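/- Let $(a_n)_{n\ge1}$ be a sequence of real numbers with $\sum_{n}|a_n|<\infty$, and let $(\lambda_n)_{n\ge1}$ be a nondecreasing sequence of real numbers with $\lambda_1=1$ and $q:=\sup_n\lambda_{n+1}/\lambda_n$ satisfying $1<q<\infty$. Put $$s_k=\Bigl(\sum_{n:\,q^k\le\lambda_n<q^{k+1}}|a_n|^2\Bigr)^{1/2},\qquad \sigma=\liminf_{k\to\infty}\frac{-\log s_k}{k\log q},\qquad \tau=\limsup_{k\to\infty}\frac{-\log s_k}{k\log q},$$ with values in $[-\infty,+\infty]$, where $-\log 0=+\infty$; assume that $\sigma$ and $\tau$ are finite. Let $(\theta_n)_{n\ge1}$ be independent random variables, each uniformly distributed on $[0,1]$, and let $$S_1(x)=\sum_{n=1}^\infty a_n\sin 2\pi(\lambda_nx+\theta_n),\qquad x\in\mathbb R.$$ For $A\subset\mathbb R$ let $G_{S_1}(A)=\{(x,S_1(x)):x\in A\}\subset\mathbb R^2$, and let $\dim_H$ denote Hausdorff dimension (with $\dim_H\emptyset=0$). Then for every Borel set $A\subset\mathbb R$: (i) If $0<\sigma\le\tau\le1$, then almost surely $$\min\Bigl\{\frac{\dim_HA}{\tau},\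 \dim_HA+1-\tau\Bigr\}\le\dim_HG_{S_1}(A)\le\min\Bigl\{\frac{\dim_HA}{\sigma},\ \dim_HA+1-\sigma\Bigr\}.$$ (ii) If $\tau=0$ and $\dim_HA>0$, then $\dim_HG_{S_1}(A)=1+\dim_HA$ almost surely. -/

import Mathlib

open MeasureTheory ProbabilityTheory Filter Set

noncomputable section

/-- The random sine series at the sample point `ω`. The sequences are indexed from `0`, so `a 0`,
`lam 0`, `θ 0` stand for the first terms of the sequences. -/
def sineSeries {Ω : Type*} (a lam : ℕ → ℝ) (θ : ℕ → Ω → ℝ) (ω : Ω) (x : ℝ) : ℝ :=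
  ∑' n, a n * Real.sin (2 * Real.pi * (lam n * x + θ n ω))

/-- `s_k`, the `ℓ²` size of the coefficients with frequency in `[q ^ k, q ^ (k + 1))`. -/
def blockNorm (a lam : ℕ → ℝ) (q : ℝ) (k : ℕ) : ℝ :=
  Real.sqrt (∑' n, {m : ℕ | q ^ k ≤ lam m ∧ lam m < q ^ (k + 1)}.indicator
    (fun m => |a m| ^ 2) n)

/-- `-log s_k / (k log q)` as an extended real number; it is `+∞` if `s_k = 0` (for `k ≥ 1`,
`q > 1`), because `ENNReal.log 0 = ⊥`. -/
def blockExponent (a lam : ℕ → ℝ) (q : ℝ) (k : ℕ) : EReal :=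
  -ENNReal.log (ENNReal.ofReal (blockNorm a lam q k)) / ((k * Real.log q : ℝ) : EReal)

/-- The lower exponent `σ`. -/
def lowerExponent (a lam : ℕ → ℝ) (q : ℝ) : EReal :=
  liminf (blockExponent a lam q) atTop

/-- The upper exponent `τ`. -/
def upperExponent (a lam : ℕ → ℝ) (q : ℝ) : EReal :=
  limsup (blockExponent a lam q) atTop

/-- The graph of `f` over `A`, in the Euclidean plane. -/
def graphOver (f : ℝ → ℝ) (A : Set ℝ) : Set (EuclideanSpace ℝ (Fin 2)) :=
  (fun x => !₂[x, f x]) '' A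

end

/-! By `sineSeries_sub`, an increment of the series over a distance h is a sum of independent terms
b_n cos 2π(c_n + θ_n), where b_n = 2 a_n sin(π λ_n (x - y)) and the c_n are deterministic.
Everything rests on two estimates for it.

Small balls. The characteristic function of the increment is a product of Bessel factors J₀(ξ b_n).
For frequencies of order 1/h the sine in b_n is bounded below, and blocks near that scale have ℓ²
norm at least h^τ' for any τ' > τ. Since |J₀(u)|^6 (1 + c u²) ≤ 1, six neighbouring blocks give the
bound (1 + c' (ξ h^τ')²)⁻¹, hence P(|increment| ≤ r) ≤ D r / h^τ'
(`exists_measure_abs_sineSeries_sub_le`). So the expected Riesz kernel of order t between two points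
of the graph is at most a constant times h^(-τ't) if t < 1, and h^(-(t+τ'-1)) if t > 1. Integrating
against a Frostman measure on A of exponent s just below dim A (`exists_frostman`) gives finite
expected energy once that exponent is below s, which is the lower bound (`ae_le_dimH_graphOver`). It
covers τ = 0 as well.

Large deviations. For 0 ≤ γ < σ and γ ≤ 1 the increment is subgaussian with variance proxy of order
h^(2γ), so when σ ≤ 1 a Kolmogorov chaining argument makes the series almost surely γ-Hölder on unit
intervals for each 0 < γ < σ (`ae_exists_holder_sineSeries`). Deterministic coverings bound the
dimension of a Hölder graph, and γ tends to σ. For τ = 0 the upper bound uses boundedness only, that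
is γ = 0. -/

open scoped ENNReal NNReal Topology

/-! ### Frostman's lemma on the line, through dyadic content and capacitability. -/

section Frostman

/-- The pair `(k, j)` naming the dyadic interval `[j / 2 ^ k, (j + 1) / 2 ^ k)` that contains `x`. -/
noncomputable def dyadicCell (k : ℕ) (x : ℝ) : ℕ × ℤ := (k, ⌊(2 : ℝ) ^ k * x⌋)

/-- The total `s`-dimensional size of a family of dyadic intervals. -/
noncomputable def dyadicWeight (s : ℝ) : Measure (ℕ × ℤ) :=
  Measure.count.withDensity fun p => ((2⁻¹ : ℝ≥0∞) ^ p.1) ^ s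

def IsDyadicCover (C : Set (ℕ × ℤ)) (E : Set ℝ) : Prop := ∀ x ∈ E, ∃ k, dyadicCell k x ∈ C

/-- The `s`-dimensional dyadic content, with intervals of length at most one. -/
noncomputable def dyadicContent (s : ℝ) (E : Set ℝ) : ℝ≥0∞ :=
  ⨅ (C : Set (ℕ × ℤ)) (_ : IsDyadicCover C E), dyadicWeight s C

/-- Dyadic intervals are nested: the index at level l is the integer quotient by 2^(k-l) of the
index at level k. -/
theorem dyadicCell_congr {k l : ℕ} (hlk : l ≤ k) {x y : ℝ} (h : dyadicCell k x = dyadicCell k y) :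
    dyadicCell l x = dyadicCell l y := by
  have key : ∀ z : ℝ, ⌊(2 : ℝ) ^ l * z⌋ = ⌊(2 : ℝ) ^ k * z⌋ / ((2 ^ (k - l) : ℕ) : ℤ) := by
    intro z
    rw [← Int.floor_div_natCast]
    congr 1
    obtain ⟨d, rfl⟩ := Nat.exists_eq_add_of_le hlk
    simp only [Nat.add_sub_cancel_left, Nat.cast_pow, Nat.cast_ofNat]
    rw [pow_add]
    field_simp
  simp only [dyadicCell, Prod.mk.injEq, true_and] at h ⊢
  rw [key x, key y, h]

theorem dyadicWeight_apply (s : ℝ) (C : Set (ℕ × ℤ)) :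
    dyadicWeight s C = ∑' p : ℕ × ℤ, C.indicator (fun p => ((2⁻¹ : ℝ≥0∞) ^ p.1) ^ s) p := by
  have hC : MeasurableSet C := C.to_countable.measurableSet
  rw [dyadicWeight, withDensity_apply _ hC, ← lintegral_indicator hC, lintegral_count]

theorem dyadicWeight_singleton (s : ℝ) (p : ℕ × ℤ) :
    dyadicWeight s {p} = ((2⁻¹ : ℝ≥0∞) ^ p.1) ^ s := by
  rw [dyadicWeight_apply, tsum_eq_single p]
  · simp
  · intro q hq
    simp [hq]

theorem dyadicContent_le {s : ℝ} {C : Set (ℕ × ℤ)} {E : Set ℝ} (h : IsDyadicCover C E) :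
    dyadicContent s E ≤ dyadicWeight s C := iInf₂_le C h

theorem exists_dyadicCover_lt {s : ℝ} {E : Set ℝ} {c : ℝ≥0∞} (h : dyadicContent s E < c) :
    ∃ C, IsDyadicCover C E ∧ dyadicWeight s C < c := by
  simpa [dyadicContent, iInf_lt_iff] using h

theorem dyadicContent_mono (s : ℝ) {E F : Set ℝ} (h : E ⊆ F) :
    dyadicContent s E ≤ dyadicContent s F :=
  le_iInf₂ fun _ hC => dyadicContent_le fun x hx => hC x (h hx)

theorem dyadicContent_union_le (s : ℝ) (E F : Set ℝ) :
    dyadicContent s (E ∪ F) ≤ dyadicContent s E + dyadicContent s F := by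
  conv_rhs => rw [dyadicContent, dyadicContent]
  refine ENNReal.le_iInf₂_add_iInf₂ fun C hC D hD => ?_
  refine (dyadicContent_le (C := C ∪ D) ?_).trans (measure_union_le _ _)
  rintro x (hx | hx)
  · obtain ⟨k, hk⟩ := hC x hx
    exact ⟨k, Or.inl hk⟩
  · obtain ⟨k, hk⟩ := hD x hx
    exact ⟨k, Or.inr hk⟩

/-- The dyadic content is continuous along increasing unions of arbitrary sets. -/
theorem dyadicContent_iUnion_le (s : ℝ) {E : ℕ → Set ℝ} (hE : Monotone E) :
    dyadicContent s (⋃ n, E n) ≤ ⨆ n, dyadicContent s (E n) := by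
  set L := ⨆ n, dyadicContent s (E n) with hL
  rcases eq_or_ne L ∞ with hLtop | hLtop
  · rw [hLtop]; exact le_top
  have hfin : ∀ n, dyadicContent s (E n) ≠ ∞ := fun n =>
    ne_top_of_le_ne_top hLtop (le_iSup (fun n => dyadicContent s (E n)) n)
  refine ENNReal.le_of_forall_pos_le_add fun ε hε _ => ?_
  obtain ⟨δ, hδ0, hδ⟩ := ENNReal.exists_pos_sum_of_countable'
    (ε := ((ε / 2 : ℝ≥0) : ℝ≥0∞)) (by simpa using hε.ne') ℕ
  have hex : ∀ n, ∃ C, IsDyadicCover C (E n) ∧ dyadicWeight s C < dyadicContent s (E n) + δ n :=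
    fun n => exists_dyadicCover_lt (ENNReal.lt_add_right (hfin n) (hδ0 n).ne')
  choose C hC hCw using hex
  have hδfin : ∀ n, δ n ≠ ∞ := fun n =>
    ne_top_of_le_ne_top (hδ.trans ENNReal.coe_lt_top).ne (ENNReal.le_tsum n)
  have hCfin : ∀ n, dyadicWeight s (C n) ≠ ∞ := fun n =>
    ((hCw n).trans_le le_top).ne
  let U : Set (ℕ × ℤ) := ⋃ n, C n
  -- The maximal intervals of the union of all near-optimal covers; they are pairwise disjoint and
  -- still cover.
  let S : Set (ℕ × ℤ) := {p | p ∈ U ∧ ∃ k x, p = dyadicCell k x ∧ ∀ l < k, dyadicCell l x ∉ U}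
  have hSmin : ∀ {k x l}, dyadicCell k x ∈ S → l < k → dyadicCell l x ∉ U := by
    rintro k x l ⟨-, k', y, hxy, hy⟩ hl
    have hk : k = k' := congrArg Prod.fst hxy
    subst hk
    rw [dyadicCell_congr hl.le hxy]
    exact hy l hl
  have hScover : IsDyadicCover S (⋃ n, E n) := by
    intro x hx
    obtain ⟨n, hn⟩ := mem_iUnion.1 hx
    obtain ⟨k, hk⟩ := hC n x hn
    have hex : ∃ k, dyadicCell k x ∈ U := ⟨k, mem_iUnion.2 ⟨n, hk⟩⟩
    classical
    exact ⟨Nat.find hex, Nat.find_spec hex, _, x, rfl, fun l hl => Nat.find_min hex hl⟩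
  -- The maximal intervals are sorted by the first cover that contains them.
  let T : ℕ → Set (ℕ × ℤ) := fun n => S ∩ disjointed C n
  have hTC : ∀ n, T n ⊆ C n := fun n => inter_subset_right.trans (disjointed_subset C n)
  have hTdisj : ∀ {i j p}, p ∈ T i → p ∈ T j → i = j := by
    intro i j p hi hj
    by_contra hij
    exact (Set.disjoint_left.1 (disjoint_disjointed C hij)) hi.2 hj.2
  -- The members of the cover `C m` that lie inside some interval of `T n`. For fixed m these
  -- families are disjoint in n, so their weights add up to at most that of `C m`.
  let Q : ℕ → ℕ → Set (ℕ × ℤ) := fun m n =>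
    {q | q ∈ C m ∧ ∃ k l x, k ≤ l ∧ q = dyadicCell l x ∧ dyadicCell k x ∈ T n}
  have hQdisj : ∀ m, Pairwise (Function.onFun Disjoint (Q m)) := by
    intro m n n' hnn
    refine Set.disjoint_left.2 ?_
    rintro q ⟨-, k, l, x, hkl, hq, hT⟩ ⟨-, k', l', x', hkl', hq', hT'⟩
    have hll : l = l' := by rw [hq] at hq'; exact congrArg Prod.fst hq'
    subst hll
    rw [hq] at hq'
    rw [← dyadicCell_congr hkl' hq'] at hT'
    have hkk : k = k' := by
      rcases lt_trichotomy k k' with h | h | h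
      · exact absurd hT.1.1 (hSmin hT'.1 h)
      · exact h
      · exact absurd hT'.1.1 (hSmin hT.1 h)
    subst hkk
    exact hnn (hTdisj hT hT')
  -- Replacing `T n` by `Q m n` inside `C n` still covers `E n`: points of `E n` are covered by `C
  -- m`, and by maximality no interval of `C m` strictly contains one of `T n`. Near-optimality of
  -- `C n` then bounds the loss by `δ n`.
  have hTQ : ∀ m n, n ≤ m → dyadicWeight s (T n) ≤ dyadicWeight s (Q m n) + δ n := by
    intro m n hnm
    have hcov : IsDyadicCover (C n \ T n ∪ Q m n) (E n) := by
      intro x hx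
      obtain ⟨k, hk⟩ := hC n x hx
      by_cases hkT : dyadicCell k x ∈ T n
      · obtain ⟨l, hl⟩ := hC m x (hE hnm hx)
        refine ⟨l, Or.inr ⟨hl, k, l, x, ?_, rfl, hkT⟩⟩
        by_contra hlt
        exact hSmin hkT.1 (not_le.1 hlt) (mem_iUnion.2 ⟨m, hl⟩)
      · exact ⟨k, Or.inl ⟨hk, hkT⟩⟩
    have h1 : dyadicWeight s (C n \ T n) + dyadicWeight s (T n) = dyadicWeight s (C n) :=
      by
      have := measure_sdiff_add_inter (μ := dyadicWeight s) (C n)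
        (T n).to_countable.measurableSet
      rwa [inter_eq_right.2 (hTC n)] at this
    have h2 : dyadicContent s (E n) ≤ dyadicWeight s (C n \ T n) + dyadicWeight s (Q m n) :=
      (dyadicContent_le hcov).trans (measure_union_le _ _)
    have h3 : dyadicWeight s (C n \ T n) ≠ ∞ :=
      ne_top_of_le_ne_top (hCfin n) (measure_mono sdiff_subset)
    refine (ENNReal.add_le_add_iff_left h3).1 ?_
    rw [h1, ← add_assoc]
    exact (hCw n).le.trans (by gcongr)
  have hST : S = ⋃ n, T n := by
    have : U = ⋃ n, disjointed C n := iUnion_disjointed.symm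
    rw [← inter_iUnion, ← this]
    exact (inter_eq_left.2 fun p hp => hp.1).symm
  refine (dyadicContent_le hScover).trans ?_
  rw [hST]
  refine (measure_iUnion_le _).trans ?_
  refine ENNReal.tsum_le_of_sum_range_le fun m => ?_
  calc ∑ n ∈ Finset.range m, dyadicWeight s (T n)
      ≤ ∑ n ∈ Finset.range m, (dyadicWeight s (Q m n) + δ n) :=
        Finset.sum_le_sum fun n hn => hTQ m n (Finset.mem_range.1 hn).le
    _ = ∑ n ∈ Finset.range m, dyadicWeight s (Q m n) + ∑ n ∈ Finset.range m, δ n :=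
        Finset.sum_add_distrib
    _ ≤ dyadicWeight s (C m) + ∑' n, δ n := by
        refine add_le_add ?_ (ENNReal.sum_le_tsum _)
        rw [← measure_biUnion_finset (fun i _ j _ hij => hQdisj m hij)
          (fun n _ => (Q m n).to_countable.measurableSet)]
        exact measure_mono (iUnion₂_subset fun n _ q hq => hq.1)
    _ ≤ (L + δ m) + ∑' n, δ n := by
        gcongr
        exact (hCw m).le.trans (by gcongr; exact le_iSup (fun n => dyadicContent s (E n)) m)
    _ ≤ (L + ((ε / 2 : ℝ≥0) : ℝ≥0∞)) + ((ε / 2 : ℝ≥0) : ℝ≥0∞) := by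
        gcongr
        exact (ENNReal.le_tsum m).trans hδ.le
    _ = L + ε := by
        rw [add_assoc, ← ENNReal.coe_add, add_halves]

theorem mem_dyadic_Ico (k : ℕ) (x : ℝ) :
    x ∈ Ico ((dyadicCell k x).2 / (2 : ℝ) ^ k) (((dyadicCell k x).2 + 1) / (2 : ℝ) ^ k) := by
  have h2 : (0 : ℝ) < 2 ^ k := by positivity
  simp only [dyadicCell, mem_Ico]
  rw [div_le_iff₀ h2, lt_div_iff₀ h2, mul_comm x]
  exact ⟨Int.floor_le _, Int.lt_floor_add_one _⟩

/-- In a cover of weight below ε every interval is shorter than ε^(1/s), so covers of small weight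
are automatically fine. -/
theorem hausdorffMeasure_eq_zero_of_dyadicContent {s : ℝ} (hs : 0 < s) {E : Set ℝ}
    (h : dyadicContent s E = 0) : μH[s] E = 0 := by
  have hex : ∀ n : ℕ, ∃ C, IsDyadicCover C E ∧ dyadicWeight s C < ((n : ℝ≥0∞) + 1)⁻¹ := fun n =>
    exists_dyadicCover_lt (by rw [h]; simp)
  choose C hC hCw using hex
  have hlim : Tendsto (fun n : ℕ => ((n : ℝ≥0∞) + 1)⁻¹) atTop (𝓝 0) := by
    have := (ENNReal.tendsto_inv_nat_nhds_zero).comp (tendsto_add_atTop_nat 1)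
    simpa [Function.comp_def] using this
  have hlim' : Tendsto (fun n : ℕ => (((n : ℝ≥0∞) + 1)⁻¹) ^ s⁻¹) atTop (𝓝 0) := by
    have := (ENNReal.continuous_rpow_const (y := s⁻¹)).tendsto (0 : ℝ≥0∞) |>.comp hlim
    simpa [Function.comp_def, ENNReal.zero_rpow_of_pos (inv_pos.2 hs)] using this
  have hdiam : ∀ p : ℕ × ℤ, Metric.ediam (Ico (p.2 / (2 : ℝ) ^ p.1) ((p.2 + 1) / (2 : ℝ) ^ p.1))
      = (2⁻¹ : ℝ≥0∞) ^ p.1 := by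
    intro p
    rw [Real.ediam_Ico, ← sub_div, add_sub_cancel_left, ← inv_eq_one_div, ← inv_pow,
      ENNReal.ofReal_pow (by norm_num), ENNReal.ofReal_inv_of_pos (by norm_num)]
    simp
  have key := Measure.hausdorffMeasure_le_liminf_tsum (β := ℕ) (ι := fun n => C n) s E (l := atTop)
    (fun n : ℕ => (((n : ℝ≥0∞) + 1)⁻¹) ^ s⁻¹) hlim'
    (fun n p => Ico (p.1.2 / (2 : ℝ) ^ p.1.1) ((p.1.2 + 1) / (2 : ℝ) ^ p.1.1))
    (Eventually.of_forall fun n p => by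
      rw [hdiam, ENNReal.le_rpow_inv_iff hs, ← dyadicWeight_singleton]
      exact (measure_mono (singleton_subset_iff.2 p.2)).trans (hCw n).le)
    (Eventually.of_forall fun n x hx => by
      obtain ⟨k, hk⟩ := hC n x hx
      exact mem_iUnion.2 ⟨⟨_, hk⟩, mem_dyadic_Ico k x⟩)
  refine le_antisymm (key.trans ?_) zero_le
  simp only [hdiam]
  have h0 : liminf (fun n : ℕ => ((n : ℝ≥0∞) + 1)⁻¹) atTop = 0 := hlim.liminf_eq
  rw [← h0]
  refine liminf_le_liminf (Eventually.of_forall fun n => ?_)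
  refine le_trans (le_of_eq ?_) (hCw n).le
  rw [dyadicWeight_apply, tsum_subtype (C n) (fun p : ℕ × ℤ => ((2⁻¹ : ℝ≥0∞) ^ p.1) ^ s)]

theorem dyadicWeight_preimage_shift (s : ℝ) (i : ℤ) (C : Set (ℕ × ℤ)) :
    dyadicWeight s {p | (p.1, p.2 + i) ∈ C} = dyadicWeight s C := by
  rw [dyadicWeight_apply, dyadicWeight_apply]
  exact ((Equiv.refl ℕ).prodCongr (Equiv.addRight i)).tsum_eq
    (C.indicator fun p => ((2⁻¹ : ℝ≥0∞) ^ p.1) ^ s)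

/-- A cover of small weight gives an open neighbourhood of small content. -/
theorem exists_isOpen_dyadicContent_le {s : ℝ} {C : Set (ℕ × ℤ)} {E : Set ℝ}
    (hC : IsDyadicCover C E) :
    ∃ U, IsOpen U ∧ E ⊆ U ∧ dyadicContent s U ≤ 3 * dyadicWeight s C := by
  -- Each interval is enlarged by its own length on both sides; the result meets three dyadic
  -- intervals of the same level, whence the factor 3.
  refine ⟨⋃ p ∈ C, Ioo ((p.2 - 1) / (2 : ℝ) ^ p.1) ((p.2 + 2) / (2 : ℝ) ^ p.1),
    isOpen_biUnion fun _ _ => isOpen_Ioo, fun x hx => ?_, ?_⟩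
  · obtain ⟨k, hk⟩ := hC x hx
    refine mem_biUnion hk ?_
    have h := mem_dyadic_Ico k x
    have h2 : (0 : ℝ) < 2 ^ k := by positivity
    have e : (dyadicCell k x).1 = k := rfl
    rw [e]
    exact ⟨lt_of_lt_of_le (by gcongr; linarith) h.1, h.2.trans (by gcongr; norm_num)⟩
  · refine (dyadicContent_le (C := {p | (p.1, p.2 + (-1)) ∈ C} ∪
      ({p | (p.1, p.2 + 0) ∈ C} ∪ {p | (p.1, p.2 + 1) ∈ C})) ?_).trans ?_
    · intro x hx
      obtain ⟨p, hp, hx⟩ := mem_iUnion₂.1 hx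
      obtain ⟨k, j⟩ := p
      refine ⟨k, ?_⟩
      have h2 : (0 : ℝ) < 2 ^ k := by positivity
      simp only [mem_Ioo] at hx
      rw [div_lt_iff₀ h2, lt_div_iff₀ h2] at hx
      have h1 : j - 1 ≤ ⌊(2 : ℝ) ^ k * x⌋ := by
        rw [Int.le_floor]; push_cast; linarith
      have h3 : ⌊(2 : ℝ) ^ k * x⌋ < j + 2 := by
        rw [Int.floor_lt]; push_cast; linarith
      have h4 : ⌊(2 : ℝ) ^ k * x⌋ = j - 1 ∨ ⌊(2 : ℝ) ^ k * x⌋ = j ∨ ⌊(2 : ℝ) ^ k * x⌋ = j + 1 := by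
        omega
      simp only [dyadicCell, mem_union, mem_ofPred_eq]
      rcases h4 with h | h | h
      · exact Or.inr (Or.inr (by rw [h]; simpa using hp))
      · exact Or.inr (Or.inl (by rw [h]; simpa using hp))
      · exact Or.inl (by rw [h]; simpa using hp)
    · refine (measure_union_le _ _).trans ?_
      refine (add_le_add le_rfl (measure_union_le _ _)).trans (le_of_eq ?_)
      simp only [dyadicWeight_preimage_shift]
      ring

/-- Capacitability of analytic sets for the dyadic content. -/
theorem exists_isCompact_dyadicContent {s : ℝ} {A : Set ℝ} (hA : AnalyticSet A) {c : ℝ≥0∞}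
    (hc : c < dyadicContent s A) :
    ∃ K ⊆ A, IsCompact K ∧ c ≤ 3 * dyadicContent s K := by
  rw [AnalyticSet] at hA
  rcases hA with rfl | ⟨f, hf, rfl⟩
  · exact ⟨∅, Subset.rfl, isCompact_empty, hc.le.trans (le_mul_of_one_le_left' (by norm_num))⟩
  -- Choquet's scheme: A is a continuous image of Baire space, and the coordinates are bounded one
  -- at a time. Continuity of the content along increasing unions keeps it above c at every stage.
  let S : ℕ → (ℕ → ℕ) → Set (ℕ → ℕ) := fun m v => {z | ∀ i < m, z i ≤ v i}
  have step : ∀ m v, c < dyadicContent s (f '' S m v) →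
      ∃ N, c < dyadicContent s (f '' S (m + 1) (Function.update v m N)) := by
    intro m v h
    have hU : S m v = ⋃ N, S (m + 1) (Function.update v m N) := by
      ext z
      simp only [S, mem_ofPred_eq, mem_iUnion]
      constructor
      · intro hz
        refine ⟨z m, fun i hi => ?_⟩
        rcases Nat.lt_succ_iff_lt_or_eq.1 hi with hi | rfl
        · rw [Function.update_of_ne hi.ne]; exact hz i hi
        · simp
      · rintro ⟨N, hN⟩ i hi
        have := hN i (by omega)
        rwa [Function.update_of_ne hi.ne] at this
    have hmono : Monotone fun N => f '' S (m + 1) (Function.update v m N) := by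
      intro N N' hN
      refine image_mono fun z hz i hi => (hz i hi).trans ?_
      rcases eq_or_ne i m with rfl | him
      · simpa using hN
      · simp [Function.update_of_ne him]
    rw [hU, image_iUnion] at h
    exact lt_iSup_iff.1 (h.trans_le (dyadicContent_iUnion_le s hmono))
  choose! g hg using step
  let V : ℕ → ℕ → ℕ := fun m => Nat.rec 0 (fun m v => Function.update v m (g m v)) m
  have hVs : ∀ m, V (m + 1) = Function.update (V m) m (g m (V m)) := fun m => rfl
  have hV : ∀ m, c < dyadicContent s (f '' S m (V m)) := by
    intro m
    induction m with
    | zero =>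
      have : S 0 (V 0) = univ := by ext; simp [S]
      rwa [this, image_univ]
    | succ m ih => rw [hVs]; exact hg m _ ih
  let b : ℕ → ℕ := fun i => V (i + 1) i
  have hVb : ∀ m i, i < m → V m i = b i := by
    intro m
    induction m with
    | zero => intro i hi; omega
    | succ m ih =>
      intro i hi
      rcases Nat.lt_succ_iff_lt_or_eq.1 hi with hi | rfl
      · rw [hVs, Function.update_of_ne hi.ne, ih i hi]
      · rfl
  have hSb : ∀ m, S m (V m) = S m b := fun m => by
    ext z
    exact forall₂_congr fun i hi => by rw [hVb m i hi]
  let T : Set (ℕ → ℕ) := univ.pi fun i => Iic (b i)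
  have hT : IsCompact T := isCompact_univ_pi fun i => (finite_Iic (b i)).isCompact
  refine ⟨f '' T, image_subset_range _ _, hT.image hf, ?_⟩
  by_contra hlt
  rw [not_le] at hlt
  have h3 : dyadicContent s (f '' T) < c / 3 := by
    rw [ENNReal.lt_div_iff_mul_lt (by simp) (by simp), mul_comm]
    exact hlt
  obtain ⟨C, hC, hCw⟩ := exists_dyadicCover_lt h3
  obtain ⟨U, hUo, hTU, hU⟩ := exists_isOpen_dyadicContent_le (s := s) hC
  have hUc : dyadicContent s U < c := by
    refine hU.trans_lt ?_
    rw [mul_comm]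
    exact (ENNReal.lt_div_iff_mul_lt (by simp) (by simp)).1 hCw
  -- The set `f '' S m b` has content above c, so it cannot lie in `U`. Only the first m coordinates
  -- of its points are bounded, hence the truncation by b below: truncations live in the compact
  -- `T`, and each coordinate is eventually untruncated, so a subsequence of the points themselves
  -- converges into `T`.
  have hnot : ∀ m, ∃ z ∈ S m b, f z ∉ U := by
    intro m
    by_contra! hsub
    have := dyadicContent_mono s (show f '' S m b ⊆ U from image_subset_iff.2 hsub)
    rw [← hSb] at this
    exact absurd (hV m) (not_lt.2 (this.trans hUc.le))
  choose z hzS hzU using hnot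
  obtain ⟨y, hyT, φ, hφ, hlim⟩ := hT.tendsto_subseq (x := fun m i => min (z m i) (b i))
    (fun m i _ => mem_Iic.2 (min_le_right (z m i) (b i)))
  have hlim' : Tendsto (fun m => z (φ m)) atTop (𝓝 y) := by
    rw [tendsto_pi_nhds] at hlim ⊢
    intro i
    refine (hlim i).congr' ?_
    filter_upwards [eventually_gt_atTop i] with m hm
    exact min_eq_left (hzS (φ m) i (hm.trans_le (hφ.id_le m)))
  have hfy : f y ∈ U := hTU (mem_image_of_mem f hyT)
  have := ((hf.tendsto y).comp hlim').eventually (hUo.mem_nhds hfy)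
  obtain ⟨m, hm⟩ := this.exists
  exact hzU _ hm

theorem dyadicContent_Icc_lt_top (s x y : ℝ) : dyadicContent s (Icc x y) < ∞ := by
  let C : Finset (ℕ × ℤ) := {0} ×ˢ Finset.Icc ⌊x⌋ ⌊y⌋
  have hcov : IsDyadicCover (C : Set (ℕ × ℤ)) (Icc x y) := by
    intro z hz
    refine ⟨0, ?_⟩
    simp only [C, dyadicCell, pow_zero, one_mul, Finset.coe_product, mem_prod, Finset.coe_singleton,
      mem_singleton_iff, true_and, Finset.coe_Icc, mem_Icc]
    exact ⟨Int.floor_mono hz.1, Int.floor_mono hz.2⟩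
  refine (dyadicContent_le hcov).trans_lt ?_
  rw [dyadicWeight, withDensity_apply _ C.measurableSet]
  rw [← lintegral_indicator C.measurableSet, lintegral_count, ← tsum_subtype]
  refine (Finset.tsum_subtype' C fun p : ℕ × ℤ => ((2⁻¹ : ℝ≥0∞) ^ p.1) ^ s).trans_lt ?_
  refine ENNReal.sum_lt_top.2 fun p hp => ?_
  have : p.1 = 0 := by
    have := (Finset.mem_product.1 hp).1
    simpa using this
  simp [this]

/-- An interval of length at most 2^(-k) meets at most two dyadic intervals of level k; k is taken
maximal. -/
theorem dyadicContent_Icc_le {s : ℝ} (hs : 0 ≤ s) {x y : ℝ} (hxy : x < y) (hy : y ≤ x + 1) :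
    dyadicContent s (Icc x y) ≤ ENNReal.ofReal (2 * 2 ^ s * (y - x) ^ s) := by
  obtain ⟨k, hk1, hk2⟩ := exists_nat_pow_near_of_lt_one (sub_pos.2 hxy) (by linarith : y - x ≤ 1)
    (by norm_num : (0 : ℝ) < 2⁻¹) (by norm_num)
  have hcov : IsDyadicCover ({(k, ⌊(2 : ℝ) ^ k * x⌋)} ∪ {(k, ⌊(2 : ℝ) ^ k * x⌋ + 1)})
      (Icc x y) := by
    intro z hz
    refine ⟨k, ?_⟩
    have h2 : (0 : ℝ) < 2 ^ k := by positivity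
    have h1 : ⌊(2 : ℝ) ^ k * x⌋ ≤ ⌊(2 : ℝ) ^ k * z⌋ := Int.floor_mono (by gcongr; exact hz.1)
    have h3 : ⌊(2 : ℝ) ^ k * z⌋ < ⌊(2 : ℝ) ^ k * x⌋ + 2 := by
      rw [Int.floor_lt]
      push_cast
      have h4 : (2 : ℝ) ^ k * (z - x) ≤ 1 := by
        calc (2 : ℝ) ^ k * (z - x) ≤ 2 ^ k * (2⁻¹) ^ k := by
              gcongr; exact (sub_le_sub_right hz.2 x).trans hk2
          _ = 1 := by rw [← mul_pow]; norm_num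
      have h5 := Int.lt_floor_add_one ((2 : ℝ) ^ k * x)
      nlinarith
    have h4 : ⌊(2 : ℝ) ^ k * z⌋ = ⌊(2 : ℝ) ^ k * x⌋ ∨ ⌊(2 : ℝ) ^ k * z⌋ = ⌊(2 : ℝ) ^ k * x⌋ + 1 := by
      omega
    rcases h4 with h | h <;> simp [dyadicCell, h]
  refine (dyadicContent_le hcov).trans ((measure_union_le _ _).trans ?_)
  rw [dyadicWeight_singleton, dyadicWeight_singleton, ← two_mul]
  have h2 : ((2⁻¹ : ℝ≥0∞) ^ k) = ENNReal.ofReal ((2⁻¹ : ℝ) ^ k) := by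
    rw [ENNReal.ofReal_pow (by norm_num), ENNReal.ofReal_inv_of_pos (by norm_num)]
    simp
  have h3 : (2 : ℝ≥0∞) = ENNReal.ofReal 2 := by simp
  rw [h2, ENNReal.ofReal_rpow_of_nonneg (by positivity) hs, h3,
    ← ENNReal.ofReal_mul (by norm_num)]
  refine ENNReal.ofReal_le_ofReal ?_
  rw [mul_assoc, ← Real.mul_rpow (by norm_num) (sub_pos.2 hxy).le]
  gcongr
  rw [pow_succ] at hk1
  linarith

/-- On the line the measure can be written down: it is the Stieltjes measure of F(x) = content of K
∩ (-∞, x], for a compact K ⊆ A of positive content. Subadditivity gives F(y) - F(x) ≤ content of K ∩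
(x, y], which yields right continuity, the growth bound, and the absence of mass off K; the total
mass is the content of K. -/
theorem exists_frostman {A : Set ℝ} (hA : MeasurableSet A) {s : ℝ} (hs : 0 < s)
    (h : ENNReal.ofReal s < dimH A) :
    ∃ μ : Measure ℝ, IsFiniteMeasure μ ∧ μ A ≠ 0 ∧
      ∃ C : ℝ, 0 < C ∧ ∀ x r, 0 < r → μ (Metric.closedBall x r) ≤ ENNReal.ofReal (C * r ^ s) := by
  have hpos : 0 < dyadicContent s A := by
    rw [pos_iff_ne_zero]
    intro h0
    have h1 := hausdorffMeasure_of_lt_dimH (d := s.toNNReal) h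
    rw [Real.coe_toNNReal s hs.le, hausdorffMeasure_eq_zero_of_dyadicContent hs h0] at h1
    simp at h1
  obtain ⟨c, hc0, hc⟩ := exists_between hpos
  obtain ⟨K, hKA, hK, hcK⟩ := exists_isCompact_dyadicContent hA.analyticSet hc
  have hK0 : dyadicContent s K ≠ 0 := by
    rintro h0
    rw [h0, mul_zero] at hcK
    exact hc0.ne' (le_antisymm hcK zero_le)
  obtain ⟨R, hR0, hR⟩ : ∃ R : ℝ, 0 < R ∧ K ⊆ Ioc (-R) R := by
    obtain ⟨R, hR⟩ := hK.isBounded.subset_closedBall 0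
    refine ⟨max R 0 + 1, by positivity, fun x hx => ?_⟩
    have h2 := hR hx
    rw [Real.closedBall_eq_Icc, mem_Icc] at h2
    exact ⟨by linarith [le_max_left R 0], by linarith [le_max_left R 0]⟩
  have hfin : ∀ E ⊆ K, dyadicContent s E ≠ ∞ := fun E hE =>
    ne_top_of_le_ne_top (dyadicContent_Icc_lt_top s (-R) R).ne
      (dyadicContent_mono s (hE.trans (hR.trans Ioc_subset_Icc_self)))
  set D : ℝ := 2 * 2 ^ s with hD
  have hD0 : 0 < D := by positivity
  let F : ℝ → ℝ := fun x => (dyadicContent s (K ∩ Iic x)).toReal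
  have hFmono : Monotone F := fun x y hxy =>
    ENNReal.toReal_mono (hfin _ inter_subset_left)
      (dyadicContent_mono s (inter_subset_inter_right _ (Iic_subset_Iic.2 hxy)))
  have hFsub : ∀ x y, x ≤ y → F y ≤ F x + (dyadicContent s (K ∩ Ioc x y)).toReal := by
    intro x y hxy
    rw [← ENNReal.toReal_add (hfin _ inter_subset_left) (hfin _ inter_subset_left)]
    refine ENNReal.toReal_mono (ENNReal.add_ne_top.2 ⟨hfin _ inter_subset_left,
      hfin _ inter_subset_left⟩) ?_
    refine le_trans (le_of_eq ?_) (dyadicContent_union_le _ _ _)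
    rw [← inter_union_distrib_left, Iic_union_Ioc_eq_Iic hxy]
  have hFle : ∀ x y, x < y → y ≤ x + 1 → F y ≤ F x + D * (y - x) ^ s := by
    intro x y hxy hy
    refine (hFsub x y hxy.le).trans (by
      gcongr
      refine ENNReal.toReal_le_of_le_ofReal
        (mul_nonneg hD0.le (Real.rpow_nonneg (sub_pos.2 hxy).le _)) ?_
      exact (dyadicContent_mono s (inter_subset_right.trans Ioc_subset_Icc_self)).trans
        (dyadicContent_Icc_le hs.le hxy hy))
  have hFrc : ∀ x, ContinuousWithinAt F (Ici x) x := by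
    intro x
    rw [← continuousWithinAt_Ioi_iff_Ici]
    have hlim : Tendsto (fun y => F x + D * (y - x) ^ s) (𝓝[>] x) (𝓝 (F x)) := by
      have : Continuous fun y : ℝ => F x + D * (y - x) ^ s :=
        continuous_const.add (continuous_const.mul
          ((continuous_id.sub continuous_const).rpow_const fun _ => Or.inr hs.le))
      have h2 := (this.tendsto x).mono_left (nhdsWithin_le_nhds (s := Ioi x))
      simpa [Real.zero_rpow hs.ne'] using h2
    refine tendsto_of_tendsto_of_tendsto_of_le_of_le' tendsto_const_nhds hlim ?_ ?_
    · filter_upwards [self_mem_nhdsWithin] with y hy using hFmono (le_of_lt hy)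
    · filter_upwards [Ioo_mem_nhdsGT (show x < x + 1 by linarith)] with y hy
      exact hFle x y hy.1 hy.2.le
  let G : StieltjesFunction ℝ := ⟨F, hFmono, hFrc⟩
  have hG : ∀ x y, G.measure (Ioc x y) = ENNReal.ofReal (F y - F x) := fun x y =>
    G.measure_Ioc x y
  have hKc : G.measure Kᶜ = 0 := by
    refine measure_null_of_locally_null _ fun x hx => ?_
    obtain ⟨ε, hε, hsub⟩ := Metric.isOpen_iff.1 hK.isClosed.isOpen_compl x hx
    rw [Real.ball_eq_Ioo] at hsub
    refine ⟨Ioc (x - ε / 2) (x + ε / 2), mem_nhdsWithin_of_mem_nhds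
      (Ioc_mem_nhds (by linarith) (by linarith)), ?_⟩
    have hempty : K ∩ Ioc (x - ε / 2) (x + ε / 2) = ∅ := by
      ext y
      simp only [mem_inter_iff, mem_Ioc, mem_empty_iff_false, iff_false, not_and]
      intro hy h1 h2
      exact hsub ⟨by linarith, by linarith⟩ hy
    have h0 : dyadicContent s (∅ : Set ℝ) = 0 := by
      refine le_antisymm ((dyadicContent_le (C := ∅) fun x hx => hx.elim).trans ?_) zero_le
      simp
    have h1 := hFsub (x - ε / 2) (x + ε / 2) (by linarith)
    rw [hempty, h0, ENNReal.toReal_zero, add_zero] at h1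
    rw [hG, ENNReal.ofReal_eq_zero]
    linarith
  have hFR : F R = (dyadicContent s K).toReal := by
    simp only [F]
    rw [inter_eq_left.2 (hR.trans Ioc_subset_Iic_self)]
  have hFR' : F (-R) = 0 := by
    have hempty : K ∩ Iic (-R) = ∅ := by
      ext y
      simp only [mem_inter_iff, mem_Iic, mem_empty_iff_false, iff_false, not_and, not_le]
      exact fun hy => (hR hy).1
    have h0 : dyadicContent s (∅ : Set ℝ) = 0 := by
      refine le_antisymm ((dyadicContent_le (C := ∅) fun x hx => hx.elim).trans ?_) zero_le
      simp
    simp only [F]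
    rw [hempty, h0, ENNReal.toReal_zero]
  have huniv : G.measure univ ≤ G.measure (Ioc (-R) R) := by
    calc G.measure univ ≤ G.measure (Kᶜ ∪ Ioc (-R) R) :=
          measure_mono fun x _ => (em (x ∈ K)).elim (fun h => Or.inr (hR h)) Or.inl
      _ ≤ G.measure Kᶜ + G.measure (Ioc (-R) R) := measure_union_le _ _
      _ = G.measure (Ioc (-R) R) := by rw [hKc, zero_add]
  set M : ℝ := (dyadicContent s K).toReal with hM
  have hM0 : 0 < M := ENNReal.toReal_pos hK0 (hfin K Subset.rfl)
  have hIoc : G.measure (Ioc (-R) R) = ENNReal.ofReal M := by rw [hG, hFR, hFR', sub_zero]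
  refine ⟨G.measure, ⟨huniv.trans_lt (by rw [hIoc]; exact ENNReal.ofReal_lt_top)⟩, ?_, ?_⟩
  · intro h0
    have h1 : G.measure (Ioc (-R) R) ≤ G.measure Kᶜ + G.measure A :=
      (measure_mono fun x _ => (em (x ∈ K)).elim (fun h => Or.inr (hKA h)) Or.inl).trans
        (measure_union_le _ _)
    rw [hKc, h0, zero_add, hIoc, nonpos_iff_eq_zero, ENNReal.ofReal_eq_zero] at h1
    linarith
  · refine ⟨max (D * 3 ^ s) (M * 3 ^ s), lt_max_of_lt_left (by positivity), fun x r hr => ?_⟩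
    -- The ball sits in the half-open interval (x - 2r, x + r] of length 3r. For larger radii the
    -- total mass suffices.
    rcases le_or_gt (3 * r) 1 with h3 | h3
    · calc G.measure (Metric.closedBall x r) ≤ G.measure (Ioc (x - 2 * r) (x + r)) := by
            refine measure_mono fun y hy => ?_
            rw [Real.closedBall_eq_Icc, mem_Icc] at hy
            exact ⟨by linarith, hy.2⟩
        _ = ENNReal.ofReal (F (x + r) - F (x - 2 * r)) := hG _ _
        _ ≤ ENNReal.ofReal (max (D * 3 ^ s) (M * 3 ^ s) * r ^ s) := by
            refine ENNReal.ofReal_le_ofReal ?_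
            have h4 := hFle (x - 2 * r) (x + r) (by linarith) (by linarith)
            rw [show x + r - (x - 2 * r) = 3 * r by ring, Real.mul_rpow (by norm_num) hr.le] at h4
            have h5 : D * 3 ^ s * r ^ s ≤ max (D * 3 ^ s) (M * 3 ^ s) * r ^ s := by
              gcongr; exact le_max_left _ _
            linarith
    · calc G.measure (Metric.closedBall x r) ≤ ENNReal.ofReal M := by
            rw [← hIoc]; exact (measure_mono (subset_univ _)).trans huniv
        _ ≤ ENNReal.ofReal (max (D * 3 ^ s) (M * 3 ^ s) * r ^ s) := by
            refine ENNReal.ofReal_le_ofReal ?_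
            have h4 : 1 ≤ (3 * r) ^ s := Real.one_le_rpow h3.le hs.le
            rw [Real.mul_rpow (by norm_num) hr.le] at h4
            calc M = M * 1 := (mul_one M).symm
              _ ≤ M * (3 ^ s * r ^ s) := by gcongr
              _ = M * 3 ^ s * r ^ s := by ring
              _ ≤ _ := by gcongr; exact le_max_right _ _

end Frostman

/-! ### Negative moments from small-ball bounds. -/

section LayerCake

variable {Ω : Type*} [MeasurableSpace Ω]

/-- For α > 0, where f vanishes the extended power is ∞ but the real power takes the default value
0; the small-ball bound makes that set null, so the layer-cake formula applies. -/
theorem lintegral_ofReal_rpow_neg_le {μ : Measure Ω} {f : Ω → ℝ} (hf : Measurable f)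
    (hf0 : ∀ ω, 0 ≤ f ω) {B κ α : ℝ} (hκ : 0 < κ)
    (hB : ∀ r, 0 < r → μ {ω | f ω ≤ r} ≤ ENNReal.ofReal (B * r ^ κ)) :
    ∫⁻ ω, ENNReal.ofReal (f ω) ^ (-α) ∂μ ≤ ∫⁻ t in Ioi (0 : ℝ), μ {ω | t ≤ f ω ^ (-α)} := by
  have hzero : μ {ω | f ω = 0} = 0 := by
    have hlim : Tendsto (fun r : ℝ => ENNReal.ofReal (B * r ^ κ)) (𝓝[>] 0) (𝓝 0) := by
      have h1 : Continuous fun r : ℝ => ENNReal.ofReal (B * r ^ κ) :=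
        ENNReal.continuous_ofReal.comp
          (continuous_const.mul (continuous_id.rpow_const fun _ => Or.inr hκ.le))
      simpa [Real.zero_rpow hκ.ne'] using (h1.tendsto 0).mono_left (nhdsWithin_le_nhds (s := Ioi 0))
    refine le_antisymm (ge_of_tendsto hlim ?_) zero_le
    filter_upwards [self_mem_nhdsWithin] with r hr
    refine (measure_mono fun ω hω => ?_).trans (hB r hr)
    have h1 : f ω = 0 := hω
    have h2 : (0 : ℝ) < r := hr
    show f ω ≤ r
    rw [h1]; exact h2.le
  rw [← lintegral_eq_lintegral_meas_le μ (Eventually.of_forall fun ω => Real.rpow_nonneg (hf0 ω) _)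
    (hf.pow_const _).aemeasurable]
  refine lintegral_mono_ae ?_
  have hae : ∀ᵐ ω ∂μ, f ω ≠ 0 := by rw [ae_iff]; simpa using hzero
  filter_upwards [hae] with ω hω
  rw [ENNReal.ofReal_rpow_of_pos (lt_of_le_of_ne (hf0 ω) (Ne.symm hω))]

theorem measure_le_rpow_neg_le {μ : Measure Ω} {f : Ω → ℝ}
    (hf0 : ∀ ω, 0 ≤ f ω) {B κ α : ℝ} (hα : 0 < α)
    (hB : ∀ r, 0 < r → μ {ω | f ω ≤ r} ≤ ENNReal.ofReal (B * r ^ κ)) {t : ℝ} (ht : 0 < t) :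
    μ {ω | t ≤ f ω ^ (-α)} ≤ ENNReal.ofReal (B * t ^ (-(κ / α))) := by
  refine (measure_mono fun ω (hω : t ≤ f ω ^ (-α)) => ?_).trans
    ((hB (t ^ (-α⁻¹)) (Real.rpow_pos_of_pos ht _)).trans_eq ?_)
  · show f ω ≤ t ^ (-α⁻¹)
    rcases (hf0 ω).eq_or_lt with h0 | h0
    · rw [← h0]; positivity
    · have h1 := Real.rpow_le_rpow_of_nonpos ht hω (neg_nonpos.2 (inv_nonneg.2 hα.le))
      rwa [← Real.rpow_mul h0.le, neg_mul_neg, mul_inv_cancel₀ hα.ne', Real.rpow_one] at h1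
  · rw [← Real.rpow_mul ht.le]
    congr 3
    field_simp

/-- The layer-cake integral is cut at T: total mass below, a tail integrable because κ/α > 1 above.
T stays free so that it can be adapted to the scale of f. -/
theorem lintegral_rpow_neg_le_of_lt {μ : Measure Ω} {f : Ω → ℝ} (hf : Measurable f)
    (hf0 : ∀ ω, 0 ≤ f ω) {B κ α T : ℝ} (hB0 : 0 ≤ B) (hα : 0 < α) (hακ : α < κ) (hT : 0 < T)
    (hB : ∀ r, 0 < r → μ {ω | f ω ≤ r} ≤ ENNReal.ofReal (B * r ^ κ)) :
    ∫⁻ ω, ENNReal.ofReal (f ω) ^ (-α) ∂μ ≤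
      ENNReal.ofReal T * μ univ + ENNReal.ofReal (B * (T ^ (1 - κ / α) / (κ / α - 1))) := by
  have hκα : 1 < κ / α := by rwa [one_lt_div hα]
  refine (lintegral_ofReal_rpow_neg_le hf hf0 (hα.trans hακ) hB).trans ?_
  rw [← Ioc_union_Ioi_eq_Ioi hT.le]
  refine (lintegral_union_le _ _ _).trans (add_le_add ?_ ?_)
  · calc ∫⁻ t in Ioc 0 T, μ {ω | t ≤ f ω ^ (-α)} ≤ ∫⁻ _ in Ioc 0 T, μ univ :=
          lintegral_mono fun t => measure_mono (subset_univ _)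
      _ = ENNReal.ofReal T * μ univ := by
          rw [lintegral_const, Measure.restrict_apply_univ, Real.volume_Ioc, sub_zero, mul_comm]
  · calc ∫⁻ t in Ioi T, μ {ω | t ≤ f ω ^ (-α)}
        ≤ ∫⁻ t in Ioi T, ENNReal.ofReal (B * t ^ (-(κ / α))) :=
          setLIntegral_mono' measurableSet_Ioi fun t ht =>
            measure_le_rpow_neg_le hf0 hα hB (hT.trans ht)
      _ = ENNReal.ofReal (∫ t in Ioi T, B * t ^ (-(κ / α))) := by
          rw [ofReal_integral_eq_lintegral_ofReal]
          · exact ((integrableOn_Ioi_rpow_of_lt (by linarith) hT).const_mul B)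
          · filter_upwards [ae_restrict_mem measurableSet_Ioi] with t ht
            exact mul_nonneg hB0 (Real.rpow_nonneg (hT.trans ht).le _)
      _ = _ := by
          rw [integral_const_mul, integral_Ioi_rpow_of_lt (by linarith) hT,
            show -(κ / α) + 1 = -(κ / α - 1) by ring, neg_div_neg_eq,
            show -(κ / α - 1) = 1 - κ / α by ring]

/-- The lower bound h on f empties the levels above h^(-α), and below them t^(-κ/α) is integrable at
0 because κ < α. -/
theorem lintegral_rpow_neg_le_of_gt {μ : Measure Ω} {f : Ω → ℝ} (hf : Measurable f)
    {h : ℝ} (hh : 0 < h) (hf0 : ∀ ω, h ≤ f ω) {B κ α : ℝ} (hB0 : 0 ≤ B) (hκ : 0 < κ) (hακ : κ < α)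
    (hB : ∀ r, 0 < r → μ {ω | f ω ≤ r} ≤ ENNReal.ofReal (B * r ^ κ)) :
    ∫⁻ ω, ENNReal.ofReal (f ω) ^ (-α) ∂μ ≤
      ENNReal.ofReal (B * (h ^ (κ - α) / (1 - κ / α))) := by
  have hα : 0 < α := hκ.trans hακ
  have hκα : κ / α < 1 := by rwa [div_lt_one hα]
  have hf0' : ∀ ω, 0 ≤ f ω := fun ω => hh.le.trans (hf0 ω)
  set T := h ^ (-α) with hT'
  have hT : 0 < T := Real.rpow_pos_of_pos hh _
  refine (lintegral_ofReal_rpow_neg_le hf hf0' hκ hB).trans ?_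
  rw [← Ioc_union_Ioi_eq_Ioi hT.le]
  refine (lintegral_union_le _ _ _).trans ?_
  have h2 : ∫⁻ t in Ioi T, μ {ω | t ≤ f ω ^ (-α)} = 0 := by
    rw [setLIntegral_congr_fun measurableSet_Ioi (g := fun _ => 0)]
    · simp
    · intro t ht
      have : {ω | t ≤ f ω ^ (-α)} = ∅ := by
        ext ω
        simp only [mem_ofPred_eq, mem_empty_iff_false, iff_false, not_le]
        exact (Real.rpow_le_rpow_of_nonpos hh (hf0 ω) (by linarith)).trans_lt ht
      simp only [this, measure_empty]
  rw [h2, add_zero]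
  calc ∫⁻ t in Ioc 0 T, μ {ω | t ≤ f ω ^ (-α)}
      ≤ ∫⁻ t in Ioc 0 T, ENNReal.ofReal (B * t ^ (-(κ / α))) :=
        setLIntegral_mono' measurableSet_Ioc fun t ht => measure_le_rpow_neg_le hf0' hα hB ht.1
    _ = ENNReal.ofReal (∫ t in Ioc 0 T, B * t ^ (-(κ / α))) := by
        rw [ofReal_integral_eq_lintegral_ofReal]
        · have := intervalIntegral.intervalIntegrable_rpow' (a := 0) (b := T)
            (r := -(κ / α)) (by linarith)
          exact (((intervalIntegrable_iff_integrableOn_Ioc_of_le hT.le).1 this).const_mul B)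
        · filter_upwards [ae_restrict_mem measurableSet_Ioc] with t ht
          exact mul_nonneg hB0 (Real.rpow_nonneg ht.1.le _)
    _ = _ := by
        rw [integral_const_mul, ← intervalIntegral.integral_of_le hT.le,
          integral_rpow (Or.inl (by linarith)), Real.zero_rpow (by linarith), sub_zero,
          show -(κ / α) + 1 = 1 - κ / α by ring, hT', ← Real.rpow_mul hh.le]
        congr 4
        field_simp
        ring

end LayerCake

/-! ### Energy method, and dimension bounds for Hölder graphs. -/

section HausdorffDimension

/-- The energy method for images of a set under a measurable map. -/
theorem le_dimH_image_of_energy {X : Type*} [EMetricSpace X] [MeasurableSpace X] [BorelSpace X]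
    [SecondCountableTopology X] {μ : Measure ℝ} [IsFiniteMeasure μ] {f : ℝ → X} (hf : Measurable f)
    {A : Set ℝ} (hA : MeasurableSet A) (hμA : μ A ≠ 0) {t : ℝ} (ht : 0 < t)
    (henergy : ∫⁻ x, ∫⁻ y, edist (f x) (f y) ^ (-t) ∂μ ∂μ ≠ ∞) :
    ENNReal.ofReal t ≤ dimH (f '' A) := by
  set V : ℝ → ℝ≥0∞ := fun x => ∫⁻ y, edist (f x) (f y) ^ (-t) ∂μ with hV
  have hVm : Measurable V :=
    Measurable.lintegral_prod_right'
      (f := fun p : ℝ × ℝ => edist (f p.1) (f p.2) ^ (-t))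
      (((hf.comp measurable_fst).edist (hf.comp measurable_snd)).pow_const _)
  have hVfin : ∀ᵐ x ∂μ, V x < ∞ := ae_lt_top hVm henergy
  -- The potential is finite almost everywhere, so it is bounded by some M on a part of A of
  -- positive mass; the measure is restricted to that part.
  obtain ⟨M, hM⟩ : ∃ M : ℕ, μ (A ∩ {x | V x ≤ M}) ≠ 0 := by
    by_contra! hcon
    refine hμA (measure_mono_null (fun x hx => ?_) (measure_union_null (measure_iUnion_null hcon)
      (t := {x | ¬ V x < ∞}) hVfin))
    by_cases h : V x < ∞
    · obtain ⟨n, hn⟩ := ENNReal.exists_nat_gt h.ne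
      exact Or.inl (mem_iUnion.2 ⟨n, hx, hn.le⟩)
    · exact Or.inr h
  set S := A ∩ {x | V x ≤ M} with hS
  have hSm : MeasurableSet S := hA.inter (measurableSet_le hVm measurable_const)
  set ν : Measure X := (μ.restrict S).map f with hν
  have hbound : ∀ s : Set X, Metric.ediam s ≤ 1 → ν s ≤ M * Metric.ediam s ^ t := by
    intro s hs
    rw [← Metric.ediam_closure s] at hs ⊢
    refine (measure_mono subset_closure).trans ?_
    rw [hν, Measure.map_apply hf isClosed_closure.measurableSet,
      Measure.restrict_apply (hf isClosed_closure.measurableSet)]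
    set d := Metric.ediam (closure s) with hd
    have hdtop : d ≠ ∞ := ne_top_of_le_ne_top ENNReal.one_ne_top hs
    rcases (f ⁻¹' closure s ∩ S).eq_empty_or_nonempty with h | ⟨x, hx, hxS⟩
    · rw [h, measure_empty]; exact zero_le
    -- Seen from one point x of the piece, the kernel is at least d^(-t) on the whole piece, while
    -- the potential at x is at most M.
    have h1 : d ^ (-t) * μ (f ⁻¹' closure s ∩ S) ≤ M := by
      calc d ^ (-t) * μ (f ⁻¹' closure s ∩ S)
          = ∫⁻ _ in f ⁻¹' closure s ∩ S, d ^ (-t) ∂μ := by rw [setLIntegral_const]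
        _ ≤ ∫⁻ y in f ⁻¹' closure s ∩ S, edist (f x) (f y) ^ (-t) ∂μ := by
            refine setLIntegral_mono' ((hf isClosed_closure.measurableSet).inter hSm)
              fun y hy => ?_
            rw [ENNReal.rpow_neg, ENNReal.rpow_neg, ENNReal.inv_le_inv]
            exact ENNReal.rpow_le_rpow (Metric.edist_le_ediam_of_mem hx hy.1) ht.le
        _ ≤ V x := setLIntegral_le_lintegral _ _
        _ ≤ M := hxS.2
    rcases eq_or_ne d 0 with h0 | h0
    · rw [h0, ENNReal.zero_rpow_of_neg (by linarith)] at h1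
      have h2 : μ (f ⁻¹' closure s ∩ S) = 0 := by
        by_contra h2
        rw [ENNReal.top_mul h2] at h1
        simp at h1
      rw [h2]; exact zero_le
    · have hdt0 : d ^ t ≠ 0 := by
        rw [Ne, ENNReal.rpow_eq_zero_iff]; rintro (h | h)
        · exact h0 h.1
        · exact hdtop h.1
      have hdt : d ^ t ≠ ∞ := ENNReal.rpow_ne_top_of_nonneg ht.le hdtop
      rw [ENNReal.rpow_neg, mul_comm, ← div_eq_mul_inv] at h1
      exact (ENNReal.div_le_iff hdt0 hdt).1 h1
  have hle : ((M : ℝ≥0∞) + 1)⁻¹ • ν ≤ μH[t] := by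
    refine Measure.le_hausdorffMeasure t _ 1 one_pos fun s hs => ?_
    rw [Measure.smul_apply, smul_eq_mul, ENNReal.inv_mul_le_iff (by simp) (by simp)]
    exact (hbound s hs).trans (by gcongr; exact le_self_add)
  have hpos : μH[t] (f '' A) ≠ 0 := by
    intro h0
    have h1 := hle (f '' A)
    rw [h0, Measure.smul_apply, smul_eq_mul, nonpos_iff_eq_zero, mul_eq_zero] at h1
    rcases h1 with h1 | h1
    · simp at h1
    · have h2 := Measure.le_map_apply (μ := μ.restrict S) hf.aemeasurable (f '' A)
      have h3 : μ S ≤ (μ.restrict S) (f ⁻¹' (f '' A)) := by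
        rw [← Measure.restrict_apply_self μ S]
        exact measure_mono (inter_subset_left.trans (subset_preimage_image f A))
      exact hM (le_antisymm (h3.trans (h2.trans h1.le)) zero_le)
  have := le_dimH_of_hausdorffMeasure_ne_zero (d := t.toNNReal) (s := f '' A)
    (by rwa [Real.coe_toNNReal t ht.le])
  exact this

theorem EuclideanSpace.dist_pair_le (a b c d : ℝ) :
    dist (!₂[a, b] : EuclideanSpace ℝ (Fin 2)) !₂[c, d] ≤ |a - c| + |b - d| := by
  rw [EuclideanSpace.dist_eq, Fin.sum_univ_two]
  simp only [Matrix.cons_val_zero, Matrix.cons_val_one, Real.dist_eq]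
  rw [Real.sqrt_le_left (by positivity)]
  nlinarith [abs_nonneg (a - c), abs_nonneg (b - d)]

theorem EuclideanSpace.max_le_dist_pair (a b c d : ℝ) :
    max |a - c| |b - d| ≤ dist (!₂[a, b] : EuclideanSpace ℝ (Fin 2)) !₂[c, d] := by
  rw [EuclideanSpace.dist_eq, Fin.sum_univ_two]
  simp only [Matrix.cons_val_zero, Matrix.cons_val_one, Real.dist_eq]
  refine max_le (Real.le_sqrt_of_sq_le ?_) (Real.le_sqrt_of_sq_le ?_)
  · nlinarith [sq_nonneg |b - d|]
  · nlinarith [sq_nonneg |a - c|]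

/-- On a set of diameter at most one, |x - y| ≤ |x - y|^γ, so the graph map is itself γ-Hölder. -/
theorem dimH_graphOver_le_div {f : ℝ → ℝ} {A : Set ℝ} {C γ u : ℝ} (hC : 0 ≤ C) (hγ : 0 < γ)
    (hγ1 : γ ≤ 1) (hA : A ⊆ Icc u (u + 1))
    (hf : ∀ x ∈ A, ∀ y ∈ A, |f x - f y| ≤ C * |x - y| ^ γ) :
    dimH (graphOver f A) ≤ dimH A / ENNReal.ofReal γ := by
  have hh : HolderOnWith (1 + C).toNNReal γ.toNNReal
      (fun x => (!₂[x, f x] : EuclideanSpace ℝ (Fin 2))) A := by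
    intro x hx y hy
    rw [edist_dist, edist_dist, Real.coe_toNNReal γ hγ.le,
      ENNReal.ofReal_rpow_of_nonneg dist_nonneg hγ.le]
    change _ ≤ ENNReal.ofReal (1 + C) * _
    rw [← ENNReal.ofReal_mul (by positivity)]
    refine ENNReal.ofReal_le_ofReal ((EuclideanSpace.dist_pair_le _ _ _ _).trans ?_)
    have h1 : |x - y| ≤ 1 := by
      have := hA hx; have := hA hy
      simp only [mem_Icc] at *
      rw [abs_le]; constructor <;> linarith
    have h2 : |x - y| ≤ |x - y| ^ γ := by
      rcases (abs_nonneg (x - y)).eq_or_lt with h | h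
      · rw [← h, Real.zero_rpow hγ.ne']
      · simpa using Real.rpow_le_rpow_of_exponent_ge h h1 hγ1
    rw [Real.dist_eq]
    linarith [hf x hx y hy]
  exact hh.dimH_image_le (Real.toNNReal_pos.2 hγ)

/-- Economical covers of a set of measure zero, with positive radii. -/
theorem exists_cover_of_hausdorffMeasure_eq_zero {A : Set ℝ} {d : ℝ} (hd : 0 < d)
    (h : μH[d] A = 0) {ε : ℝ} (hε : 0 < ε) :
    ∃ (t : ℕ → Set ℝ) (r : ℕ → ℝ), A ⊆ ⋃ i, t i ∧ (∀ i, 0 < r i ∧ r i ≤ ε) ∧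
      (∀ i, ∀ x ∈ t i, ∀ y ∈ t i, |x - y| ≤ r i) ∧
      ∑' i, ENNReal.ofReal (r i ^ d) ≤ ENNReal.ofReal ε := by
  have hε2 : 0 < ENNReal.ofReal (ε / 2) := ENNReal.ofReal_pos.2 (by positivity)
  rw [Measure.hausdorffMeasure_apply] at h
  have h1 := (ENNReal.iSup_eq_zero.1 (ENNReal.iSup_eq_zero.1 h (ENNReal.ofReal ε)))
    (ENNReal.ofReal_pos.2 hε)
  have h2 := h1.trans_lt hε2
  simp only [iInf_lt_iff] at h2
  obtain ⟨t, ht, htd, hsum⟩ := h2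
  obtain ⟨δ, hδ0, hδ⟩ := NNReal.exists_pos_sum_of_countable
    (ε := (ε / 2).toNNReal) (by simpa using hε) ℕ
  obtain ⟨c, hc, hcδ⟩ := hδ
  have hdf : ∀ i, Metric.ediam (t i) ≠ ∞ := fun i =>
    ne_top_of_le_ne_top ENNReal.ofReal_ne_top (htd i)
  -- Padding radii with summable d-th powers: covering sets may be singletons or empty, and division
  -- by r must make sense later.
  set ρ : ℕ → ℝ := fun i => min ε ((δ i : ℝ) ^ d⁻¹) with hρ
  have hρ0 : ∀ i, 0 < ρ i := fun i =>
    lt_min hε (Real.rpow_pos_of_pos (NNReal.coe_pos.2 (hδ0 i)) _)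
  refine ⟨t, fun i => max (Metric.ediam (t i)).toReal (ρ i), ht, fun i => ⟨?_, ?_⟩, ?_, ?_⟩
  · exact lt_max_of_lt_right (hρ0 i)
  · exact max_le (ENNReal.toReal_le_of_le_ofReal hε.le (htd i)) (min_le_left _ _)
  · intro i x hx y hy
    refine le_trans ?_ (le_max_left _ _)
    rw [← Real.dist_eq, dist_edist]
    exact ENNReal.toReal_mono (hdf i) (Metric.edist_le_ediam_of_mem hx hy)
  · calc ∑' i, ENNReal.ofReal (max (Metric.ediam (t i)).toReal (ρ i) ^ d)
        ≤ ∑' i, ((⨆ _ : (t i).Nonempty, Metric.ediam (t i) ^ d) + (δ i : ℝ≥0∞)) := by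
          refine ENNReal.tsum_le_tsum fun i => ?_
          rcases le_total (Metric.ediam (t i)).toReal (ρ i) with h | h
          · rw [max_eq_right h]
            refine le_trans ?_ le_add_self
            rw [← ENNReal.ofReal_coe_nnreal]
            refine ENNReal.ofReal_le_ofReal ?_
            calc ρ i ^ d ≤ ((δ i : ℝ) ^ d⁻¹) ^ d :=
                  Real.rpow_le_rpow (hρ0 i).le (min_le_right _ _) hd.le
              _ = δ i := by
                rw [← Real.rpow_mul (NNReal.coe_nonneg _), inv_mul_cancel₀ hd.ne', Real.rpow_one]
          · rw [max_eq_left h]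
            refine le_trans ?_ le_self_add
            rw [← ENNReal.ofReal_rpow_of_nonneg ENNReal.toReal_nonneg hd.le,
              ENNReal.ofReal_toReal (hdf i)]
            rcases (t i).eq_empty_or_nonempty with h0 | h0
            · simp [h0, ENNReal.zero_rpow_of_pos hd]
            · exact le_iSup_of_le h0 le_rfl
      _ = ∑' i, (⨆ _ : (t i).Nonempty, Metric.ediam (t i) ^ d) + ∑' i, (δ i : ℝ≥0∞) :=
          ENNReal.tsum_add
      _ ≤ ENNReal.ofReal (ε / 2) + ENNReal.ofReal (ε / 2) := by
          refine add_le_add hsum.le ?_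
          rw [← ENNReal.coe_tsum hc.summable, hc.tsum_eq]
          exact ENNReal.coe_le_coe.2 hcδ.le
      _ = ENNReal.ofReal ε := by
          rw [← ENNReal.ofReal_add (by positivity) (by positivity), add_halves]

/-- Above a set of diameter r the graph has height at most 2 C r^γ, so about r^(γ-1) pieces of size
r cover it, and r^(γ-1) · r^(d+1-γ) = r^d. -/
theorem hausdorffMeasure_graphOver_eq_zero {f : ℝ → ℝ} {A : Set ℝ} {C γ d : ℝ} (hC : 0 ≤ C)
    (hγ : 0 ≤ γ) (hγ1 : γ ≤ 1)
    (hf : ∀ x ∈ A, ∀ y ∈ A, |f x - f y| ≤ C * |x - y| ^ γ) (hd : 0 < d) (hA : μH[d] A = 0) :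
    μH[d + 1 - γ] (graphOver f A) = 0 := by
  set e := d + 1 - γ with he
  have he0 : 0 < e := by linarith
  have hex := fun n : ℕ => exists_cover_of_hausdorffMeasure_eq_zero hd hA
    (ε := 1 / ((n : ℝ) + 1)) (by positivity)
  choose t r htA hr htr hsum using hex
  have hr1 : ∀ n i, r n i ≤ 1 := fun n i => (hr n i).2.trans (by
    rw [div_le_one (by positivity)]; linarith [(Nat.cast_nonneg n : (0 : ℝ) ≤ n)])
  -- A reference height for each covering set; the value 0 is a dummy when the set misses A.
  have hx : ∀ n i, ∃ x0, ∀ x ∈ A ∩ t n i, |f x - f x0| ≤ C * r n i ^ γ := by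
    intro n i
    rcases (A ∩ t n i).eq_empty_or_nonempty with h | ⟨x0, hx0⟩
    · exact ⟨0, fun x hx => by rw [h] at hx; exact hx.elim⟩
    · refine ⟨x0, fun x hx => (hf x hx.1 x0 hx0.1).trans ?_⟩
      gcongr
      exact htr n i x hx.2 x0 hx0.2
  choose x0 hx0 using hx
  let N : ℕ → ℕ → ℕ := fun n i => ⌊2 * C * r n i ^ (γ - 1)⌋₊ + 1
  let piece : ∀ n : ℕ, (Σ i : ℕ, Fin (N n i)) → Set (EuclideanSpace ℝ (Fin 2)) := fun n p =>
    (fun x => !₂[x, f x]) ''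
      {x | x ∈ A ∩ t n p.1 ∧ ⌊(f x - f (x0 n p.1) + C * r n p.1 ^ γ) / r n p.1⌋₊ = (p.2 : ℕ)}
  have hpd : ∀ n p, Metric.ediam (piece n p) ≤ ENNReal.ofReal (2 * r n p.1) := by
    rintro n ⟨i, j⟩
    have hri := (hr n i).1
    refine Metric.ediam_le ?_
    rintro _ ⟨x, ⟨hx, hxj⟩, rfl⟩ _ ⟨y, ⟨hy, hyj⟩, rfl⟩
    rw [edist_dist]
    refine ENNReal.ofReal_le_ofReal ((EuclideanSpace.dist_pair_le _ _ _ _).trans ?_)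
    have h1 := htr n i x hx.2 y hy.2
    have hfl : ∀ z ∈ A ∩ t n i,
        ⌊(f z - f (x0 n i) + C * r n i ^ γ) / r n i⌋₊ = (j : ℕ) →
        (j : ℝ) * r n i ≤ f z - f (x0 n i) + C * r n i ^ γ ∧
          f z - f (x0 n i) + C * r n i ^ γ < (j + 1) * r n i := by
      intro z hz hzj
      have hz0 : 0 ≤ (f z - f (x0 n i) + C * r n i ^ γ) / r n i :=
        div_nonneg (by linarith [(abs_le.1 (hx0 n i z hz)).1]) hri.le
      have h2 := Nat.floor_le hz0
      have h3 := Nat.lt_floor_add_one ((f z - f (x0 n i) + C * r n i ^ γ) / r n i)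
      rw [hzj] at h2 h3
      rw [le_div_iff₀ hri] at h2
      rw [div_lt_iff₀ hri] at h3
      exact ⟨h2, h3⟩
    have hxx := hfl x hx hxj
    have hyy := hfl y hy hyj
    have h4 : |f x - f y| ≤ r n i := by
      rw [abs_le]; constructor <;> nlinarith
    linarith
  have hcover : ∀ n, graphOver f A ⊆ ⋃ p, piece n p := by
    rintro n _ ⟨x, hxA, rfl⟩
    obtain ⟨i, hi⟩ := mem_iUnion.1 (htA n hxA)
    have hri := (hr n i).1
    refine mem_iUnion.2 ⟨⟨i, ⟨⌊(f x - f (x0 n i) + C * r n i ^ γ) / r n i⌋₊, ?_⟩⟩,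
      x, ⟨⟨hxA, hi⟩, rfl⟩, rfl⟩
    refine Nat.lt_succ_of_le (Nat.floor_mono ?_)
    rw [div_le_iff₀ hri, mul_assoc, ← Real.rpow_add_one hri.ne', sub_add_cancel]
    linarith [(abs_le.1 (hx0 n i x ⟨hxA, hi⟩)).2]
  have hinv : Tendsto (fun n : ℕ => 1 / ((n : ℝ) + 1)) atTop (𝓝 0) :=
    tendsto_one_div_add_atTop_nhds_zero_nat
  have key := Measure.hausdorffMeasure_le_liminf_tsum (β := ℕ) e (graphOver f A) (l := atTop)
    (fun n : ℕ => ENNReal.ofReal (2 * (1 / ((n : ℝ) + 1))))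
    (by simpa using ENNReal.tendsto_ofReal (hinv.const_mul 2))
    piece (Eventually.of_forall fun n p => (hpd n p).trans
      (ENNReal.ofReal_le_ofReal (by linarith [(hr n p.1).2])))
    (Eventually.of_forall hcover)
  refine le_antisymm (key.trans ?_) zero_le
  set K : ℝ := (2 * C + 1) * 2 ^ e with hK
  have hK0 : 0 ≤ K := by positivity
  have hlim : Tendsto (fun n : ℕ => ENNReal.ofReal (K * (1 / ((n : ℝ) + 1)))) atTop (𝓝 0) := by
    simpa using ENNReal.tendsto_ofReal (hinv.const_mul K)
  rw [← hlim.liminf_eq]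
  refine liminf_le_liminf (Eventually.of_forall fun n => ?_)
  rw [ENNReal.tsum_sigma', ENNReal.ofReal_mul hK0]
  refine le_trans ?_ (mul_le_mul_right (hsum n) _)
  rw [← ENNReal.tsum_mul_left]
  refine ENNReal.tsum_le_tsum fun i => ?_
  rw [tsum_fintype]
  have hri := (hr n i).1
  calc ∑ j : Fin (N n i), Metric.ediam (piece n ⟨i, j⟩) ^ e
      ≤ ∑ _j : Fin (N n i), ENNReal.ofReal ((2 * r n i) ^ e) := by
        refine Finset.sum_le_sum fun j _ => ?_
        rw [← ENNReal.ofReal_rpow_of_nonneg (by positivity) he0.le]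
        exact ENNReal.rpow_le_rpow (hpd n ⟨i, j⟩) he0.le
    _ = ENNReal.ofReal (N n i * (2 * r n i) ^ e) := by
        rw [Finset.sum_const, Finset.card_univ, Fintype.card_fin, nsmul_eq_mul,
          ENNReal.ofReal_mul (by positivity), ENNReal.ofReal_natCast]
    _ ≤ ENNReal.ofReal K * ENNReal.ofReal (r n i ^ d) := by
        rw [← ENNReal.ofReal_mul hK0]
        refine ENNReal.ofReal_le_ofReal ?_
        have h1 : (N n i : ℝ) ≤ (2 * C + 1) * r n i ^ (γ - 1) := by
          have h2 : (⌊2 * C * r n i ^ (γ - 1)⌋₊ : ℝ) ≤ 2 * C * r n i ^ (γ - 1) :=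
            Nat.floor_le (by positivity)
          have h3 : 1 ≤ r n i ^ (γ - 1) :=
            Real.one_le_rpow_of_pos_of_le_one_of_nonpos hri (hr1 n i) (by linarith)
          simp only [N]
          push_cast
          nlinarith
        calc (N n i : ℝ) * (2 * r n i) ^ e
            ≤ (2 * C + 1) * r n i ^ (γ - 1) * (2 * r n i) ^ e := by gcongr
          _ = K * (r n i ^ (γ - 1) * r n i ^ e) := by
              rw [Real.mul_rpow (by norm_num) hri.le, hK]; ring
          _ = K * r n i ^ d := by
              rw [← Real.rpow_add hri]
              congr 2
              rw [he]; ring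

/-- The exponent γ = 0 is allowed, so that merely bounded functions are included. -/
theorem dimH_graphOver_le_add {f : ℝ → ℝ} {A : Set ℝ} {C γ : ℝ} (hC : 0 ≤ C)
    (hγ : 0 ≤ γ) (hγ1 : γ ≤ 1)
    (hf : ∀ x ∈ A, ∀ y ∈ A, |f x - f y| ≤ C * |x - y| ^ γ) :
    dimH (graphOver f A) ≤ dimH A + 1 - ENNReal.ofReal γ := by
  have hfin : dimH A ≠ ∞ := Real.dimH_ne_top A
  have key : ∀ d : ℝ≥0, dimH A < d → dimH (graphOver f A) + ENNReal.ofReal γ ≤ d + 1 := by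
    intro d hd
    have hd0 : (0 : ℝ) < d := by
      have : (0 : ℝ≥0∞) < d := zero_le.trans_lt hd
      exact_mod_cast this
    have h0 := hausdorffMeasure_graphOver_eq_zero hC hγ hγ1 hf hd0 (hausdorffMeasure_of_dimH_lt hd)
    have h1 := dimH_le_of_hausdorffMeasure_ne_top (d := ((d : ℝ) + 1 - γ).toNNReal)
      (s := graphOver f A) (by
        rw [Real.coe_toNNReal _ (by linarith), h0]; simp)
    calc dimH (graphOver f A) + ENNReal.ofReal γ
        ≤ ENNReal.ofReal ((d : ℝ) + 1 - γ) + ENNReal.ofReal γ := add_le_add h1 le_rfl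
      _ = ENNReal.ofReal ((d : ℝ) + 1) := by
          rw [← ENNReal.ofReal_add (by linarith) hγ]; ring_nf
      _ = d + 1 := by
          rw [ENNReal.ofReal_add hd0.le zero_le_one, ENNReal.ofReal_coe_nnreal, ENNReal.ofReal_one]
  refine ENNReal.le_sub_of_add_le_right ENNReal.ofReal_ne_top ?_
  refine ENNReal.le_of_forall_pos_le_add fun ε hε _ => ?_
  have h2 := key ((dimH A).toNNReal + ε) (by
    rw [ENNReal.coe_add, ENNReal.coe_toNNReal hfin]
    exact ENNReal.lt_add_right hfin (by simpa using hε.ne'))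
  rw [ENNReal.coe_add, ENNReal.coe_toNNReal hfin] at h2
  exact h2.trans_eq (by ring)

end HausdorffDimension

/-! ### Decay of the Bessel function J₀. -/

section Bessel

/-- The Bessel function `J₀`, the characteristic function of the cosine of a uniform phase. -/
noncomputable def besselZero (u : ℝ) : ℝ :=
  ∫ t in (0 : ℝ)..1, Real.cos (u * Real.cos (2 * Real.pi * t))

theorem besselZero_neg (u : ℝ) : besselZero (-u) = besselZero u := by
  simp [besselZero]

theorem abs_besselZero_le_one (u : ℝ) : |besselZero u| ≤ 1 := by
  have h := intervalIntegral.norm_integral_le_of_norm_le_const (a := (0 : ℝ)) (b := 1) (C := 1)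
    (f := fun t => Real.cos (u * Real.cos (2 * Real.pi * t)))
    fun t _ => by rw [Real.norm_eq_abs]; exact Real.abs_cos_le_one _
  simpa [besselZero] using h

theorem integral_cos_two_pi_sq : ∫ t in (0 : ℝ)..1, Real.cos (2 * Real.pi * t) ^ 2 = 1 / 2 := by
  rw [intervalIntegral.integral_comp_mul_left (fun x => Real.cos x ^ 2) (by positivity),
    integral_cos_sq]
  simp [Real.sin_two_pi]
  field_simp

/-- Integrate 1 - y²/2 ≤ cos y ≤ 1 - 2y²/5, valid for |y| ≤ 1, at y = u cos 2πt, where cos² 2πt has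
mean 1/2. -/
theorem besselZero_mem_of_abs_le_one {u : ℝ} (hu : |u| ≤ 1) :
    0 ≤ besselZero u ∧ besselZero u ≤ 1 - u ^ 2 / 5 := by
  have hint : ∀ a : ℝ, ∫ t in (0 : ℝ)..1, (1 - a * Real.cos (2 * Real.pi * t) ^ 2) = 1 - a / 2 := by
    intro a
    rw [intervalIntegral.integral_sub (by simp)
      (Continuous.intervalIntegrable (by fun_prop) _ _), intervalIntegral.integral_const_mul,
      integral_cos_two_pi_sq]
    simp; ring
  have hu2 : u ^ 2 ≤ 1 := by rw [← sq_abs]; nlinarith [abs_nonneg u]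
  constructor
  · have h1 : 1 - (u ^ 2 / 2) / 2 ≤ besselZero u := by
      rw [← hint, besselZero]
      refine intervalIntegral.integral_mono_on zero_le_one
        (Continuous.intervalIntegrable (by fun_prop) _ _)
        (Continuous.intervalIntegrable (by fun_prop) _ _) fun t _ => ?_
      refine le_trans (le_of_eq (by ring)) (Real.one_sub_sq_div_two_le_cos
        (x := u * Real.cos (2 * Real.pi * t)))
    linarith
  · rw [show 1 - u ^ 2 / 5 = 1 - (2 * u ^ 2 / 5) / 2 by ring, ← hint, besselZero]
    refine intervalIntegral.integral_mono_on zero_le_one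
      (Continuous.intervalIntegrable (by fun_prop) _ _)
      (Continuous.intervalIntegrable (by fun_prop) _ _) fun t _ => ?_
    set y := Real.cos (2 * Real.pi * t) with hy
    have hy1 : |y| ≤ 1 := Real.abs_cos_le_one _
    have h1 : |u * y| ≤ 1 := by rw [abs_mul]; exact mul_le_one₀ hu (abs_nonneg _) hy1
    have h2 := (abs_le.1 (Real.cos_bound h1)).2
    have h3 : |u * y| ^ 4 = (u * y) ^ 2 * (u * y) ^ 2 := by
      rw [show |u * y| ^ 4 = (|u * y| ^ 2) ^ 2 by ring, sq_abs]; ring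
    have h4 : (u * y) ^ 2 ≤ 1 := by rw [← sq_abs]; nlinarith [abs_nonneg (u * y)]
    nlinarith [sq_nonneg (u * y)]

/-- Van der Corput estimate for `J₀`, with a non-optimal exponent. -/
theorem abs_besselZero_le_of_eps {u ε : ℝ} (hu : 0 < u) (hε : 0 < ε) (hε4 : ε ≤ 1 / 4) :
    |besselZero u| ≤ 4 * ε + 2 / (u * ε ^ 2) := by
  have hπ := Real.pi_pos
  set f : ℝ → ℝ := fun t => Real.cos (u * Real.cos (2 * Real.pi * t)) with hf
  have hfc : Continuous f := by fun_prop
  have hfi : ∀ a b, IntervalIntegrable f volume a b := fun a b => hfc.intervalIntegrable a b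
  have hf1 : ∀ t, ‖f t‖ ≤ 1 := fun t => by rw [Real.norm_eq_abs]; exact Real.abs_cos_le_one _
  have hhalf : ∫ t in (1 / 2 : ℝ)..1, f t = ∫ t in (0 : ℝ)..(1 / 2), f t := by
    have h1 := intervalIntegral.integral_comp_add_right (a := (0 : ℝ)) (b := 1 / 2) f (1 / 2)
    rw [show (0 : ℝ) + 1 / 2 = 1 / 2 by ring, show (1 / 2 : ℝ) + 1 / 2 = 1 by ring] at h1
    rw [← h1]
    refine intervalIntegral.integral_congr fun t _ => ?_
    simp only [hf]
    rw [show 2 * Real.pi * (t + 1 / 2) = 2 * Real.pi * t + Real.pi by ring, Real.cos_add_pi,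
      mul_neg, Real.cos_neg]
  have hJ : besselZero u = 2 * ∫ t in (0 : ℝ)..(1 / 2), f t := by
    rw [besselZero, ← intervalIntegral.integral_add_adjacent_intervals (hfi 0 (1 / 2))
      (hfi (1 / 2) 1), hhalf]
    ring
  have hsplit : ∫ t in (0 : ℝ)..(1 / 2), f t = (∫ t in (0 : ℝ)..ε, f t) +
      (∫ t in ε..(1 / 2 - ε), f t) + ∫ t in (1 / 2 - ε)..(1 / 2), f t := by
    rw [intervalIntegral.integral_add_adjacent_intervals (hfi _ _) (hfi _ _),
      intervalIntegral.integral_add_adjacent_intervals (hfi _ _) (hfi _ _)]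
  have hA : |∫ t in (0 : ℝ)..ε, f t| ≤ ε := by
    have := intervalIntegral.norm_integral_le_of_norm_le_const (a := (0 : ℝ)) (b := ε) (C := 1)
      (f := f) fun t _ => hf1 t
    rwa [one_mul, sub_zero, abs_of_pos hε, Real.norm_eq_abs] at this
  have hB : |∫ t in (1 / 2 - ε)..(1 / 2), f t| ≤ ε := by
    have := intervalIntegral.norm_integral_le_of_norm_le_const (a := (1 / 2 - ε : ℝ)) (b := 1 / 2)
      (C := 1) (f := f) fun t _ => hf1 t
    rwa [one_mul, sub_sub_cancel, abs_of_pos hε, Real.norm_eq_abs] at this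
  have hle : ε ≤ 1 / 2 - ε := by linarith
  have hsin : ∀ t ∈ Icc ε (1 / 2 - ε), 4 * ε ≤ Real.sin (2 * Real.pi * t) := by
    intro t ht
    rcases le_total t (1 / 4) with h | h
    · have h1 := Real.mul_le_sin (x := 2 * Real.pi * t)
        (by have := hε.le.trans ht.1; positivity) (by nlinarith)
      have h2 : 2 / Real.pi * (2 * Real.pi * t) = 4 * t := by field_simp; ring
      linarith [ht.1]
    · have h1 := Real.mul_le_sin (x := Real.pi - 2 * Real.pi * t)
        (by nlinarith [ht.2]) (by nlinarith)
      rw [Real.sin_pi_sub] at h1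
      have h2 : 2 / Real.pi * (Real.pi - 2 * Real.pi * t) = 2 - 4 * t := by field_simp; ring
      linarith [ht.2]
  -- Away from the critical points 0 and 1/2 of the phase, the integrand is g' divided by -2πu sin
  -- 2πt, and one integration by parts gains the factor 1/u. The ε-neighbourhoods of the critical
  -- points are estimated trivially.
  set g : ℝ → ℝ := fun t => Real.sin (u * Real.cos (2 * Real.pi * t)) with hg
  set w : ℝ → ℝ := fun t => (Real.sin (2 * Real.pi * t))⁻¹ with hw
  set w' : ℝ → ℝ := fun t => -(Real.cos (2 * Real.pi * t) * (2 * Real.pi)) /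
    Real.sin (2 * Real.pi * t) ^ 2 with hw'
  set g' : ℝ → ℝ := fun t => Real.cos (u * Real.cos (2 * Real.pi * t)) *
    (u * (-Real.sin (2 * Real.pi * t) * (2 * Real.pi))) with hg'
  have hlin : ∀ t : ℝ, HasDerivAt (fun t : ℝ => 2 * Real.pi * t) (2 * Real.pi) t := fun t => by
    simpa using (hasDerivAt_id t).const_mul (2 * Real.pi)
  have hgd : ∀ t, HasDerivAt g (g' t) t := fun t =>
    (((hlin t).cos).const_mul u).sin
  have hIcc : uIcc ε (1 / 2 - ε) = Icc ε (1 / 2 - ε) := uIcc_of_le hle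
  have hsin0 : ∀ t ∈ Icc ε (1 / 2 - ε), Real.sin (2 * Real.pi * t) ≠ 0 := fun t ht =>
    ((by positivity : 0 < 4 * ε).trans_le (hsin t ht)).ne'
  have hwd : ∀ t ∈ Icc ε (1 / 2 - ε), HasDerivAt w (w' t) t := fun t ht =>
    ((hlin t).sin).inv (hsin0 t ht)
  have hw'c : ContinuousOn w' (Icc ε (1 / 2 - ε)) := by
    refine ContinuousOn.div (by fun_prop) (by fun_prop) fun t ht => pow_ne_zero 2 (hsin0 t ht)
  have hparts := intervalIntegral.integral_deriv_mul_eq_sub (a := ε) (b := 1 / 2 - ε)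
    (u := g) (v := w) (u' := g') (v' := w') (fun t _ => hgd t) (fun t ht => hwd t (hIcc ▸ ht))
    (Continuous.intervalIntegrable (by fun_prop) _ _)
    ((hIcc ▸ hw'c).intervalIntegrable)
  have hw'b : ∀ t ∈ Icc ε (1 / 2 - ε), |g t * w' t| ≤ Real.pi / (8 * ε ^ 2) := by
    intro t ht
    have h1 := hsin t ht
    have hs2 : 16 * ε ^ 2 ≤ Real.sin (2 * Real.pi * t) ^ 2 := by nlinarith
    have h2 : |g t| ≤ 1 := Real.abs_sin_le_one _
    have h3 : |w' t| ≤ Real.pi / (8 * ε ^ 2) := by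
      simp only [hw']
      rw [abs_div, abs_neg, abs_mul, abs_of_pos (by positivity : 0 < 2 * Real.pi),
        abs_of_nonneg (sq_nonneg (Real.sin _))]
      calc |Real.cos (2 * Real.pi * t)| * (2 * Real.pi) / Real.sin (2 * Real.pi * t) ^ 2
          ≤ 1 * (2 * Real.pi) / (16 * ε ^ 2) := by
            gcongr; exact Real.abs_cos_le_one _
        _ = Real.pi / (8 * ε ^ 2) := by field_simp; ring
    rw [abs_mul]
    calc |g t| * |w' t| ≤ 1 * (Real.pi / (8 * ε ^ 2)) := by gcongr
      _ = _ := one_mul _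
  have hwb : ∀ t ∈ Icc ε (1 / 2 - ε), |g t * w t| ≤ 1 / (4 * ε) := by
    intro t ht
    rw [abs_mul]
    have h2 : |g t| ≤ 1 := Real.abs_sin_le_one _
    have h3 : |w t| ≤ 1 / (4 * ε) := by
      simp only [hw]
      rw [abs_inv, ← one_div]
      exact one_div_le_one_div_of_le (by positivity) ((hsin t ht).trans (le_abs_self _))
    calc |g t| * |w t| ≤ 1 * (1 / (4 * ε)) := by gcongr
      _ = _ := one_mul _
  have hsum : ∫ t in ε..(1 / 2 - ε), g' t * w t =
      g (1 / 2 - ε) * w (1 / 2 - ε) - g ε * w ε - ∫ t in ε..(1 / 2 - ε), g t * w' t := by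
    rw [← hparts, intervalIntegral.integral_add]
    · ring
    · refine ContinuousOn.intervalIntegrable ?_
      rw [hIcc]
      exact (Continuous.continuousOn (by fun_prop)).mul fun t ht =>
        (hwd t ht).continuousAt.continuousWithinAt
    · refine ContinuousOn.intervalIntegrable ?_
      rw [hIcc]
      exact (Continuous.continuousOn (by fun_prop)).mul hw'c
  have hfg : ∫ t in ε..(1 / 2 - ε), g' t * w t =
      -(2 * Real.pi * u) * ∫ t in ε..(1 / 2 - ε), f t := by
    rw [← intervalIntegral.integral_const_mul]
    refine intervalIntegral.integral_congr fun t ht => ?_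
    have := hsin0 t (hIcc ▸ ht)
    simp only [hg', hw, hf]
    field_simp
  have hC' : |∫ t in ε..(1 / 2 - ε), g t * w' t| ≤ Real.pi / (8 * ε ^ 2) := by
    have := intervalIntegral.norm_integral_le_of_norm_le_const (a := ε) (b := 1 / 2 - ε)
      (C := Real.pi / (8 * ε ^ 2)) (f := fun t => g t * w' t) fun t ht => by
        rw [uIoc_of_le hle] at ht
        exact hw'b t (Ioc_subset_Icc_self ht)
    rw [Real.norm_eq_abs] at this
    refine this.trans ?_
    refine mul_le_of_le_one_right (by positivity) ?_
    rw [abs_of_nonneg (by linarith)]; linarith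
  have hC : |∫ t in ε..(1 / 2 - ε), f t| ≤ 1 / (u * ε ^ 2) := by
    have h1 : |-(2 * Real.pi * u) * ∫ t in ε..(1 / 2 - ε), f t| ≤
        1 / (4 * ε) + 1 / (4 * ε) + Real.pi / (8 * ε ^ 2) := by
      rw [← hfg, hsum]
      refine (abs_sub _ _).trans (add_le_add ((abs_sub _ _).trans (add_le_add ?_ ?_)) hC')
      · exact hwb _ ⟨hle, le_rfl⟩
      · exact hwb _ ⟨le_rfl, hle⟩
    rw [abs_mul, abs_neg, abs_of_pos (by positivity : 0 < 2 * Real.pi * u)] at h1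
    have h2 : 1 / (4 * ε) + 1 / (4 * ε) + Real.pi / (8 * ε ^ 2) ≤ 2 * Real.pi / ε ^ 2 := by
      rw [show 1 / (4 * ε) + 1 / (4 * ε) + Real.pi / (8 * ε ^ 2)
        = (ε / 2 + Real.pi / 8) / ε ^ 2 by field_simp; ring]
      gcongr
      linarith [Real.pi_gt_three]
    have h3 : |∫ t in ε..(1 / 2 - ε), f t| ≤ (2 * Real.pi / ε ^ 2) / (2 * Real.pi * u) := by
      rw [le_div_iff₀' (by positivity)]
      exact h1.trans h2
    refine h3.trans_eq ?_
    field_simp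
  rw [hJ, hsplit, abs_mul, abs_two]
  have := (abs_add_le ((∫ t in (0 : ℝ)..ε, f t) + ∫ t in ε..(1 / 2 - ε), f t)
    (∫ t in (1 / 2 - ε)..(1 / 2), f t)).trans (add_le_add (abs_add_le _ _) le_rfl)
  have h5 : 2 / (u * ε ^ 2) = 2 * (1 / (u * ε ^ 2)) := by ring
  rw [h5]
  linarith

/-- With u = v³ the choice ε = 1/(4v) balances the two terms: 1/v + 32/v. -/
theorem abs_besselZero_cube_le {v : ℝ} (hv : 1 ≤ v) : |besselZero (v ^ 3)| ≤ 33 / v := by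
  have hv0 : 0 < v := by linarith
  refine (abs_besselZero_le_of_eps (ε := 1 / (4 * v)) (by positivity) (by positivity) ?_).trans_eq ?_
  · exact one_div_le_one_div_of_le (by norm_num) (by linarith)
  · field_simp; ring

/-- The double-angle formula for the cosine, averaged, together with nonnegativity of a variance. It
carries a bound away from 1 from 2u down to u. -/
theorem two_mul_besselZero_sq_sub_one_le (u : ℝ) :
    2 * besselZero u ^ 2 - 1 ≤ besselZero (2 * u) := by
  set X : ℝ → ℝ := fun t => Real.cos (u * Real.cos (2 * Real.pi * t)) with hX
  have hXc : Continuous X := by fun_prop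
  have h1 : besselZero (2 * u) = 2 * (∫ t in (0 : ℝ)..1, X t ^ 2) - 1 := by
    have h3 : ∀ t, Real.cos (2 * u * Real.cos (2 * Real.pi * t)) = 2 * X t ^ 2 - 1 := fun t => by
      rw [mul_assoc, Real.cos_two_mul]
    simp only [besselZero, h3]
    rw [intervalIntegral.integral_sub (Continuous.intervalIntegrable (by fun_prop) _ _) (by simp),
      intervalIntegral.integral_const_mul]
    simp
  have h2 : 0 ≤ ∫ t in (0 : ℝ)..1, (X t - besselZero u) ^ 2 :=
    intervalIntegral.integral_nonneg zero_le_one fun t _ => sq_nonneg _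
  have h3 : ∫ t in (0 : ℝ)..1, (X t - besselZero u) ^ 2 =
      (∫ t in (0 : ℝ)..1, X t ^ 2) - besselZero u ^ 2 := by
    have h4 : ∀ t, (X t - besselZero u) ^ 2 =
        X t ^ 2 - (2 * besselZero u * X t - besselZero u ^ 2) := fun t => by ring
    simp only [h4]
    rw [intervalIntegral.integral_sub (Continuous.intervalIntegrable (by fun_prop) _ _)
      (Continuous.intervalIntegrable (by fun_prop) _ _),
      intervalIntegral.integral_sub (Continuous.intervalIntegrable (by fun_prop) _ _) (by simp),
      intervalIntegral.integral_const_mul]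
    have h5 : ∫ t in (0 : ℝ)..1, X t = besselZero u := rfl
    rw [h5]
    simp; ring
  rw [h3] at h2
  linarith

theorem exists_abs_besselZero_le : ∃ η : ℝ, 0 < η ∧ ∀ u, 1 ≤ u → |besselZero u| ≤ 1 - η := by
  have key : ∀ m : ℕ, ∃ η : ℝ, 0 < η ∧ η ≤ 1 ∧
      ∀ u, 66 ^ 3 / 2 ^ m ≤ u → |besselZero u| ≤ 1 - η := by
    intro m
    induction m with
    | zero =>
      -- For u ≥ 66³ the decay 33 / u^(1/3) is already at most 1/2.
      refine ⟨1 / 2, by norm_num, by norm_num, fun u hu => ?_⟩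
      have hu' : (66 : ℝ) ^ 3 ≤ u := by simpa using hu
      have hu0 : 0 ≤ u := by linarith [show (0 : ℝ) < 66 ^ 3 by norm_num]
      have h66 : 66 ≤ u ^ (1 / 3 : ℝ) := by
        have h := Real.rpow_le_rpow (by norm_num) hu' (by norm_num : (0 : ℝ) ≤ 1 / 3)
        rw [← Real.rpow_natCast, ← Real.rpow_mul (by norm_num)] at h
        norm_num at h
        norm_num
        exact h
      have hcube : (u ^ (1 / 3 : ℝ)) ^ 3 = u := by
        rw [← Real.rpow_natCast, ← Real.rpow_mul hu0]; norm_num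
      have h1 := abs_besselZero_cube_le (v := u ^ (1 / 3 : ℝ)) (by linarith)
      rw [hcube] at h1
      refine h1.trans ?_
      rw [div_le_iff₀ (by linarith)]
      linarith
    | succ m ih =>
      obtain ⟨η, hη, hη1, h⟩ := ih
      refine ⟨η / 4, by positivity, by linarith, fun u hu => ?_⟩
      have h1 := (abs_le.1 (h (2 * u) (by
        rw [pow_succ (2 : ℝ), ← div_div, div_le_iff₀ (by norm_num)] at hu
        linarith))).2
      have h2 := two_mul_besselZero_sq_sub_one_le u
      refine abs_le_of_sq_le_sq ?_ (by linarith)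
      nlinarith
  -- Twenty halvings reach u = 1, since 66³ < 2^20.
  obtain ⟨η, hη, -, h⟩ := key 20
  exact ⟨η, hη, fun u hu => h u (le_trans (by norm_num) hu)⟩

/-- The decay available is u^(-1/3), so the sixth power is what yields u^(-2). The constant c is the
minimum over three ranges: the quadratic bound near 0, the uniform gap η in the middle, the decay at
infinity. -/
theorem exists_besselZero_pow_six_le :
    ∃ c : ℝ, 0 < c ∧ ∀ u, |besselZero u| ^ 6 * (1 + c * u ^ 2) ≤ 1 := by
  obtain ⟨η, hη, hηb⟩ := exists_abs_besselZero_le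
  set c : ℝ := min (1 / 5) (min (η / (2 * 33 ^ 6)) (1 / (2 * 33 ^ 6))) with hc
  have hc1 : c ≤ 1 / 5 := min_le_left _ _
  have hc2 : c ≤ η / (2 * 33 ^ 6) := (min_le_right _ _).trans (min_le_left _ _)
  have hc3 : c ≤ 1 / (2 * 33 ^ 6) := (min_le_right _ _).trans (min_le_right _ _)
  have hc0 : 0 < c := by positivity
  refine ⟨c, hc0, fun u => ?_⟩
  wlog hu0 : 0 ≤ u with H
  · have := H η hη hηb hc hc1 hc2 hc3 hc0 (-u) (by linarith)
    rwa [besselZero_neg, neg_sq] at this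
  have hJ0 := abs_nonneg (besselZero u)
  have hJ1 := abs_besselZero_le_one u
  have h61 : |besselZero u| ^ 6 ≤ |besselZero u| := by
    simpa using pow_le_pow_of_le_one hJ0 hJ1 (show 1 ≤ 6 by norm_num)
  have hpos : 0 < 1 + c * u ^ 2 := by positivity
  rcases le_total u 1 with h1 | h1
  · obtain ⟨ha, hb⟩ := besselZero_mem_of_abs_le_one (u := u) (by rwa [abs_of_nonneg hu0])
    rw [abs_of_nonneg ha] at h61 ⊢
    calc besselZero u ^ 6 * (1 + c * u ^ 2) ≤ (1 - u ^ 2 / 5) * (1 + 1 / 5 * u ^ 2) := by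
          have : 0 ≤ 1 - u ^ 2 / 5 := ha.trans hb
          gcongr
          exact h61.trans hb
      _ ≤ 1 := by nlinarith [sq_nonneg (u ^ 2)]
  · rcases le_total (u ^ 2) (2 * 33 ^ 6) with h2 | h2
    · have hb := hηb u h1
      have h3 : c * u ^ 2 ≤ η := by
        calc c * u ^ 2 ≤ η / (2 * 33 ^ 6) * (2 * 33 ^ 6) := by gcongr
          _ = η := by field_simp
      calc |besselZero u| ^ 6 * (1 + c * u ^ 2) ≤ (1 - η) * (1 + η) := by
            have : 0 ≤ 1 - η := hJ0.trans hb
            gcongr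
            exact h61.trans hb
        _ ≤ 1 := by nlinarith
    · have hcube : (u ^ (1 / 3 : ℝ)) ^ 3 = u := by
        rw [← Real.rpow_natCast, ← Real.rpow_mul hu0]; norm_num
      set v := u ^ (1 / 3 : ℝ) with hv
      have hv1 : 1 ≤ v := Real.one_le_rpow h1 (by norm_num)
      have hb := abs_besselZero_cube_le hv1
      rw [hcube] at hb
      have hu6 : v ^ 6 = u ^ 2 := by rw [← hcube]; ring
      have h4 : |besselZero u| ^ 6 ≤ 33 ^ 6 / u ^ 2 := by
        calc |besselZero u| ^ 6 ≤ (33 / v) ^ 6 := by gcongr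
          _ = 33 ^ 6 / u ^ 2 := by rw [div_pow, hu6]
      have hu2 : 0 < u ^ 2 := by positivity
      calc |besselZero u| ^ 6 * (1 + c * u ^ 2) ≤ 33 ^ 6 / u ^ 2 * (1 + c * u ^ 2) := by gcongr
        _ = 33 ^ 6 / u ^ 2 + 33 ^ 6 * c := by field_simp
        _ ≤ 1 / 2 + 33 ^ 6 * (1 / (2 * 33 ^ 6)) := by
            refine add_le_add ?_ (by gcongr)
            rw [div_le_div_iff₀ hu2 (by norm_num)]
            linarith
        _ = 1 := by norm_num

end Bessel

/-! ### Small-ball bounds from characteristic functions. -/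

section Concentration

/-- A decay estimate for the characteristic function bounds the mass near the origin. -/
theorem measure_abs_le_of_norm_charFun_le {ν : Measure ℝ} [IsProbabilityMeasure ν] {a : ℝ}
    (ha : 0 < a) (h : ∀ ξ, ‖charFun ν ξ‖ ≤ (1 + (a * ξ) ^ 2)⁻¹) {r : ℝ} (hr : 0 < r) :
    ν {z | |z| ≤ r} ≤ ENNReal.ofReal (8 * r / a) := by
  -- Duality with a Gaussian of variance 1/r²: its transform exp(-z²/(2r²)) is at least 1/2 on |z| ≤
  -- r, and its density is at most r.
  set v : ℝ≥0 := (1 / r ^ 2).toNNReal with hv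
  have hvr : (v : ℝ) = 1 / r ^ 2 := Real.coe_toNNReal _ (by positivity)
  have hv0 : v ≠ 0 := by
    rw [← NNReal.coe_ne_zero, hvr]; positivity
  set γ := gaussianReal 0 v with hγ
  have hchar : ∀ z : ℝ, ∫ ξ, Complex.exp (z * ξ * Complex.I) ∂γ =
      ((Real.exp (-(z ^ 2 / (2 * r ^ 2))) : ℝ) : ℂ) := by
    intro z
    rw [← charFun_apply_real, hγ, charFun_gaussianReal]
    have : (v : ℂ) = ((1 / r ^ 2 : ℝ) : ℂ) := by rw [← hvr]
    rw [this]
    push_cast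
    congr 1
    have : (r : ℂ) ≠ 0 := by exact_mod_cast hr.ne'
    field_simp
    simp [sq]
  have hswap : ∫ z, ((Real.exp (-(z ^ 2 / (2 * r ^ 2))) : ℝ) : ℂ) ∂ν = ∫ ξ, charFun ν ξ ∂γ := by
    simp_rw [← hchar, charFun_apply_real]
    rw [integral_integral_swap]
    · congr 1 with ξ
      congr 1 with z
      rw [mul_comm (z : ℂ)]
    · refine Integrable.of_bound (C := 1) (Continuous.aestronglyMeasurable (by fun_prop)) ?_
      refine Eventually.of_forall fun p => ?_
      simp only [Function.uncurry]
      rw [← Complex.ofReal_mul, Complex.norm_exp_ofReal_mul_I]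
  have hcont : Continuous fun z : ℝ => Real.exp (-(z ^ 2 / (2 * r ^ 2))) := by fun_prop
  have hint : Integrable (fun z : ℝ => Real.exp (-(z ^ 2 / (2 * r ^ 2)))) ν := by
    refine Integrable.of_bound (C := 1) hcont.aestronglyMeasurable ?_
    refine Eventually.of_forall fun z => ?_
    rw [Real.norm_eq_abs, Real.abs_exp, Real.exp_le_one_iff]
    have : 0 ≤ z ^ 2 / (2 * r ^ 2) := by positivity
    linarith
  have hint2 : Integrable (fun ξ : ℝ => r * (1 + (a * ξ) ^ 2)⁻¹) := by
    exact (integrable_inv_one_add_sq.comp_mul_left' ha.ne').const_mul r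
  have hupper : ∫ z, Real.exp (-(z ^ 2 / (2 * r ^ 2))) ∂ν ≤ r * (Real.pi / a) := by
    have h1 : ∫ z, Real.exp (-(z ^ 2 / (2 * r ^ 2))) ∂ν = ‖∫ ξ, charFun ν ξ ∂γ‖ := by
      rw [← hswap, integral_complex_ofReal, Complex.norm_real, Real.norm_eq_abs, abs_of_nonneg]
      exact integral_nonneg fun z => (Real.exp_pos _).le
    rw [h1]
    refine (norm_integral_le_integral_norm _).trans ?_
    rw [hγ, integral_gaussianReal_eq_integral_smul hv0]
    have h2 : ∫ ξ : ℝ, r * (1 + (a * ξ) ^ 2)⁻¹ = r * (Real.pi / a) := by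
      rw [integral_const_mul, Measure.integral_comp_mul_left (fun x => (1 + x ^ 2)⁻¹) a,
        integral_univ_inv_one_add_sq, abs_of_pos (inv_pos.2 ha), smul_eq_mul]
      ring
    rw [← h2]
    refine integral_mono_of_nonneg (Eventually.of_forall fun ξ =>
      mul_nonneg (gaussianPDFReal_nonneg _ _ _) (norm_nonneg _)) hint2
      (Eventually.of_forall fun ξ => ?_)
    refine mul_le_mul ?_ (h ξ) (norm_nonneg _) hr.le
    rw [gaussianPDFReal_def]
    have h3 : 1 / r ≤ √(2 * Real.pi * v) := by
      refine Real.le_sqrt_of_sq_le ?_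
      rw [hvr, div_pow, one_pow]
      have : 0 < 1 / r ^ 2 := by positivity
      nlinarith [Real.pi_gt_three]
    have h4 : (√(2 * Real.pi * v))⁻¹ ≤ r := by
      have := inv_anti₀ (by positivity) h3
      simpa using this
    calc (√(2 * Real.pi * v))⁻¹ * Real.exp (-(ξ - 0) ^ 2 / (2 * v)) ≤ r * 1 := by
          gcongr
          rw [Real.exp_le_one_iff]
          have : 0 ≤ (ξ - 0) ^ 2 / (2 * (v : ℝ)) := by positivity
          rw [neg_div]; linarith
      _ = r := mul_one r
  have hmeas : MeasurableSet {z : ℝ | |z| ≤ r} := measurableSet_le measurable_norm measurable_const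
  have hlower : ν.real {z | |z| ≤ r} * (1 / 2) ≤ ∫ z, Real.exp (-(z ^ 2 / (2 * r ^ 2))) ∂ν := by
    calc ν.real {z | |z| ≤ r} * (1 / 2) = ∫ _ in {z | |z| ≤ r}, (1 / 2 : ℝ) ∂ν := by
          rw [setIntegral_const, smul_eq_mul]
      _ ≤ ∫ z in {z | |z| ≤ r}, Real.exp (-(z ^ 2 / (2 * r ^ 2))) ∂ν := by
          refine setIntegral_mono_on (integrable_const _).integrableOn hint.integrableOn hmeas
            fun z hz => ?_
          have h1 : z ^ 2 ≤ r ^ 2 := by rw [← sq_abs z]; exact pow_le_pow_left₀ (abs_nonneg z) hz 2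
          have h2 : z ^ 2 / (2 * r ^ 2) ≤ 1 / 2 := by
            rw [div_le_div_iff₀ (by positivity) (by norm_num)]; linarith
          have h3 := Real.add_one_le_exp (-(z ^ 2 / (2 * r ^ 2)))
          linarith
      _ ≤ _ := setIntegral_le_integral hint (Eventually.of_forall fun z => (Real.exp_pos _).le)
  rw [← ofReal_measureReal]
  refine ENNReal.ofReal_le_ofReal ?_
  have h5 : ν.real {z | |z| ≤ r} ≤ 2 * (r * (Real.pi / a)) := by linarith
  refine h5.trans ?_
  rw [show 2 * (r * (Real.pi / a)) = (2 * Real.pi) * r / a by ring]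
  gcongr
  linarith [Real.pi_le_four]

end Concentration

/-! ### Cosine series with independent uniform phases. -/

section CosineSeries

variable {Ω : Type*}

/-- A cosine series with shifted random phases. -/
noncomputable def cosineSeries (b c : ℕ → ℝ) (θ : ℕ → Ω → ℝ) (ω : Ω) : ℝ :=
  ∑' n, b n * Real.cos (2 * Real.pi * (c n + θ n ω))

theorem norm_mul_cos_le (b y : ℝ) : ‖b * Real.cos y‖ ≤ |b| := by
  rw [norm_mul, Real.norm_eq_abs, Real.norm_eq_abs]
  exact mul_le_of_le_one_right (abs_nonneg _) (Real.abs_cos_le_one _)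

theorem hasSum_cosineSeries {b : ℕ → ℝ} (hb : Summable fun n => |b n|) (c : ℕ → ℝ)
    (θ : ℕ → Ω → ℝ) (ω : Ω) :
    HasSum (fun n => b n * Real.cos (2 * Real.pi * (c n + θ n ω))) (cosineSeries b c θ ω) :=
  (Summable.of_norm_bounded hb fun _ => norm_mul_cos_le _ _).hasSum

theorem abs_sum_cosine_le {b : ℕ → ℝ} (hb : Summable fun n => |b n|) (c : ℕ → ℝ)
    (θ : ℕ → Ω → ℝ) (ω : Ω) (s : Finset ℕ) :
    |∑ n ∈ s, b n * Real.cos (2 * Real.pi * (c n + θ n ω))| ≤ ∑' n, |b n| :=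
  (Finset.abs_sum_le_sum_abs _ _).trans ((Finset.sum_le_sum fun _ _ => norm_mul_cos_le _ _).trans
    (hb.sum_le_tsum _ fun _ _ => abs_nonneg _))

variable [MeasurableSpace Ω] {P : Measure Ω}

theorem measurable_sum_cosine {θ : ℕ → Ω → ℝ} (hθ : ∀ n, Measurable (θ n)) (b c : ℕ → ℝ)
    (s : Finset ℕ) :
    Measurable fun ω => ∑ n ∈ s, b n * Real.cos (2 * Real.pi * (c n + θ n ω)) := by
  refine Finset.measurable_sum _ fun n _ => ?_
  have := hθ n
  fun_prop

theorem measurable_cosineSeries {θ : ℕ → Ω → ℝ} (hθ : ∀ n, Measurable (θ n)) {b : ℕ → ℝ}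
    (hb : Summable fun n => |b n|) (c : ℕ → ℝ) : Measurable (cosineSeries b c θ) := by
  refine measurable_of_tendsto_metrizable (fun N => measurable_sum_cosine hθ b c (Finset.range N))
    ?_
  rw [tendsto_pi_nhds]
  exact fun ω => (hasSum_cosineSeries hb c θ ω).tendsto_sum_nat

/-- Periodicity absorbs the deterministic shift c, so the laws met later do not depend on it. -/
theorem integral_comp_uniform {X : Ω → ℝ} (hX : Measurable X)
    (hu : pdf.IsUniform X (Icc (0 : ℝ) 1) P volume) {E : Type*} [NormedAddCommGroup E]
    [NormedSpace ℝ E] {g : ℝ → E} (hg : Continuous g) (hper : Function.Periodic g 1) (c : ℝ) :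
    ∫ ω, g (c + X ω) ∂P = ∫ t in (0 : ℝ)..1, g t := by
  have h1 : ∫ ω, g (c + X ω) ∂P = ∫ x, g (c + x) ∂(P.map X) := by
    rw [integral_map hX.aemeasurable]
    exact (hg.comp (by fun_prop : Continuous fun x : ℝ => c + x)).aestronglyMeasurable
  have h2 : P.map X = volume.restrict (Icc (0 : ℝ) 1) := by
    rw [hu, ProbabilityTheory.cond]
    simp
  rw [h1, h2, integral_Icc_eq_integral_Ioc, ← intervalIntegral.integral_of_le zero_le_one,
    intervalIntegral.integral_comp_add_left]
  have h3 := hper.intervalIntegral_add_eq c 0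
  rwa [zero_add, ← add_zero c, add_assoc, zero_add] at h3

theorem periodic_cos_two_pi : Function.Periodic (fun x : ℝ => Real.cos (2 * Real.pi * x)) 1 := by
  intro x
  simp only
  rw [mul_add, mul_one, Real.cos_add_two_pi]

theorem integral_exp_cos (u : ℝ) :
    ∫ t in (0 : ℝ)..1, Complex.exp ((u * Real.cos (2 * Real.pi * t) : ℝ) * Complex.I) =
      besselZero u := by
  have h1 : ∀ t : ℝ, Complex.exp ((u * Real.cos (2 * Real.pi * t) : ℝ) * Complex.I) =
      ((Real.cos (u * Real.cos (2 * Real.pi * t)) : ℝ) : ℂ) +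
        ((Real.sin (u * Real.cos (2 * Real.pi * t)) : ℝ) : ℂ) * Complex.I := fun t => by
    rw [Complex.exp_mul_I, ← Complex.ofReal_cos, ← Complex.ofReal_sin]
  have hodd : ∫ t in (0 : ℝ)..1, Real.sin (u * Real.cos (2 * Real.pi * t)) = 0 := by
    set f : ℝ → ℝ := fun t => Real.sin (u * Real.cos (2 * Real.pi * t)) with hf
    have hper : Function.Periodic f 1 := fun t => by
      simp only [hf]
      have := periodic_cos_two_pi t
      simp only at this
      rw [this]
    have h2 := hper.intervalIntegral_add_eq (1 / 2) 0
    rw [zero_add] at h2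
    have h3 := intervalIntegral.integral_comp_add_right (a := (0 : ℝ)) (b := 1) f (1 / 2)
    rw [zero_add, add_comm (1 : ℝ), h2] at h3
    have h4 : ∀ t, f (t + 1 / 2) = -f t := fun t => by
      simp only [hf]
      rw [show 2 * Real.pi * (t + 1 / 2) = 2 * Real.pi * t + Real.pi by ring, Real.cos_add_pi,
        mul_neg, Real.sin_neg]
    simp only [h4, intervalIntegral.integral_neg] at h3
    linarith
  simp only [h1]
  rw [intervalIntegral.integral_add (Continuous.intervalIntegrable (by fun_prop) _ _)
    (Continuous.intervalIntegrable (by fun_prop) _ _), intervalIntegral.integral_mul_const,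
    intervalIntegral.integral_ofReal, intervalIntegral.integral_ofReal, hodd]
  simp [besselZero]

variable {θ : ℕ → Ω → ℝ}

theorem integral_exp_sum_cosine (hθ : ∀ n, Measurable (θ n)) (hindep : iIndepFun θ P)
    (hunif : ∀ n, pdf.IsUniform (θ n) (Icc (0 : ℝ) 1) P volume) (b c : ℕ → ℝ) (ξ : ℝ)
    (s : Finset ℕ) :
    ∫ ω, Complex.exp ((ξ * ∑ n ∈ s, b n * Real.cos (2 * Real.pi * (c n + θ n ω)) : ℝ) *
      Complex.I) ∂P = ∏ n ∈ s, (besselZero (ξ * b n) : ℂ) := by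
  set g : ℕ → ℝ → ℂ := fun n x =>
    Complex.exp ((ξ * b n * Real.cos (2 * Real.pi * x) : ℝ) * Complex.I) with hg
  have hgc : ∀ n, Continuous (g n) := fun n => by simp only [hg]; fun_prop
  have hper : ∀ n, Function.Periodic (g n) 1 := fun n x => by
    simp only [hg]
    have := periodic_cos_two_pi x
    simp only at this
    rw [this]
  have h1 : ∀ ω, Complex.exp ((ξ * ∑ n ∈ s, b n * Real.cos (2 * Real.pi * (c n + θ n ω)) : ℝ) *
      Complex.I) = ∏ n : s, g n (c n + θ n ω) := fun ω => by
    rw [Finset.prod_coe_sort s (fun n => g n (c n + θ n ω)), ← Complex.exp_sum, Finset.mul_sum,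
      Complex.ofReal_sum, Finset.sum_mul]
    simp only [mul_assoc]
  simp only [h1]
  have hind : iIndepFun (fun (n : s) ω => θ n ω) P := hindep.precomp Subtype.val_injective
  have h2 := iIndepFun.integral_fun_prod_comp (X := fun (n : s) ω => θ n ω) hind
    (f := fun n x => g n (c n + x)) (fun n => (hθ n).aemeasurable)
    (fun n => ((hgc n).comp (by fun_prop : Continuous fun x : ℝ => c n + x)).aestronglyMeasurable)
  rw [h2, Finset.prod_coe_sort s (fun n => ∫ ω, g n (c n + θ n ω) ∂P)]
  refine Finset.prod_congr rfl fun n _ => ?_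
  rw [integral_comp_uniform (hθ n) (hunif n) (hgc n) (hper n)]
  exact integral_exp_cos _

/-- Every factor has modulus at most one, so all but any chosen finite set of frequencies may be
dropped. -/
theorem norm_charFun_cosineSeries_le [IsProbabilityMeasure P] (hθ : ∀ n, Measurable (θ n))
    (hindep : iIndepFun θ P)
    (hunif : ∀ n, pdf.IsUniform (θ n) (Icc (0 : ℝ) 1) P volume) {b : ℕ → ℝ}
    (hb : Summable fun n => |b n|) (c : ℕ → ℝ) (ξ : ℝ) (s : Finset ℕ) :
    ‖charFun (P.map (cosineSeries b c θ)) ξ‖ ≤ ∏ n ∈ s, |besselZero (ξ * b n)| := by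
  have hlim : Tendsto (fun N => ∫ ω, Complex.exp ((ξ * ∑ n ∈ Finset.range N,
      b n * Real.cos (2 * Real.pi * (c n + θ n ω)) : ℝ) * Complex.I) ∂P) atTop
      (𝓝 (∫ ω, Complex.exp ((ξ * cosineSeries b c θ ω : ℝ) * Complex.I) ∂P)) := by
    refine tendsto_integral_of_dominated_convergence (fun _ => 1) (fun N => ?_)
      (integrable_const _) (fun N => Eventually.of_forall fun ω => ?_)
      (Eventually.of_forall fun ω => ?_)
    · have := measurable_sum_cosine hθ b c (Finset.range N)
      exact Measurable.aestronglyMeasurable (by fun_prop)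
    · rw [Complex.norm_exp_ofReal_mul_I]
    · have hc : Continuous fun z : ℝ => Complex.exp ((ξ * z : ℝ) * Complex.I) := by fun_prop
      exact (hc.tendsto _).comp (hasSum_cosineSeries hb c θ ω).tendsto_sum_nat
  have hchar : charFun (P.map (cosineSeries b c θ)) ξ =
      ∫ ω, Complex.exp ((ξ * cosineSeries b c θ ω : ℝ) * Complex.I) ∂P := by
    rw [charFun_apply_real, integral_map (measurable_cosineSeries hθ hb c).aemeasurable
      (Continuous.aestronglyMeasurable (by fun_prop))]
    simp
  rw [hchar]
  refine le_of_tendsto hlim.norm ?_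
  obtain ⟨N, hN⟩ := s.exists_nat_subset_range
  filter_upwards [eventually_ge_atTop N] with M hM
  rw [integral_exp_sum_cosine hθ hindep hunif, norm_prod]
  simp only [Complex.norm_real, Real.norm_eq_abs]
  exact Finset.prod_le_prod_of_subset_of_le_one (hN.trans (Finset.range_mono hM))
    (fun n _ => abs_nonneg _) (fun n _ _ => abs_besselZero_le_one _)

theorem Finset.one_add_sum_le_prod {ι : Type*} (s : Finset ι) {x : ι → ℝ} (hx : ∀ i, 0 ≤ x i) :
    1 + ∑ i ∈ s, x i ≤ ∏ i ∈ s, (1 + x i) := by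
  classical
  induction s using Finset.induction_on with
  | empty => simp
  | insert i s hi ih =>
    rw [Finset.sum_insert hi, Finset.prod_insert hi]
    have h1 : 0 ≤ ∑ j ∈ s, x j := Finset.sum_nonneg fun j _ => hx j
    have h2 := mul_le_mul_of_nonneg_left ih (by linarith [hx i] : 0 ≤ 1 + x i)
    nlinarith [mul_nonneg (hx i) h1]

/-- Small ball estimate: six disjoint groups of coefficients with large `ℓ²` norm suffice. -/
theorem exists_measure_abs_cosineSeries_le [IsProbabilityMeasure P] (hθ : ∀ n, Measurable (θ n))
    (hindep : iIndepFun θ P)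
    (hunif : ∀ n, pdf.IsUniform (θ n) (Icc (0 : ℝ) 1) P volume) :
    ∃ D : ℝ, 0 < D ∧ ∀ {b : ℕ → ℝ}, (Summable fun n => |b n|) → ∀ (c : ℕ → ℝ)
      (F : Fin 6 → Finset ℕ), Pairwise (Function.onFun Disjoint F) → ∀ {B : ℝ}, 0 < B →
      (∀ i, B ^ 2 ≤ ∑ n ∈ F i, b n ^ 2) → ∀ {r : ℝ}, 0 < r →
      P {ω | |cosineSeries b c θ ω| ≤ r} ≤ ENNReal.ofReal (D * r / B) := by
  obtain ⟨κ, hκ, hJ⟩ := exists_besselZero_pow_six_le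
  refine ⟨8 / √κ, by positivity, fun {b} hb c F hF {B} hB hBF {r} hr => ?_⟩
  have hm := measurable_cosineSeries hθ hb c
  have : IsProbabilityMeasure (P.map (cosineSeries b c θ)) :=
    Measure.isProbabilityMeasure_map hm.aemeasurable
  have hkey := measure_abs_le_of_norm_charFun_le (ν := P.map (cosineSeries b c θ))
    (a := √κ * B) (by positivity) (fun ξ => ?_) hr
  · have hmeas : MeasurableSet {z : ℝ | |z| ≤ r} :=
      measurableSet_le measurable_norm measurable_const
    rw [Measure.map_apply hm hmeas] at hkey
    refine hkey.trans_eq ?_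
    congr 1
    field_simp
  · refine (norm_charFun_cosineSeries_le hθ hindep hunif hb c ξ (Finset.univ.biUnion F)).trans ?_
    rw [Finset.prod_biUnion (fun i _ j _ hij => hF hij)]
    have hx : (√κ * B * ξ) ^ 2 = κ * B ^ 2 * ξ ^ 2 := by
      rw [mul_pow, mul_pow, Real.sq_sqrt hκ.le]
    rw [hx]
    set y := κ * B ^ 2 * ξ ^ 2 with hy
    have hy0 : 0 ≤ y := by positivity
    -- One group controls only the sixth power of its Bessel product by (1 + y)⁻¹. Six groups
    -- compensate exactly: both sides are raised to the sixth power, and each group pays for one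
    -- factor (1 + y)⁻¹.
    refine le_of_pow_le_pow_left₀ (show 6 ≠ 0 by norm_num) (by positivity) ?_
    rw [← Finset.prod_pow]
    calc ∏ i, (∏ n ∈ F i, |besselZero (ξ * b n)|) ^ 6 ≤ ∏ _i : Fin 6, (1 + y)⁻¹ := by
          refine Finset.prod_le_prod (fun i _ => by positivity) fun i _ => ?_
          rw [← Finset.prod_pow]
          have h1 : ∏ n ∈ F i, |besselZero (ξ * b n)| ^ 6 ≤
              ∏ n ∈ F i, (1 + κ * (ξ * b n) ^ 2)⁻¹ := by
            refine Finset.prod_le_prod (fun n _ => by positivity) fun n _ => ?_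
            have := hJ (ξ * b n)
            rw [← one_div, le_div_iff₀ (by positivity)]
            exact this
          refine h1.trans ?_
          rw [Finset.prod_inv_distrib]
          refine inv_anti₀ (by positivity) (le_trans ?_ (Finset.one_add_sum_le_prod (F i)
            (x := fun n => κ * (ξ * b n) ^ 2) fun n => by positivity))
          have h2 : ∑ n ∈ F i, κ * (ξ * b n) ^ 2 = κ * ξ ^ 2 * ∑ n ∈ F i, b n ^ 2 := by
            rw [Finset.mul_sum]
            exact Finset.sum_congr rfl fun n _ => by ring
          rw [h2, hy]
          have := mul_le_mul_of_nonneg_left (hBF i) (by positivity : 0 ≤ κ * ξ ^ 2)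
          linarith
      _ = ((1 + y)⁻¹) ^ 6 := by simp

theorem hasSubgaussianMGF_mul_cos [IsProbabilityMeasure P] {X : Ω → ℝ} (hX : Measurable X)
    (hu : pdf.IsUniform X (Icc (0 : ℝ) 1) P volume) (b c : ℝ) :
    HasSubgaussianMGF (fun ω => b * Real.cos (2 * Real.pi * (c + X ω))) (‖b‖₊ ^ 2) P := by
  have hmean : ∫ ω, Real.cos (2 * Real.pi * (c + X ω)) ∂P = 0 := by
    rw [integral_comp_uniform hX hu (g := fun x => Real.cos (2 * Real.pi * x)) (by fun_prop)
      periodic_cos_two_pi,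
      intervalIntegral.integral_comp_mul_left (fun x => Real.cos x) (by positivity)]
    simp [Real.sin_two_pi]
  have h := hasSubgaussianMGF_of_mem_Icc_of_integral_eq_zero (μ := P)
    (X := fun ω => b * Real.cos (2 * Real.pi * (c + X ω))) (a := -|b|) (b := |b|)
    (Measurable.aemeasurable (by fun_prop))
    (Eventually.of_forall fun ω => abs_le.1 (norm_mul_cos_le b _))
    (by rw [integral_const_mul, hmean, mul_zero])
  have hb : ‖|b| - -|b|‖₊ / 2 = ‖b‖₊ := by
    rw [← NNReal.coe_inj]
    push_cast
    rw [sub_neg_eq_add, ← two_mul, norm_mul, Real.norm_eq_abs, Real.norm_eq_abs, Real.norm_eq_abs,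
      abs_abs, abs_two, mul_div_cancel_left₀ _ two_ne_zero]
  rwa [hb] at h

theorem hasSubgaussianMGF_cosineSeries [IsProbabilityMeasure P] (hθ : ∀ n, Measurable (θ n))
    (hindep : iIndepFun θ P)
    (hunif : ∀ n, pdf.IsUniform (θ n) (Icc (0 : ℝ) 1) P volume) {b : ℕ → ℝ}
    (hb : Summable fun n => |b n|) (c : ℕ → ℝ) {V : ℝ≥0}
    (hV : ∀ s : Finset ℕ, ∑ n ∈ s, b n ^ 2 ≤ V) :
    HasSubgaussianMGF (cosineSeries b c θ) V P := by
  have hm := measurable_cosineSeries hθ hb c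
  have hbd : ∀ ω, |cosineSeries b c θ ω| ≤ ∑' n, |b n| := fun ω =>
    le_of_tendsto (hasSum_cosineSeries hb c θ ω).tendsto_sum_nat.abs
      (Eventually.of_forall fun N => abs_sum_cosine_le hb c θ ω _)
  have hexp : ∀ t y : ℝ, |y| ≤ ∑' n, |b n| →
      ‖Real.exp (t * y)‖ ≤ Real.exp (|t| * ∑' n, |b n|) := by
    intro t y hy
    rw [Real.norm_eq_abs, Real.abs_exp, Real.exp_le_exp]
    exact (le_abs_self _).trans (by rw [abs_mul]; gcongr)
  refine ⟨fun t => Integrable.of_bound (by fun_prop) (Real.exp (|t| * ∑' n, |b n|))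
    (Eventually.of_forall fun ω => hexp t _ (hbd ω)), fun t => ?_⟩
  have hlim : Tendsto (fun N => mgf (fun ω => ∑ n ∈ Finset.range N,
      b n * Real.cos (2 * Real.pi * (c n + θ n ω))) P t) atTop
      (𝓝 (mgf (cosineSeries b c θ) P t)) := by
    refine tendsto_integral_of_dominated_convergence (fun _ => Real.exp (|t| * ∑' n, |b n|))
      (fun N => ?_) (integrable_const _)
      (fun N => Eventually.of_forall fun ω => hexp t _ (abs_sum_cosine_le hb c θ ω _))
      (Eventually.of_forall fun ω => ?_)
    · have := measurable_sum_cosine hθ b c (Finset.range N)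
      exact Measurable.aestronglyMeasurable (by fun_prop)
    · have hc : Continuous fun z : ℝ => Real.exp (t * z) := by fun_prop
      exact (hc.tendsto _).comp (hasSum_cosineSeries hb c θ ω).tendsto_sum_nat
  refine le_of_tendsto hlim (Eventually.of_forall fun N => ?_)
  have hind : iIndepFun (fun n ω => b n * Real.cos (2 * Real.pi * (c n + θ n ω))) P :=
    hindep.comp (fun n x => b n * Real.cos (2 * Real.pi * (c n + x))) fun n => by fun_prop
  have h1 := HasSubgaussianMGF.sum_of_iIndepFun hind (s := Finset.range N)
    (c := fun n => ‖b n‖₊ ^ 2) fun n _ => hasSubgaussianMGF_mul_cos (hθ n) (hunif n) (b n) (c n)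
  refine (h1.mgf_le t).trans (Real.exp_le_exp.2 ?_)
  have h2 : ((∑ n ∈ Finset.range N, ‖b n‖₊ ^ 2 : ℝ≥0) : ℝ) ≤ V := by
    push_cast
    simpa using hV (Finset.range N)
  gcongr

/-- Bound (t|X|)^p / p! by exp(t|X|) at t = V^(-1/2), where each of the two exponential moments is
at most e^(1/2) ≤ 2. -/
theorem lintegral_pow_le_of_hasSubgaussianMGF {X : Ω → ℝ} {V : ℝ≥0}
    (h : HasSubgaussianMGF X V P) (hV : 0 < V) (p : ℕ) :
    ∫⁻ ω, ENNReal.ofReal (|X ω| ^ p) ∂P ≤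
      ENNReal.ofReal (p.factorial * 4 * √V ^ p) := by
  have hs : 0 < √(V : ℝ) := Real.sqrt_pos.2 hV
  set t := (√(V : ℝ))⁻¹ with ht
  have ht0 : 0 < t := inv_pos.2 hs
  have hpt : ∀ ω, |X ω| ^ p ≤
      (p.factorial * √V ^ p) * (Real.exp (t * X ω) + Real.exp (-t * X ω)) := by
    intro ω
    have h1 := Real.pow_div_factorial_le_exp (x := t * |X ω|) (by positivity) p
    have h2 : Real.exp (t * |X ω|) ≤ Real.exp (t * X ω) + Real.exp (-t * X ω) := by
      rcases abs_choice (X ω) with h | h <;> rw [h]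
      · linarith [Real.exp_pos (-t * X ω)]
      · rw [mul_neg, ← neg_mul]; linarith [Real.exp_pos (t * X ω)]
    rw [mul_pow, div_le_iff₀ (by positivity)] at h1
    have h3 : √(V : ℝ) ^ p * t ^ p = 1 := by
      rw [← mul_pow, ht, mul_inv_cancel₀ hs.ne', one_pow]
    calc |X ω| ^ p = √(V : ℝ) ^ p * (t ^ p * |X ω| ^ p) := by rw [← mul_assoc, h3, one_mul]
      _ ≤ √(V : ℝ) ^ p * ((Real.exp (t * X ω) + Real.exp (-t * X ω)) * p.factorial) := by
          refine mul_le_mul_of_nonneg_left (h1.trans ?_) (by positivity)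
          exact mul_le_mul_of_nonneg_right h2 (by positivity)
      _ = _ := by ring
  have hi : Integrable (fun ω => (p.factorial * √V ^ p) *
      (Real.exp (t * X ω) + Real.exp (-t * X ω))) P :=
    ((h.integrable_exp_mul t).add (h.integrable_exp_mul (-t))).const_mul _
  calc ∫⁻ ω, ENNReal.ofReal (|X ω| ^ p) ∂P
      ≤ ∫⁻ ω, ENNReal.ofReal ((p.factorial * √V ^ p) *
          (Real.exp (t * X ω) + Real.exp (-t * X ω))) ∂P :=
        lintegral_mono fun ω => ENNReal.ofReal_le_ofReal (hpt ω)
    _ = ENNReal.ofReal (∫ ω, (p.factorial * √V ^ p) *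
          (Real.exp (t * X ω) + Real.exp (-t * X ω)) ∂P) := by
        rw [ofReal_integral_eq_lintegral_ofReal hi (Eventually.of_forall fun ω => ?_)]
        positivity
    _ ≤ _ := by
        refine ENNReal.ofReal_le_ofReal ?_
        rw [integral_const_mul, integral_add (h.integrable_exp_mul t) (h.integrable_exp_mul (-t))]
        have hVt : (V : ℝ) * t ^ 2 = 1 := by
          rw [ht, inv_pow, Real.sq_sqrt V.coe_nonneg, mul_inv_cancel₀ (NNReal.coe_pos.2 hV).ne']
        have he : Real.exp (1 / 2) ≤ 2 := by
          have h1 := Real.exp_one_lt_d9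
          have h2 : Real.exp (1 / 2) ^ 2 = Real.exp 1 := by
            rw [← Real.exp_nat_mul]; norm_num
          nlinarith [Real.exp_pos (1 / 2)]
        have h1 : ∫ ω, Real.exp (t * X ω) ∂P ≤ 2 := by
          refine ((h.mgf_le t).trans_eq ?_).trans he
          rw [hVt]
        have h2 : ∫ ω, Real.exp (-t * X ω) ∂P ≤ 2 := by
          refine ((h.mgf_le (-t)).trans_eq ?_).trans he
          rw [neg_sq, hVt]
        calc (p.factorial * √V ^ p) * _ ≤ (p.factorial * √(V : ℝ) ^ p) * (2 + 2) := by gcongr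
          _ = _ := by ring

end CosineSeries

/-! ### What the exponents σ and τ say about block norms. -/

section BlockExponents

variable {a lam : ℕ → ℝ} {q : ℝ}

theorem summable_sq_of_summable_abs (ha : Summable fun n => |a n|) :
    Summable fun n => |a n| ^ 2 := by
  refine Summable.of_nonneg_of_le (fun n => by positivity) (fun n => ?_)
    (ha.mul_left (∑' n, |a n|))
  rw [sq]
  exact mul_le_mul_of_nonneg_right (ha.le_tsum n fun _ _ => abs_nonneg _) (abs_nonneg _)

theorem blockNorm_sq (a lam : ℕ → ℝ) (q : ℝ) (k : ℕ) :
    blockNorm a lam q k ^ 2 = ∑' n, {m : ℕ | q ^ k ≤ lam m ∧ lam m < q ^ (k + 1)}.indicator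
      (fun m => |a m| ^ 2) n :=
  Real.sq_sqrt (tsum_nonneg fun _ => indicator_nonneg (fun _ _ => by positivity) _)

theorem blockNorm_nonneg (a lam : ℕ → ℝ) (q : ℝ) (k : ℕ) : 0 ≤ blockNorm a lam q k :=
  Real.sqrt_nonneg _

theorem eventually_lt_blockNorm (hq : 1 < q) {τ τ' : ℝ}
    (hτ : upperExponent a lam q = (τ : EReal)) (hττ' : τ < τ') :
    ∀ᶠ k : ℕ in atTop, q ^ (-(k * τ')) < blockNorm a lam q k := by
  have h1 : limsup (blockExponent a lam q) atTop < (τ' : EReal) := by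
    rw [show limsup (blockExponent a lam q) atTop = (τ : EReal) from hτ]
    exact_mod_cast hττ'
  filter_upwards [eventually_lt_of_limsup_lt h1, eventually_ge_atTop 1] with k hk hk1
  have hq0 : 0 < q := by linarith
  have hL : 0 < (k : ℝ) * Real.log q := mul_pos (by exact_mod_cast hk1) (Real.log_pos hq)
  rw [blockExponent, EReal.div_lt_iff (by exact_mod_cast hL) (EReal.coe_ne_top _)] at hk
  -- A vanishing block would have exponent +∞, which is not below τ'.
  rcases (blockNorm_nonneg a lam q k).eq_or_lt with h0 | h0
  · rw [← h0] at hk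
    simp at hk
  · rw [ENNReal.log_ofReal_of_pos h0, ← EReal.coe_mul, ← EReal.coe_neg, EReal.coe_lt_coe_iff] at hk
    rw [← Real.log_lt_log_iff (Real.rpow_pos_of_pos hq0 _) h0, Real.log_rpow hq0]
    linarith

theorem eventually_blockNorm_lt (hq : 1 < q) {σ γ : ℝ}
    (hσ : lowerExponent a lam q = (σ : EReal)) (hγσ : γ < σ) :
    ∀ᶠ k : ℕ in atTop, blockNorm a lam q k < q ^ (-(k * γ)) := by
  have h1 : (γ : EReal) < liminf (blockExponent a lam q) atTop := by
    rw [show liminf (blockExponent a lam q) atTop = (σ : EReal) from hσ]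
    exact_mod_cast hγσ
  filter_upwards [eventually_lt_of_lt_liminf h1, eventually_ge_atTop 1] with k hk hk1
  have hq0 : 0 < q := by linarith
  have hL : 0 < (k : ℝ) * Real.log q := mul_pos (by exact_mod_cast hk1) (Real.log_pos hq)
  rw [blockExponent, EReal.lt_div_iff (by exact_mod_cast hL) (EReal.coe_ne_top _)] at hk
  rcases (blockNorm_nonneg a lam q k).eq_or_lt with h0 | h0
  · rw [← h0]; positivity
  · rw [ENNReal.log_ofReal_of_pos h0, ← EReal.coe_mul, ← EReal.coe_neg, EReal.coe_lt_coe_iff] at hk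
    rw [← Real.log_lt_log_iff h0 (Real.rpow_pos_of_pos hq0 _), Real.log_rpow hq0]
    linarith

/-- A finite part of a block carries any amount strictly below the size of the block. -/
theorem exists_finset_lt_block (ha : Summable fun n => |a n|) {k : ℕ} {B : ℝ} (hB : 0 ≤ B)
    (h : B < blockNorm a lam q k) :
    ∃ F : Finset ℕ, (∀ n ∈ F, q ^ k ≤ lam n ∧ lam n < q ^ (k + 1)) ∧
      B ^ 2 ≤ ∑ n ∈ F, a n ^ 2 := by
  classical
  set S := {m : ℕ | q ^ k ≤ lam m ∧ lam m < q ^ (k + 1)} with hS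
  have hsum : Summable (S.indicator fun m => |a m| ^ 2) :=
    (summable_sq_of_summable_abs ha).indicator S
  have h1 : B ^ 2 < ∑' n, S.indicator (fun m => |a m| ^ 2) n := by
    rw [← blockNorm_sq]
    exact pow_lt_pow_left₀ h hB two_ne_zero
  obtain ⟨F, hF⟩ := (hsum.hasSum.eventually (lt_mem_nhds h1)).exists
  refine ⟨F.filter (· ∈ S), fun n hn => (Finset.mem_filter.1 hn).2, hF.le.trans_eq ?_⟩
  rw [Finset.sum_filter]
  refine Finset.sum_congr rfl fun n _ => ?_
  simp only [indicator, sq_abs]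

/-- Sobolev-type regularity read off from the lower exponent. -/
theorem exists_sum_sq_mul_rpow_le (ha : Summable fun n => |a n|) (hlam : ∀ n, 1 ≤ lam n)
    (hq : 1 < q) {σ γ : ℝ} (hσ : lowerExponent a lam q = (σ : EReal)) (hγ : 0 ≤ γ) (hγσ : γ < σ) :
    ∃ V : ℝ, 0 < V ∧ ∀ s : Finset ℕ, ∑ n ∈ s, a n ^ 2 * lam n ^ (2 * γ) ≤ V := by
  have hq0 : 0 < q := by linarith
  obtain ⟨γ', hγγ', hγ'σ⟩ := exists_between hγσ
  set S : ℕ → Set ℕ := fun k => {m : ℕ | q ^ k ≤ lam m ∧ lam m < q ^ (k + 1)} with hS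
  set A : ℕ → ℝ := fun k => blockNorm a lam q k ^ 2 * q ^ (((k : ℝ) + 1) * (2 * γ)) with hA
  have hA0 : ∀ k, 0 ≤ A k := fun k => by positivity
  -- The choice γ < γ' < σ makes the contribution of block k at most of order q^(-2k(γ' - γ)).
  have hAs : Summable A := by
    have hgeo : Summable fun k : ℕ => q ^ (2 * γ) * (q ^ (-(2 * (γ' - γ)))) ^ k := by
      refine (summable_geometric_of_lt_one (by positivity) ?_).mul_left _
      exact Real.rpow_lt_one_of_one_lt_of_neg hq (by linarith)
    refine Summable.of_norm_bounded_eventually_nat hgeo ?_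
    filter_upwards [eventually_blockNorm_lt hq hσ hγ'σ] with k hk
    rw [Real.norm_of_nonneg (hA0 k)]
    calc A k ≤ (q ^ (-(k * γ'))) ^ 2 * q ^ (((k : ℝ) + 1) * (2 * γ)) := by
          simp only [hA]
          have := blockNorm_nonneg a lam q k
          gcongr
      _ = q ^ (2 * γ) * (q ^ (-(2 * (γ' - γ)))) ^ k := by
          rw [← Real.rpow_natCast (q ^ (-(k * γ'))), ← Real.rpow_natCast (q ^ (-(2 * (γ' - γ)))),
            ← Real.rpow_mul hq0.le, ← Real.rpow_mul hq0.le, ← Real.rpow_add hq0,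
            ← Real.rpow_add hq0]
          congr 1
          push_cast
          ring
  have hterm : ∀ n, ENNReal.ofReal (a n ^ 2 * lam n ^ (2 * γ)) ≤
      ∑' k, ENNReal.ofReal ((S k).indicator (fun m => |a m| ^ 2) n *
        q ^ (((k : ℝ) + 1) * (2 * γ))) := by
    intro n
    -- As all frequencies are at least 1, every index lies in some block.
    obtain ⟨k, hk1, hk2⟩ := exists_nat_pow_near (hlam n) hq
    refine le_trans ?_ (ENNReal.le_tsum k)
    have hn : n ∈ S k := ⟨hk1, hk2⟩
    rw [indicator_of_mem hn, sq_abs]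
    refine ENNReal.ofReal_le_ofReal ?_
    have h0 : 0 ≤ lam n := zero_le_one.trans (hlam n)
    gcongr
    rw [Real.rpow_mul hq0.le]
    refine Real.rpow_le_rpow h0 ?_ (by linarith)
    have : q ^ ((k : ℝ) + 1) = q ^ (k + 1) := by exact_mod_cast Real.rpow_natCast q (k + 1)
    rw [this]
    exact hk2.le
  have htot : ∑' n, ENNReal.ofReal (a n ^ 2 * lam n ^ (2 * γ)) ≤ ENNReal.ofReal (∑' k, A k) := by
    refine (ENNReal.tsum_le_tsum hterm).trans ?_
    rw [ENNReal.tsum_comm, ENNReal.ofReal_tsum_of_nonneg hA0 hAs]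
    refine ENNReal.tsum_le_tsum fun k => ?_
    have hs : Summable ((S k).indicator fun m => |a m| ^ 2) :=
      (summable_sq_of_summable_abs ha).indicator _
    rw [← ENNReal.ofReal_tsum_of_nonneg
      (fun n => mul_nonneg (indicator_nonneg (fun _ _ => by positivity) _) (by positivity))
      (hs.mul_right _), tsum_mul_right]
    refine ENNReal.ofReal_le_ofReal (le_of_eq ?_)
    simp only [hA]
    rw [blockNorm_sq]
  have hAnn : 0 ≤ ∑' k, A k := tsum_nonneg hA0
  refine ⟨∑' k, A k + 1, by linarith, fun s => ?_⟩
  have hnn : ∀ n, 0 ≤ a n ^ 2 * lam n ^ (2 * γ) := fun n =>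
    mul_nonneg (sq_nonneg _) (Real.rpow_nonneg (zero_le_one.trans (hlam n)) _)
  have h1 := (ENNReal.sum_le_tsum s).trans htot
  rw [← ENNReal.ofReal_sum_of_nonneg fun n _ => hnn n,
    ENNReal.ofReal_le_ofReal_iff hAnn] at h1
  linarith

end BlockExponents

/-! ### Increments of the sine series: small balls and subgaussian bounds. -/

section SineSeries

variable {Ω : Type*} {a lam : ℕ → ℝ}

theorem norm_mul_sin_le (b y : ℝ) : ‖b * Real.sin y‖ ≤ |b| := by
  rw [norm_mul, Real.norm_eq_abs, Real.norm_eq_abs]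
  exact mul_le_of_le_one_right (abs_nonneg _) (Real.abs_sin_le_one _)

theorem hasSum_sineSeries (ha : Summable fun n => |a n|) (lam : ℕ → ℝ) (θ : ℕ → Ω → ℝ) (ω : Ω)
    (x : ℝ) : HasSum (fun n => a n * Real.sin (2 * Real.pi * (lam n * x + θ n ω)))
      (sineSeries a lam θ ω x) :=
  (Summable.of_norm_bounded ha fun _ => norm_mul_sin_le _ _).hasSum

theorem continuous_sineSeries (ha : Summable fun n => |a n|) (lam : ℕ → ℝ) (θ : ℕ → Ω → ℝ)
    (ω : Ω) : Continuous (sineSeries a lam θ ω) :=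
  continuous_tsum (fun n => by fun_prop) ha fun _ _ => norm_mul_sin_le _ _

theorem measurable_sineSeries_comp [MeasurableSpace Ω] {θ : ℕ → Ω → ℝ}
    (hθ : ∀ n, Measurable (θ n)) (ha : Summable fun n => |a n|) (lam : ℕ → ℝ) {β : Type*}
    [MeasurableSpace β] {g : β → Ω} {x : β → ℝ} (hg : Measurable g) (hx : Measurable x) :
    Measurable fun p => sineSeries a lam θ (g p) (x p) := by
  refine measurable_of_tendsto_metrizable (f := fun N p => ∑ n ∈ Finset.range N,
    a n * Real.sin (2 * Real.pi * (lam n * x p + θ n (g p)))) (fun N => ?_) ?_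
  · refine Finset.measurable_sum _ fun n _ => ?_
    have := (hθ n).comp hg
    simp only [Function.comp_def] at this
    fun_prop
  · rw [tendsto_pi_nhds]
    exact fun p => (hasSum_sineSeries ha lam θ (g p) (x p)).tendsto_sum_nat

theorem measurable_sineSeries [MeasurableSpace Ω] {θ : ℕ → Ω → ℝ}
    (hθ : ∀ n, Measurable (θ n)) (ha : Summable fun n => |a n|) (lam : ℕ → ℝ) (x : ℝ) :
    Measurable fun ω => sineSeries a lam θ ω x :=
  measurable_sineSeries_comp hθ ha lam (g := fun ω => ω) (x := fun _ => x) measurable_id'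
    measurable_const

theorem abs_sineSeries_le (ha : Summable fun n => |a n|) (lam : ℕ → ℝ) (θ : ℕ → Ω → ℝ) (ω : Ω)
    (x : ℝ) : |sineSeries a lam θ ω x| ≤ ∑' n, |a n| :=
  tsum_of_norm_bounded ha.hasSum fun _ => norm_mul_sin_le _ _

theorem summable_abs_increment (ha : Summable fun n => |a n|) (lam : ℕ → ℝ) (h : ℝ) :
    Summable fun n => |2 * a n * Real.sin (Real.pi * (lam n * h))| := by
  refine Summable.of_nonneg_of_le (fun n => abs_nonneg _) (fun n => ?_) (ha.mul_left 2)
  refine (norm_mul_sin_le _ _).trans_eq ?_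
  rw [abs_mul, abs_two]

/-- The amplitudes depend on x - y only and the midpoint enters only through the phase shifts, so
both estimates below are uniform in the position. -/
theorem sineSeries_sub (ha : Summable fun n => |a n|) (lam : ℕ → ℝ) (θ : ℕ → Ω → ℝ) (ω : Ω)
    (x y : ℝ) : sineSeries a lam θ ω x - sineSeries a lam θ ω y =
      cosineSeries (fun n => 2 * a n * Real.sin (Real.pi * (lam n * (x - y))))
        (fun n => lam n * ((x + y) / 2)) θ ω := by
  refine (((hasSum_sineSeries ha lam θ ω x).sub (hasSum_sineSeries ha lam θ ω y)).unique ?_)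
  convert! hasSum_cosineSeries (summable_abs_increment ha lam (x - y))
    (fun n => lam n * ((x + y) / 2)) θ ω using 2 with n
  rw [← mul_sub, Real.sin_sub_sin]
  have h1 : (2 * Real.pi * (lam n * x + θ n ω) - 2 * Real.pi * (lam n * y + θ n ω)) / 2 =
      Real.pi * (lam n * (x - y)) := by ring
  have h2 : (2 * Real.pi * (lam n * x + θ n ω) + 2 * Real.pi * (lam n * y + θ n ω)) / 2 =
      2 * Real.pi * (lam n * ((x + y) / 2) + θ n ω) := by ring
  rw [h1, h2]
  ring

variable [MeasurableSpace Ω] {P : Measure Ω} [IsProbabilityMeasure P] {θ : ℕ → Ω → ℝ} {q : ℝ}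

/-- Take q^k just below 1/(2 q^6 h). In the blocks k, ..., k+5 one has λh ≤ 1/2 and 2λh ≥ q^(-7), so
sin(πλh) ≥ q^(-7) by concavity; and h ≤ q^(-(k+i)) makes h^τ' smaller than the norm of block k+i.
These are the six disjoint groups required. -/
theorem exists_measure_abs_sineSeries_sub_le (hθ : ∀ n, Measurable (θ n)) (hindep : iIndepFun θ P)
    (hunif : ∀ n, pdf.IsUniform (θ n) (Icc (0 : ℝ) 1) P volume)
    (ha : Summable fun n => |a n|) (hq : 1 < q) {τ τ' : ℝ}
    (hτ : upperExponent a lam q = (τ : EReal)) (hττ' : τ < τ') (hτ' : 0 < τ') :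
    ∃ D h₀ : ℝ, 0 < D ∧ 0 < h₀ ∧ ∀ x y, 0 < |x - y| → |x - y| ≤ h₀ → ∀ r, 0 < r →
      P {ω | |sineSeries a lam θ ω x - sineSeries a lam θ ω y| ≤ r} ≤
        ENNReal.ofReal (D * r / |x - y| ^ τ') := by
  have hq0 : 0 < q := by linarith
  obtain ⟨D, hD, hball⟩ := exists_measure_abs_cosineSeries_le hθ hindep hunif
  obtain ⟨K, hK⟩ := eventually_atTop.1 (eventually_lt_blockNorm hq hτ hττ')
  -- The factor q^7 comes from the lower bound on the sines; the bound on h forces k ≥ K, where the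
  -- block estimates hold.
  refine ⟨D * q ^ 7, 1 / (2 * q ^ 6 * q ^ (K + 1)), by positivity, by positivity,
    fun x y hxy hxy0 r hr => ?_⟩
  set h := |x - y| with hh
  have hx1 : q ^ (K + 1) ≤ 1 / (2 * q ^ 6 * h) := by
    rw [le_div_iff₀ (by positivity)] at hxy0 ⊢
    linarith
  obtain ⟨k, hk1, hk2⟩ := exists_nat_pow_near ((one_le_pow₀ hq.le).trans hx1) hq
  have hKk : K ≤ k := by
    have := (pow_lt_pow_iff_right₀ hq).1 (hx1.trans_lt hk2)
    omega
  have hk6 : q ^ (k + 6) * h ≤ 1 / 2 := by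
    rw [le_div_iff₀ (by positivity)] at hk1
    rw [pow_add]; linarith
  have hk7 : (q ^ 7)⁻¹ ≤ 2 * (q ^ k * h) := by
    rw [div_lt_iff₀ (by positivity)] at hk2
    rw [inv_le_iff_one_le_mul₀' (by positivity)]
    have : q ^ (k + 1) * (2 * q ^ 6 * h) = q ^ 7 * (2 * (q ^ k * h)) := by ring
    linarith
  have hex : ∀ i : Fin 6, ∃ F : Finset ℕ,
      (∀ n ∈ F, q ^ (k + i) ≤ lam n ∧ lam n < q ^ (k + i + 1)) ∧
        (h ^ τ') ^ 2 ≤ ∑ n ∈ F, a n ^ 2 := by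
    intro i
    refine exists_finset_lt_block ha (by positivity) (lt_of_le_of_lt ?_ (hK (k + i) (by omega)))
    have h1 : q ^ (k + (i : ℕ)) * h ≤ 1 := by
      have : q ^ (k + (i : ℕ)) ≤ q ^ (k + 6) := pow_le_pow_right₀ hq.le (by omega)
      have := mul_le_mul_of_nonneg_right this hxy.le
      linarith
    have h2 : h ≤ (q ^ (k + (i : ℕ)))⁻¹ := by
      rw [← one_div, le_div_iff₀ (by positivity)]
      linarith
    calc h ^ τ' ≤ ((q ^ (k + (i : ℕ)))⁻¹) ^ τ' := Real.rpow_le_rpow hxy.le h2 hτ'.le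
      _ = q ^ (-(((k + (i : ℕ) : ℕ) : ℝ) * τ')) := by
          rw [← Real.rpow_natCast, ← Real.rpow_neg hq0.le, ← Real.rpow_mul hq0.le, neg_mul]
  choose F hFmem hFsum using hex
  have hdisj : Pairwise (Function.onFun Disjoint F) := by
    have key : ∀ i j : Fin 6, i < j → Disjoint (F i) (F j) := by
      intro i j hij
      rw [Finset.disjoint_left]
      intro n hi hj
      have h1 : q ^ (k + (i : ℕ) + 1) ≤ q ^ (k + (j : ℕ)) :=
        pow_le_pow_right₀ hq.le (by have : (i : ℕ) < j := hij; omega)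
      exact absurd ((hFmem i n hi).2.trans_le h1) (not_lt.2 (hFmem j n hj).1)
    intro i j hij
    rcases lt_or_gt_of_ne hij with h | h
    · exact key i j h
    · exact (key j i h).symm
  have hB : 0 < (q ^ 7)⁻¹ * h ^ τ' := by positivity
  have hsq : ∀ i, ((q ^ 7)⁻¹ * h ^ τ') ^ 2 ≤
      ∑ n ∈ F i, (2 * a n * Real.sin (Real.pi * (lam n * (x - y)))) ^ 2 := by
    intro i
    rw [mul_pow]
    refine (mul_le_mul_of_nonneg_left (hFsum i) (by positivity)).trans ?_
    rw [Finset.mul_sum]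
    refine Finset.sum_le_sum fun n hn => ?_
    obtain ⟨hn1, hn2⟩ := hFmem i n hn
    have hlam0 : 0 < lam n := (by positivity : 0 < q ^ (k + (i : ℕ))).trans_le hn1
    have hlam1 : lam n * h ≤ 1 / 2 := by
      have h1 : lam n ≤ q ^ (k + 6) := hn2.le.trans (pow_le_pow_right₀ hq.le (by omega))
      exact (mul_le_mul_of_nonneg_right h1 hxy.le).trans hk6
    have hlam2 : q ^ k ≤ lam n := (pow_le_pow_right₀ hq.le (by omega)).trans hn1
    have hs1 : (q ^ 7)⁻¹ ≤ Real.sin (Real.pi * (lam n * h)) := by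
      have h1 := Real.mul_le_sin (x := Real.pi * (lam n * h)) (by positivity)
        (by nlinarith [Real.pi_pos])
      have h2 : 2 / Real.pi * (Real.pi * (lam n * h)) = 2 * (lam n * h) := by
        field_simp
      have h3 := mul_le_mul_of_nonneg_right hlam2 hxy.le
      linarith
    have hs2 : Real.sin (Real.pi * (lam n * (x - y))) ^ 2 =
        Real.sin (Real.pi * (lam n * h)) ^ 2 := by
      rcases abs_choice (x - y) with h1 | h1
      · rw [hh, h1]
      · rw [hh, h1, mul_neg, mul_neg, Real.sin_neg, neg_sq]
    rw [mul_pow, hs2]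
    have h4 : (q ^ 7)⁻¹ ^ 2 ≤ Real.sin (Real.pi * (lam n * h)) ^ 2 :=
      pow_le_pow_left₀ (by positivity) hs1 2
    calc (q ^ 7)⁻¹ ^ 2 * a n ^ 2 ≤ Real.sin (Real.pi * (lam n * h)) ^ 2 * (4 * a n ^ 2) := by
          gcongr; linarith [sq_nonneg (a n)]
      _ = _ := by ring
  have hkey := hball (summable_abs_increment ha lam (x - y)) (fun n => lam n * ((x + y) / 2)) F
    hdisj hB hsq hr
  simp only [sineSeries_sub ha]
  refine hkey.trans_eq ?_
  congr 1
  field_simp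

/-- Interpolation: sin² y ≤ |y|^(2γ) for 0 ≤ γ ≤ 1 turns the sum of squared amplitudes into |x -
y|^(2γ) times the weighted sum Σ a_n² λ_n^(2γ). -/
theorem exists_hasSubgaussianMGF_sineSeries_sub (hθ : ∀ n, Measurable (θ n))
    (hindep : iIndepFun θ P)
    (hunif : ∀ n, pdf.IsUniform (θ n) (Icc (0 : ℝ) 1) P volume)
    (ha : Summable fun n => |a n|) (hlam : ∀ n, 1 ≤ lam n) (hq : 1 < q) {σ γ : ℝ}
    (hσ : lowerExponent a lam q = (σ : EReal)) (hγ : 0 ≤ γ) (hγσ : γ < σ) (hγ1 : γ ≤ 1) :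
    ∃ V : ℝ≥0, 0 < V ∧ ∀ x y, HasSubgaussianMGF
      (fun ω => sineSeries a lam θ ω x - sineSeries a lam θ ω y)
      (V * (Real.toNNReal |x - y|) ^ (2 * γ)) P := by
  obtain ⟨V, hV, hVs⟩ := exists_sum_sq_mul_rpow_le ha hlam hq hσ hγ hγσ
  refine ⟨(4 * Real.pi ^ (2 * γ) * V).toNNReal, Real.toNNReal_pos.2 (by positivity),
    fun x y => ?_⟩
  simp only [sineSeries_sub ha]
  refine hasSubgaussianMGF_cosineSeries hθ hindep hunif (summable_abs_increment ha lam (x - y))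
    _ fun s => ?_
  rw [NNReal.coe_mul, NNReal.coe_rpow, Real.coe_toNNReal _ (by positivity),
    Real.coe_toNNReal _ (abs_nonneg _)]
  have hsin : ∀ y : ℝ, Real.sin y ^ 2 ≤ |y| ^ (2 * γ) := by
    intro y
    rcases le_total |y| 1 with h | h
    · have h1 : Real.sin y ^ 2 ≤ |y| ^ (2 : ℝ) := by
        rw [Real.rpow_two]
        exact sq_le_sq.2 ((Real.abs_sin_le_abs).trans (le_abs_self _))
      rcases (abs_nonneg y).eq_or_lt with h0 | h0
      · rw [← h0, Real.zero_rpow two_ne_zero] at h1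
        exact h1.trans (by positivity)
      · exact h1.trans (Real.rpow_le_rpow_of_exponent_ge h0 h (by linarith))
    · exact (Real.sin_sq_le_one y).trans (Real.one_le_rpow h (by linarith))
  calc ∑ n ∈ s, (2 * a n * Real.sin (Real.pi * (lam n * (x - y)))) ^ 2
      ≤ ∑ n ∈ s, 4 * Real.pi ^ (2 * γ) * |x - y| ^ (2 * γ) * (a n ^ 2 * lam n ^ (2 * γ)) := by
        refine Finset.sum_le_sum fun n _ => ?_
        have hl : 0 ≤ lam n := zero_le_one.trans (hlam n)
        have h1 := hsin (Real.pi * (lam n * (x - y)))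
        rw [abs_mul, abs_mul, abs_of_pos Real.pi_pos, abs_of_nonneg hl,
          Real.mul_rpow Real.pi_pos.le (by positivity), Real.mul_rpow hl (abs_nonneg _)] at h1
        have h2 := mul_le_mul_of_nonneg_left h1 (by positivity : 0 ≤ 4 * a n ^ 2)
        calc _ = 4 * a n ^ 2 * Real.sin (Real.pi * (lam n * (x - y))) ^ 2 := by ring
          _ ≤ _ := h2
          _ = _ := by ring
    _ = 4 * Real.pi ^ (2 * γ) * |x - y| ^ (2 * γ) * ∑ n ∈ s, a n ^ 2 * lam n ^ (2 * γ) := by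
        rw [Finset.mul_sum]
    _ ≤ 4 * Real.pi ^ (2 * γ) * |x - y| ^ (2 * γ) * V := by gcongr; exact hVs s
    _ = _ := by ring

end SineSeries

/-! ### Kolmogorov chaining and almost sure Hölder regularity. -/

section Holder

/-- A continuous function with Hölder increments over dyadic points is Hölder. -/
theorem exists_holder_of_dyadic {f : ℝ → ℝ} (hf : Continuous f) {u C γ : ℝ} (hC : 0 ≤ C)
    (hγ : 0 < γ) (h : ∀ m j : ℕ, j < 2 ^ m →
      |f (u + (j + 1 : ℕ) / 2 ^ m) - f (u + (j : ℕ) / 2 ^ m)| ≤ C * ((2 : ℝ) ^ (-γ)) ^ m) :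
    ∃ C' : ℝ, 0 ≤ C' ∧ ∀ x ∈ Icc u (u + 1), ∀ y ∈ Icc u (u + 1),
      |f x - f y| ≤ C' * |x - y| ^ γ := by
  set ρ : ℝ := 2 ^ (-γ) with hρ
  have hρ0 : 0 < ρ := by positivity
  have hρ1 : ρ < 1 := Real.rpow_lt_one_of_one_lt_of_neg (by norm_num) (by linarith)
  -- Dyadic approximation of z from below; consecutive approximations coincide or are neighbours at
  -- the finer level.
  let N : ℕ → ℝ → ℕ := fun m z => ⌊2 ^ m * z⌋₊
  let Z : ℕ → ℝ → ℝ := fun m z => f (u + (N m z : ℕ) / 2 ^ m)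
  have hNle : ∀ m z, z ≤ 1 → N m z ≤ 2 ^ m := by
    intro m z hz
    refine Nat.floor_le_of_le ?_
    push_cast
    exact mul_le_of_le_one_right (by positivity) hz
  have hstep : ∀ z, 0 ≤ z → z ≤ 1 → ∀ m, dist (Z m z) (Z (m + 1) z) ≤ C * ρ ^ m := by
    intro z hz0 hz1 m
    have hnn : (0 : ℝ) ≤ 2 ^ m * z := by positivity
    have h1 := Nat.floor_le hnn
    have h2 := Nat.lt_floor_add_one ((2 : ℝ) ^ m * z)
    have h3 : 2 * N m z ≤ N (m + 1) z := by
      refine Nat.le_floor ?_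
      push_cast
      rw [pow_succ]
      change 2 * (⌊(2 : ℝ) ^ m * z⌋₊ : ℝ) ≤ _
      linarith
    have h4 : N (m + 1) z < 2 * N m z + 2 := by
      refine (Nat.floor_lt (by positivity)).2 ?_
      push_cast
      rw [pow_succ]
      change _ < 2 * (⌊(2 : ℝ) ^ m * z⌋₊ : ℝ) + 2
      linarith
    have h5 : ((2 * N m z : ℕ) : ℝ) / 2 ^ (m + 1) = (N m z : ℝ) / 2 ^ m := by
      rw [pow_succ]; push_cast; field_simp
    rcases (show N (m + 1) z = 2 * N m z ∨ N (m + 1) z = 2 * N m z + 1 by omega) with h6 | h6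
    · have : Z (m + 1) z = Z m z := by
        simp only [Z]
        rw [h6, h5]
      rw [this, dist_self]
      positivity
    · have h7 : 2 * N m z < 2 ^ (m + 1) := by
        have := hNle (m + 1) z hz1
        omega
      have h8 := h (m + 1) (2 * N m z) h7
      rw [h5, ← h6] at h8
      rw [dist_comm, Real.dist_eq]
      refine h8.trans ?_
      rw [pow_succ]
      have : C * ρ ^ m * ρ ≤ C * ρ ^ m * 1 := by gcongr
      linarith
  have hlim : ∀ z, 0 ≤ z → Tendsto (fun m => Z m z) atTop (𝓝 (f (u + z))) := by
    intro z hz0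
    refine (hf.tendsto _).comp (tendsto_const_nhds.add ?_)
    have h1 := (tendsto_nat_floor_mul_div_atTop (R := ℝ) hz0).comp
      (tendsto_pow_atTop_atTop_of_one_lt (one_lt_two (α := ℝ)))
    refine h1.congr fun m => ?_
    simp only [Function.comp, N]
    rw [mul_comm z]
  have hdist : ∀ z, 0 ≤ z → z ≤ 1 → ∀ m, |Z m z - f (u + z)| ≤ C * ρ ^ m / (1 - ρ) :=
    fun z hz0 hz1 m => dist_le_of_le_geometric_of_tendsto ρ C hρ1 (hstep z hz0 hz1) (hlim z hz0) m
  -- Two geometric tails plus one step at the level m with 2^(-(m+1)) < w - z ≤ 2^(-m); the factor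
  -- 2^γ pays for replacing 2^(-m) by w - z.
  set C' : ℝ := (2 * (C / (1 - ρ)) + C) * 2 ^ γ with hC'
  have h1ρ : 0 < 1 - ρ := by linarith
  have key : ∀ z w, 0 ≤ z → z < w → w ≤ 1 → |f (u + z) - f (u + w)| ≤ C' * (w - z) ^ γ := by
    intro z w hz0 hzw hw1
    have hwz : 0 < w - z := by linarith
    obtain ⟨m, hm1, hm2⟩ := exists_nat_pow_near_of_lt_one hwz (by linarith : w - z ≤ 1)
      (by norm_num : (0 : ℝ) < 2⁻¹) (by norm_num)
    have h2m : (0 : ℝ) < 2 ^ m := by positivity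
    have h1 : N m z ≤ N m w := Nat.floor_mono (by gcongr)
    have h2 : N m w ≤ N m z + 1 := by
      have h3 : (2 : ℝ) ^ m * w ≤ 2 ^ m * z + 1 := by
        have : (2 : ℝ) ^ m * (w - z) ≤ 2 ^ m * 2⁻¹ ^ m := by gcongr
        rw [← mul_pow] at this
        norm_num at this
        linarith
      refine (Nat.floor_mono h3).trans ?_
      rw [Nat.floor_add_one (by positivity)]
    have hmid : |Z m z - Z m w| ≤ C * ρ ^ m := by
      rcases (show N m w = N m z ∨ N m w = N m z + 1 by omega) with h3 | h3
      · have : Z m w = Z m z := by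
          simp only [Z]
          rw [h3]
        rw [this, sub_self, abs_zero]; positivity
      · have h4 := h m (N m z) (by have := hNle m w hw1; omega)
        rw [abs_sub_comm, ← h3] at h4
        exact h4
    have h5 := hdist z hz0 (by linarith) m
    have h6 := hdist w (by linarith) hw1 m
    have h7 : |f (u + z) - f (u + w)| ≤ C * ρ ^ m / (1 - ρ) + C * ρ ^ m + C * ρ ^ m / (1 - ρ) := by
      have e : f (u + z) - f (u + w) =
          -(Z m z - f (u + z)) + (Z m z - Z m w) + (Z m w - f (u + w)) := by ring
      rw [e]
      refine (abs_add_le _ _).trans (add_le_add ((abs_add_le _ _).trans (add_le_add ?_ hmid)) h6)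
      rwa [abs_neg]
    have h8 : ρ ^ m ≤ 2 ^ γ * (w - z) ^ γ := by
      rw [← Real.mul_rpow (by norm_num) hwz.le]
      calc ρ ^ m = ((2⁻¹ : ℝ) ^ m) ^ γ := by
            rw [hρ, ← Real.rpow_natCast, ← Real.rpow_natCast, ← Real.rpow_mul (by norm_num),
              ← Real.rpow_mul (by norm_num), Real.inv_rpow (by norm_num),
              ← Real.rpow_neg (by norm_num)]
            congr 1; ring
        _ ≤ (2 * (w - z)) ^ γ := by
            refine Real.rpow_le_rpow (by positivity) ?_ hγ.le
            rw [pow_succ] at hm1; linarith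
    calc _ ≤ _ := h7
      _ = (2 * (C / (1 - ρ)) + C) * ρ ^ m := by ring
      _ ≤ (2 * (C / (1 - ρ)) + C) * (2 ^ γ * (w - z) ^ γ) := by gcongr
      _ = C' * (w - z) ^ γ := by rw [hC']; ring
  refine ⟨C', by positivity, fun x hx y hy => ?_⟩
  rcases lt_trichotomy x y with hxy | hxy | hxy
  · have := key (x - u) (y - u) (by linarith [hx.1]) (by linarith) (by linarith [hy.2])
    rw [add_sub_cancel, add_sub_cancel, sub_sub_sub_cancel_right] at this
    rwa [abs_sub_comm x y, abs_of_pos (sub_pos.2 hxy)]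
  · rw [hxy, sub_self, sub_self, abs_zero]; positivity
  · have := key (y - u) (x - u) (by linarith [hy.1]) (by linarith) (by linarith [hx.2])
    rw [add_sub_cancel, add_sub_cancel, sub_sub_sub_cancel_right] at this
    rwa [abs_sub_comm, abs_of_pos (sub_pos.2 hxy)]

/-- The condition p(γ' - γ) ≥ 2 makes the rescaled p-th moment at level m decay like 4^(-m), which
survives summation over the 2^m increments of that level. -/
theorem lintegral_rescaled_pow_le {Ω : Type*} [MeasurableSpace Ω] {P : Measure Ω} {X : Ω → ℝ}
    (hX : Measurable X) {V : ℝ≥0} (hV : 0 < V) {γ γ' : ℝ} {p m : ℕ} (hp2 : 2 ≤ p * (γ' - γ))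
    (hh : HasSubgaussianMGF X (V * (Real.toNNReal ((2⁻¹ : ℝ) ^ m)) ^ (2 * γ')) P) :
    ∫⁻ ω, ENNReal.ofReal ((|X ω| / ((2 : ℝ) ^ (-γ)) ^ m) ^ p) ∂P ≤
      ENNReal.ofReal (p.factorial * 4 * √(V : ℝ) ^ p * (1 / 4) ^ m) := by
  set ρ : ℝ := 2 ^ (-γ) with hρ
  have hρ0 : 0 < ρ := by positivity
  set K : ℝ := p.factorial * 4 * √(V : ℝ) ^ p with hK
  have hVpos : 0 < V * (Real.toNNReal ((2⁻¹ : ℝ) ^ m)) ^ (2 * γ') :=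
    mul_pos hV (NNReal.rpow_pos (Real.toNNReal_pos.2 (by positivity)))
  have h1 := lintegral_pow_le_of_hasSubgaussianMGF hh hVpos p
  have h2 : √((V * (Real.toNNReal ((2⁻¹ : ℝ) ^ m)) ^ (2 * γ') : ℝ≥0) : ℝ) =
      √(V : ℝ) * ((2 : ℝ) ^ (-γ')) ^ m := by
    rw [NNReal.coe_mul, Real.sqrt_mul (NNReal.coe_nonneg _), NNReal.coe_rpow,
      Real.coe_toNNReal _ (by positivity), mul_comm 2 γ', Real.rpow_mul (by positivity),
      Real.rpow_two, Real.sqrt_sq (by positivity), ← Real.rpow_natCast, ← Real.rpow_natCast,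
      ← Real.rpow_mul (by norm_num), ← Real.rpow_mul (by norm_num), Real.inv_rpow (by norm_num),
      ← Real.rpow_neg (by norm_num)]
    congr 2; ring
  rw [h2] at h1
  have h3 : ∀ ω, ENNReal.ofReal ((|X ω| / ρ ^ m) ^ p) =
      ENNReal.ofReal (((ρ ^ m) ^ p)⁻¹) * ENNReal.ofReal (|X ω| ^ p) := fun ω => by
    rw [← ENNReal.ofReal_mul (by positivity), div_pow, div_eq_inv_mul]
  simp only [h3]
  have hm : Measurable fun ω => ENNReal.ofReal (|X ω| ^ p) :=
    ((continuous_abs.measurable.comp hX).pow_const p).ennreal_ofReal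
  rw [lintegral_const_mul _ hm]
  refine (mul_le_mul_right h1 _).trans ?_
  rw [← ENNReal.ofReal_mul (by positivity)]
  refine ENNReal.ofReal_le_ofReal ?_
  have h4 : ((2 : ℝ) ^ (-γ')) ^ p ≤ ρ ^ p * (1 / 4) := by
    have e1 : ((2 : ℝ) ^ (-γ')) ^ p = 2 ^ (-(p * γ')) := by
      rw [← Real.rpow_natCast, ← Real.rpow_mul (by norm_num)]; congr 1; ring
    have e2 : ρ ^ p * (1 / 4) = (2 : ℝ) ^ (-(p * γ) - 2) := by
      rw [hρ, ← Real.rpow_natCast, ← Real.rpow_mul (by norm_num), Real.rpow_sub (by norm_num),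
        Real.rpow_two]
      rw [show -γ * (p : ℝ) = -(p * γ) by ring]
      norm_num
      ring
    rw [e1, e2]
    exact Real.rpow_le_rpow_of_exponent_le (by norm_num) (by linarith)
  have h5 : (((2 : ℝ) ^ (-γ')) ^ m) ^ p ≤ (ρ ^ m) ^ p * (1 / 4) ^ m := by
    rw [← pow_mul, ← pow_mul, mul_comm m p, pow_mul, pow_mul, ← mul_pow]
    gcongr
  rw [inv_mul_le_iff₀ (by positivity), mul_pow, ← mul_assoc]
  calc K * (((2 : ℝ) ^ (-γ')) ^ m) ^ p ≤ K * ((ρ ^ m) ^ p * (1 / 4) ^ m) := by gcongr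
    _ = _ := by ring

/-- A moment criterion for almost sure Hölder regularity. -/
theorem ae_exists_holder_of_moments {Ω : Type*} [MeasurableSpace Ω] {P : Measure Ω}
    {f : Ω → ℝ → ℝ} (hfc : ∀ ω, Continuous (f ω)) (hfm : ∀ x, Measurable fun ω => f ω x)
    {γ K u : ℝ} (hγ : 0 < γ) {p : ℕ} (hp0 : p ≠ 0)
    (hmom : ∀ m j : ℕ, ∫⁻ ω, ENNReal.ofReal ((|f ω (u + (j + 1 : ℕ) / 2 ^ m) -
      f ω (u + (j : ℕ) / 2 ^ m)| / ((2 : ℝ) ^ (-γ)) ^ m) ^ p) ∂P ≤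
        ENNReal.ofReal (K * (1 / 4) ^ m)) :
    ∀ᵐ ω ∂P, ∃ C : ℝ, 0 ≤ C ∧ ∀ x ∈ Icc u (u + 1), ∀ y ∈ Icc u (u + 1),
      |f ω x - f ω y| ≤ C * |x - y| ^ γ := by
  have hρ0 : (0 : ℝ) < 2 ^ (-γ) := by positivity
  generalize hρ : (2 : ℝ) ^ (-γ) = ρ at *
  obtain ⟨Δ, hΔ⟩ : ∃ Δ : ℕ → ℕ → Ω → ℝ, ∀ m j ω, Δ m j ω =
    |f ω (u + (j + 1 : ℕ) / 2 ^ m) - f ω (u + (j : ℕ) / 2 ^ m)| := ⟨_, fun _ _ _ => rfl⟩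
  simp only [← hΔ] at hmom
  have hΔm : ∀ m j, Measurable (Δ m j) := fun m j => by
    have : Δ m j = fun ω => |f ω (u + (j + 1 : ℕ) / 2 ^ m) - f ω (u + (j : ℕ) / 2 ^ m)| :=
      funext (hΔ m j)
    rw [this]
    exact continuous_abs.measurable.comp ((hfm _).sub (hfm _))
  have htm : ∀ m j, Measurable fun ω => ENNReal.ofReal ((Δ m j ω / ρ ^ m) ^ p) := fun m j =>
    (((hΔm m j).div_const _).pow_const p).ennreal_ofReal
  have hsumm : ∀ m, Measurable fun ω =>
      ∑ j ∈ Finset.range (2 ^ m), ENNReal.ofReal ((Δ m j ω / ρ ^ m) ^ p) := fun m =>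
    Finset.measurable_sum _ fun j _ => htm m j
  have hblock : ∀ m, ∫⁻ ω, ∑ j ∈ Finset.range (2 ^ m),
      ENNReal.ofReal ((Δ m j ω / ρ ^ m) ^ p) ∂P ≤ ENNReal.ofReal (K * (1 / 2) ^ m) := by
    intro m
    rw [lintegral_finsetSum _ fun j _ => htm m j]
    refine (Finset.sum_le_sum fun j _ => hmom m j).trans (le_of_eq ?_)
    rw [Finset.sum_const, Finset.card_range, nsmul_eq_mul, ← ENNReal.ofReal_natCast,
      ← ENNReal.ofReal_mul (by positivity)]
    congr 1
    push_cast
    rw [mul_left_comm, ← mul_pow]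
    norm_num
  -- The sum of all rescaled moments has finite expectation, so almost surely it is finite and
  -- bounds every rescaled increment at once.
  have hfin : ∫⁻ ω, ∑' m, ∑ j ∈ Finset.range (2 ^ m),
      ENNReal.ofReal ((Δ m j ω / ρ ^ m) ^ p) ∂P ≠ ∞ := by
    rw [lintegral_tsum fun m => (hsumm m).aemeasurable]
    have hgeo : Summable fun m : ℕ => K * (1 / 2 : ℝ) ^ m := summable_geometric_two.mul_left K
    exact ne_top_of_le_ne_top hgeo.tsum_ofReal_ne_top (ENNReal.tsum_le_tsum hblock)
  filter_upwards [ae_lt_top (Measurable.tsum hsumm) hfin] with ω hω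
  -- The maximum with 1 removes the power p: a ratio above one is at most its p-th power.
  refine exists_holder_of_dyadic (hfc ω) (C := max 1 (∑' m, ∑ j ∈ Finset.range (2 ^ m),
      ENNReal.ofReal ((Δ m j ω / ρ ^ m) ^ p)).toReal) (by positivity) hγ fun m j hj => ?_
  rw [hρ, ← div_le_iff₀ (by positivity), ← hΔ]
  have hle : ENNReal.ofReal ((Δ m j ω / ρ ^ m) ^ p) ≤ ∑' m, ∑ j ∈ Finset.range (2 ^ m),
      ENNReal.ofReal ((Δ m j ω / ρ ^ m) ^ p) :=
    (Finset.single_le_sum (f := fun j => ENNReal.ofReal ((Δ m j ω / ρ ^ m) ^ p))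
      (fun _ _ => zero_le) (Finset.mem_range.2 hj)).trans (ENNReal.le_tsum m)
  have hle' := (ENNReal.ofReal_le_iff_le_toReal hω.ne).1 hle
  rcases le_total (Δ m j ω / ρ ^ m) 1 with h1 | h1
  · exact h1.trans (le_max_left _ _)
  · exact (le_self_pow₀ h1 hp0).trans (hle'.trans (le_max_right _ _))

variable {Ω : Type*} [MeasurableSpace Ω] {P : Measure Ω} [IsProbabilityMeasure P]
  {θ : ℕ → Ω → ℝ} {a lam : ℕ → ℝ} {q : ℝ}

theorem ae_exists_holder_sineSeries (hθ : ∀ n, Measurable (θ n)) (hindep : iIndepFun θ P)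
    (hunif : ∀ n, pdf.IsUniform (θ n) (Icc (0 : ℝ) 1) P volume)
    (ha : Summable fun n => |a n|) (hlam : ∀ n, 1 ≤ lam n) (hq : 1 < q) {σ γ : ℝ}
    (hσ : lowerExponent a lam q = (σ : EReal)) (hσ1 : σ ≤ 1) (hγ : 0 < γ) (hγσ : γ < σ) (u : ℝ) :
    ∀ᵐ ω ∂P, ∃ C : ℝ, 0 ≤ C ∧ ∀ x ∈ Icc u (u + 1), ∀ y ∈ Icc u (u + 1),
      |sineSeries a lam θ ω x - sineSeries a lam θ ω y| ≤ C * |x - y| ^ γ := by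
  obtain ⟨γ', hγγ', hγ'σ⟩ := exists_between hγσ
  obtain ⟨V, hV, hsub⟩ := exists_hasSubgaussianMGF_sineSeries_sub hθ hindep hunif ha hlam hq hσ
    (hγ.le.trans hγγ'.le) hγ'σ (hγ'σ.le.trans hσ1)
  obtain ⟨p, hp⟩ := exists_nat_gt (2 / (γ' - γ))
  have hγd : 0 < γ' - γ := by linarith
  have hp2 : 2 ≤ p * (γ' - γ) := by
    rw [div_lt_iff₀ hγd] at hp; exact hp.le
  have hp0 : p ≠ 0 := by
    rintro rfl
    rw [Nat.cast_zero, zero_mul] at hp2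
    linarith
  have hSm := measurable_sineSeries hθ ha lam
  refine ae_exists_holder_of_moments (continuous_sineSeries ha lam θ) hSm hγ
    (K := p.factorial * 4 * √(V : ℝ) ^ p) hp0 fun m j => ?_
  have hxy : |u + ((j + 1 : ℕ) : ℝ) / 2 ^ m - (u + (j : ℕ) / 2 ^ m)| = (2⁻¹ : ℝ) ^ m := by
    have : u + ((j + 1 : ℕ) : ℝ) / 2 ^ m - (u + (j : ℕ) / 2 ^ m) = (2⁻¹ : ℝ) ^ m := by
      rw [inv_pow]; push_cast; ring
    rw [this, abs_of_pos (by positivity)]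
  have hh := hsub (u + ((j + 1 : ℕ) : ℝ) / 2 ^ m) (u + (j : ℕ) / 2 ^ m)
  rw [hxy] at hh
  exact lintegral_rescaled_pow_le ((hSm _).sub (hSm _)) hV hp2 hh

end Holder

/-! ### Expected energy and the almost sure lower bound. -/

section LowerBound

variable {Ω : Type*} [MeasurableSpace Ω] {P : Measure Ω}

/-- Expected Riesz kernel along the graph: below the critical exponent one. -/
theorem lintegral_rpow_neg_abs_le_of_lt_one [IsProbabilityMeasure P] {Z : Ω → ℝ} (hZ : Measurable Z) {D h τ t : ℝ}
    (hD : 0 < D) (hh : 0 < h) (ht : 0 < t) (ht1 : t < 1)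
    (hball : ∀ r, 0 < r → P {ω | |Z ω| ≤ r} ≤ ENNReal.ofReal (D * r / h ^ τ)) :
    ∫⁻ ω, ENNReal.ofReal (max h |Z ω|) ^ (-t) ∂P ≤
      ENNReal.ofReal ((1 + D / (1 / t - 1)) * h ^ (-(τ * t))) := by
  have h1t : 1 < 1 / t := by rwa [lt_div_iff₀ ht, one_mul]
  have hT : 0 < h ^ (-(τ * t)) := Real.rpow_pos_of_pos hh _
  -- The level T = h^(-τt) balances the two terms of the layer-cake bound.
  have key := lintegral_rpow_neg_le_of_lt (μ := P) (f := fun ω => |Z ω|)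
    (continuous_abs.measurable.comp hZ) (fun ω => abs_nonneg _) (B := D / h ^ τ) (κ := 1)
    (α := t) (T := h ^ (-(τ * t))) (by positivity) ht ht1 hT fun r hr => by
      rw [Real.rpow_one, div_mul_eq_mul_div]; exact hball r hr
  refine le_trans (lintegral_mono fun ω => ?_) (key.trans ?_)
  · rw [ENNReal.rpow_neg, ENNReal.rpow_neg, ENNReal.inv_le_inv]
    exact ENNReal.rpow_le_rpow (ENNReal.ofReal_le_ofReal (le_max_right _ _)) ht.le
  · rw [measure_univ, mul_one, ← ENNReal.ofReal_add hT.le]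
    · refine ENNReal.ofReal_le_ofReal (le_of_eq ?_)
      have e : (h ^ (-(τ * t))) ^ (1 - 1 / t) = h ^ (-(τ * t)) * h ^ τ := by
        rw [← Real.rpow_mul hh.le, ← Real.rpow_add hh]
        congr 1
        field_simp
        ring
      rw [e]
      have := (Real.rpow_pos_of_pos hh τ).ne'
      have h2 : 1 / t - 1 ≠ 0 := by linarith
      field_simp
    · have : 0 < 1 / t - 1 := by linarith
      positivity

/-- Expected Riesz kernel along the graph: above the critical exponent one. -/
theorem lintegral_rpow_neg_abs_le_of_one_lt {Z : Ω → ℝ} (hZ : Measurable Z) {D h τ t : ℝ}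
    (hD : 0 < D) (hh : 0 < h) (ht1 : 1 < t)
    (hball : ∀ r, 0 < r → P {ω | |Z ω| ≤ r} ≤ ENNReal.ofReal (D * r / h ^ τ)) :
    ∫⁻ ω, ENNReal.ofReal (max h |Z ω|) ^ (-t) ∂P ≤
      ENNReal.ofReal (D / (1 - 1 / t) * h ^ (-(t + τ - 1))) := by
  have key := lintegral_rpow_neg_le_of_gt (μ := P) (f := fun ω => max h |Z ω|)
    (measurable_const.max (continuous_abs.measurable.comp hZ)) hh (fun ω => le_max_left _ _)
    (B := D / h ^ τ) (κ := 1) (α := t) (by positivity) one_pos ht1 fun r hr => by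
      rw [Real.rpow_one, div_mul_eq_mul_div]
      exact (measure_mono fun ω (hω : max h |Z ω| ≤ r) => (le_max_right _ _).trans hω).trans
        (hball r hr)
  refine key.trans (ENNReal.ofReal_le_ofReal (le_of_eq ?_))
  have e : h ^ (-(t + τ - 1)) = h ^ (1 - t) / h ^ τ := by
    rw [← Real.rpow_sub hh]
    congr 1
    ring
  rw [e]
  ring

variable {θ : ℕ → Ω → ℝ} {a lam : ℕ → ℝ} {q : ℝ}

/-- Fubini bounds the expected energy of a Frostman measure of exponent s, whose potential of order
α < s is uniformly bounded. The constant R absorbs pairs of points that are not close. -/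
theorem ae_le_dimH_image_of_kernel [IsProbabilityMeasure P] {X : Type*} [MetricSpace X]
    [MeasurableSpace X] [BorelSpace X] [SecondCountableTopology X] {G : Ω → ℝ → X} (hG : Measurable fun p : Ω × ℝ => G p.1 p.2)
    {A : Set ℝ} (hA : MeasurableSet A) {s t α E : ℝ} {R : ℝ≥0∞} (hR : R ≠ ∞) (ht : 0 < t)
    (hα : 0 < α) (hαs : α < s) (hs : ENNReal.ofReal s < dimH A)
    (hker : ∀ x y, ∫⁻ ω, edist (G ω x) (G ω y) ^ (-t) ∂P ≤
      ENNReal.ofReal E * ENNReal.ofReal |x - y| ^ (-α) + R) :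
    ∀ᵐ ω ∂P, ENNReal.ofReal t ≤ dimH (G ω '' A) := by
  obtain ⟨μ, hμ, hμA, C, hC, hball⟩ := exists_frostman hA (hα.trans hαs) hs
  obtain ⟨k, hk⟩ : ∃ k : (Ω × ℝ) × ℝ → ℝ≥0∞,
      k = fun p => edist (G p.1.1 p.1.2) (G p.1.1 p.2) ^ (-t) := ⟨_, rfl⟩
  have hke : ∀ ω x y, edist (G ω x) (G ω y) ^ (-t) = k ((ω, x), y) := fun ω x y => by rw [hk]
  have hkm : Measurable k := by
    rw [hk]
    have h1 : Measurable fun p : (Ω × ℝ) × ℝ => G p.1.1 p.1.2 := hG.comp measurable_fst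
    have h2 : Measurable fun p : (Ω × ℝ) × ℝ => G p.1.1 p.2 :=
      hG.comp ((measurable_fst.comp measurable_fst).prodMk measurable_snd)
    exact (h1.edist h2).pow_const _
  simp only [hke] at hker
  set M : ℝ≥0∞ := ENNReal.ofReal 1 * μ univ +
    ENNReal.ofReal (C * ((1 : ℝ) ^ (1 - s / α) / (s / α - 1))) with hM
  have hMfin : M ≠ ∞ := by
    rw [hM]
    exact ENNReal.add_ne_top.2 ⟨ENNReal.mul_ne_top ENNReal.ofReal_ne_top (measure_ne_top μ _),
      ENNReal.ofReal_ne_top⟩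
  have hpot : ∀ x, ∫⁻ y, ENNReal.ofReal |x - y| ^ (-α) ∂μ ≤ M := by
    intro x
    refine lintegral_rpow_neg_le_of_lt (f := fun y => |x - y|) ?_ (fun y => abs_nonneg _) hC.le hα
      hαs one_pos fun r hr => ?_
    · fun_prop
    · refine le_trans (measure_mono fun y (hy : |x - y| ≤ r) => ?_) (hball x r hr)
      rw [Metric.mem_closedBall, Real.dist_eq, abs_sub_comm]
      exact hy
  have hm1 : Measurable fun p : Ω × ℝ => ∫⁻ y, k (p, y) ∂μ := hkm.lintegral_prod_right'
  have htotal : ∫⁻ ω, ∫⁻ x, ∫⁻ y, k ((ω, x), y) ∂μ ∂μ ∂P ≠ ∞ := by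
    rw [lintegral_lintegral_swap (f := fun ω x => ∫⁻ y, k ((ω, x), y) ∂μ) hm1.aemeasurable]
    have hbound : ∀ x, ∫⁻ ω, ∫⁻ y, k ((ω, x), y) ∂μ ∂P ≤ ENNReal.ofReal E * M + R * μ univ := by
      intro x
      have hm : Measurable fun p : Ω × ℝ => k ((p.1, x), p.2) :=
        hkm.comp ((measurable_fst.prodMk measurable_const).prodMk measurable_snd)
      rw [lintegral_lintegral_swap (f := fun ω y => k ((ω, x), y)) hm.aemeasurable]
      refine (lintegral_mono fun y => hker x y).trans ?_
      rw [lintegral_add_right _ measurable_const, lintegral_const,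
        lintegral_const_mul' _ _ ENNReal.ofReal_ne_top]
      gcongr
      exact hpot x
    refine ne_top_of_le_ne_top ?_ (lintegral_mono hbound)
    rw [lintegral_const]
    exact ENNReal.mul_ne_top (ENNReal.add_ne_top.2
      ⟨ENNReal.mul_ne_top ENNReal.ofReal_ne_top hMfin,
        ENNReal.mul_ne_top hR (measure_ne_top μ _)⟩) (measure_ne_top μ _)
  have hmeas : Measurable fun ω => ∫⁻ x, ∫⁻ y, k ((ω, x), y) ∂μ ∂μ := hm1.lintegral_prod_right'
  filter_upwards [ae_lt_top hmeas htotal] with ω hω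
  simp only [← hke] at hω
  exact le_dimH_image_of_energy (hG.comp measurable_prodMk_left) hA hμA ht hω.ne

theorem measurable_graph_sineSeries (hθ : ∀ n, Measurable (θ n)) (ha : Summable fun n => |a n|) :
    Measurable fun p : Ω × ℝ =>
      (!₂[p.2, sineSeries a lam θ p.1 p.2] : EuclideanSpace ℝ (Fin 2)) := by
  have hpair : Measurable fun p : ℝ × ℝ => (!₂[p.1, p.2] : EuclideanSpace ℝ (Fin 2)) := by
    refine Continuous.measurable ?_
    refine (PiLp.continuous_toLp 2 _).comp (continuous_pi fun i => ?_)
    fin_cases i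
    · exact continuous_fst
    · exact continuous_snd
  have hS := measurable_sineSeries_comp hθ ha lam (g := Prod.fst) (x := Prod.snd)
    (measurable_fst (α := Ω) (β := ℝ)) measurable_snd
  exact hpair.comp (g := fun p : ℝ × ℝ => (!₂[p.1, p.2] : EuclideanSpace ℝ (Fin 2)))
    (f := fun p : Ω × ℝ => (p.2, sineSeries a lam θ p.1 p.2)) (measurable_snd.prodMk hS)

theorem ae_le_dimH_graphOver_of_kernel [IsProbabilityMeasure P] (hθ : ∀ n, Measurable (θ n))
    (ha : Summable fun n => |a n|)
    {A : Set ℝ} (hA : MeasurableSet A) {s t α E h₀ : ℝ} (ht : 0 < t) (hα : 0 < α) (hαs : α < s)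
    (hE : 0 < E) (hh₀ : 0 < h₀) (hs : ENNReal.ofReal s < dimH A)
    (hker : ∀ x y, 0 < |x - y| → |x - y| ≤ h₀ →
      ∫⁻ ω, ENNReal.ofReal (max |x - y| |sineSeries a lam θ ω x - sineSeries a lam θ ω y|) ^ (-t) ∂P
        ≤ ENNReal.ofReal (E * |x - y| ^ (-α))) :
    ∀ᵐ ω ∂P, ENNReal.ofReal t ≤ dimH (graphOver (sineSeries a lam θ ω) A) := by
  have hR : ENNReal.ofReal h₀ ^ (-t) ≠ ∞ := by
    rw [ENNReal.ofReal_rpow_of_pos hh₀]; exact ENNReal.ofReal_ne_top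
  refine ae_le_dimH_image_of_kernel
    (G := fun ω x => (!₂[x, sineSeries a lam θ ω x] : EuclideanSpace ℝ (Fin 2)))
    (measurable_graph_sineSeries hθ ha) hA (E := E) hR ht hα hαs hs fun x y => ?_
  have hle : ∀ ω, edist (!₂[x, sineSeries a lam θ ω x] : EuclideanSpace ℝ (Fin 2))
      !₂[y, sineSeries a lam θ ω y] ^ (-t) ≤
      ENNReal.ofReal (max |x - y| |sineSeries a lam θ ω x - sineSeries a lam θ ω y|) ^ (-t) := by
    intro ω
    rw [ENNReal.rpow_neg, ENNReal.rpow_neg, ENNReal.inv_le_inv, edist_dist]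
    exact ENNReal.rpow_le_rpow (ENNReal.ofReal_le_ofReal
      (EuclideanSpace.max_le_dist_pair _ _ _ _)) ht.le
  -- On the diagonal the right-hand side is ∞, so nothing is to be proved there.
  rcases (abs_nonneg (x - y)).eq_or_lt with h0 | h0
  · rw [← h0, ENNReal.ofReal_zero, ENNReal.zero_rpow_of_neg (by linarith),
      ENNReal.mul_top (ENNReal.ofReal_pos.2 hE).ne', top_add]
    exact le_top
  · rcases le_total |x - y| h₀ with h1 | h1
    · refine ((lintegral_mono hle).trans (hker x y h0 h1)).trans (le_trans ?_ le_self_add)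
      rw [ENNReal.ofReal_mul hE.le, ENNReal.ofReal_rpow_of_pos h0]
    · refine le_trans ?_ le_add_self
      refine (lintegral_mono (g := fun _ => ENNReal.ofReal h₀ ^ (-t)) fun ω =>
        (hle ω).trans ?_).trans ?_
      · rw [ENNReal.rpow_neg, ENNReal.rpow_neg, ENNReal.inv_le_inv]
        exact ENNReal.rpow_le_rpow (ENNReal.ofReal_le_ofReal (h1.trans (le_max_left _ _))) ht.le
      · rw [lintegral_const, measure_univ, mul_one]

theorem ae_le_dimH_graphOver [IsProbabilityMeasure P] (hθ : ∀ n, Measurable (θ n))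
    (hindep : iIndepFun θ P)
    (hunif : ∀ n, pdf.IsUniform (θ n) (Icc (0 : ℝ) 1) P volume)
    (ha : Summable fun n => |a n|) (hq : 1 < q) {τ : ℝ}
    (hτ : upperExponent a lam q = (τ : EReal)) (hτ0 : 0 ≤ τ) (hτ1 : τ ≤ 1)
    {A : Set ℝ} (hA : MeasurableSet A) {t : ℝ} (ht : 0 < t)
    (h1 : t * τ < (dimH A).toReal) (h2 : t < (dimH A).toReal + 1 - τ) :
    ∀ᵐ ω ∂P, ENNReal.ofReal t ≤ dimH (graphOver (sineSeries a lam θ ω) A) := by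
  set δ := (dimH A).toReal with hδ
  have hfin : dimH A ≠ ∞ := Real.dimH_ne_top A
  -- Neither kernel estimate covers t = 1. The hypotheses are open in t, so a slightly larger
  -- exponent satisfies them too and gives a stronger conclusion.
  wlog ht1 : t ≠ 1 generalizing t
  · rw [not_not] at ht1
    subst ht1
    have hlt : τ < δ := by linarith
    have := this (t := 1 + (δ - τ) / 2) (by linarith) (by nlinarith) (by linarith) (by linarith)
    filter_upwards [this] with ω hω
    exact (ENNReal.ofReal_le_ofReal (by linarith)).trans hω
  have hs : ∀ {s}, 0 < s → s < δ → ENNReal.ofReal s < dimH A := fun {s} hs0 hsδ => by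
    rw [← ENNReal.ofReal_toReal hfin]
    exact (ENNReal.ofReal_lt_ofReal_iff (hs0.trans hsδ)).2 hsδ
  have hZ : ∀ x y, Measurable fun ω => sineSeries a lam θ ω x - sineSeries a lam θ ω y :=
    fun x y => (measurable_sineSeries hθ ha lam x).sub (measurable_sineSeries hθ ha lam y)
  rcases lt_or_gt_of_ne ht1 with ht1 | ht1
  · obtain ⟨s, hs1, hs2⟩ := exists_between h1
    have hs0 : 0 < s := (by positivity : 0 ≤ t * τ).trans_lt hs1
    -- Room for both losses: s below dim A for Frostman, τ' above τ for the small balls, still with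
    -- τ't < s.
    obtain ⟨τ', hτ'1, hτ'2⟩ := exists_between ((lt_div_iff₀' ht).2 hs1)
    have hτ'0 : 0 < τ' := hτ0.trans_lt hτ'1
    obtain ⟨D, h₀, hD, hh₀, hball⟩ :=
      exists_measure_abs_sineSeries_sub_le hθ hindep hunif ha hq hτ hτ'1 hτ'0
    have h3 : 0 < 1 / t - 1 := by
      have : 1 < 1 / t := by rwa [lt_div_iff₀ ht, one_mul]
      linarith
    refine ae_le_dimH_graphOver_of_kernel hθ ha hA (α := τ' * t) ht (by positivity)
      ((lt_div_iff₀ ht).1 hτ'2) (E := 1 + D / (1 / t - 1)) (by positivity) hh₀ (hs hs0 hs2)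
      fun x y hxy hxy0 => ?_
    exact lintegral_rpow_neg_abs_le_of_lt_one (hZ x y) hD hxy ht ht1 (hball x y hxy hxy0)
  · obtain ⟨s, hs1, hs2⟩ := exists_between (show t + τ - 1 < δ by linarith)
    have hs0 : 0 < s := by linarith
    obtain ⟨τ', hτ'1, hτ'2⟩ := exists_between (show τ < s + 1 - t by linarith)
    have hτ'0 : 0 < τ' := hτ0.trans_lt hτ'1
    obtain ⟨D, h₀, hD, hh₀, hball⟩ :=
      exists_measure_abs_sineSeries_sub_le hθ hindep hunif ha hq hτ hτ'1 hτ'0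
    have h3 : 0 < 1 - 1 / t := by
      have : 1 / t < 1 := by rwa [div_lt_one ht]
      linarith
    refine ae_le_dimH_graphOver_of_kernel hθ ha hA (α := t + τ' - 1) ht (by linarith)
      (by linarith) (E := D / (1 - 1 / t)) (by positivity) hh₀ (hs hs0 hs2)
      fun x y hxy hxy0 => ?_
    exact lintegral_rpow_neg_abs_le_of_one_lt (hZ x y) hD hxy ht1 (hball x y hxy hxy0)

/-- An almost sure lower bound follows from its rational approximations. -/
theorem ae_le_of_forall_ofReal_lt {b : ℝ≥0∞} {X : Ω → ℝ≥0∞}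
    (h : ∀ t : ℝ, 0 < t → ENNReal.ofReal t < b → ∀ᵐ ω ∂P, ENNReal.ofReal t ≤ X ω) :
    ∀ᵐ ω ∂P, b ≤ X ω := by
  have hall : ∀ᵐ ω ∂P, ∀ t : ℚ, 0 < (t : ℝ) → ENNReal.ofReal t < b → ENNReal.ofReal t ≤ X ω := by
    rw [ae_all_iff]
    intro t
    by_cases ht : 0 < (t : ℝ)
    · by_cases htb : ENNReal.ofReal t < b
      · filter_upwards [h t ht htb] with ω hω _ _ using hω
      · exact Eventually.of_forall fun ω _ h' => absurd h' htb
    · exact Eventually.of_forall fun ω h' => absurd h' ht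
  filter_upwards [hall] with ω hω
  by_contra! hlt
  obtain ⟨t, ht0, ht1, ht2⟩ := ENNReal.lt_iff_exists_rat_btwn.1 hlt
  refine absurd (hω t ?_ ht2) (not_le.2 ht1)
  by_contra! hle
  have : Real.toNNReal t = 0 := Real.toNNReal_of_nonpos hle
  rw [this] at ht1
  exact absurd ht1 (by simp)

end LowerBound

/-! ### Localization and the main theorem. -/

theorem graphOver_iUnion {ι : Type*} (f : ℝ → ℝ) (A : ι → Set ℝ) :
    graphOver f (⋃ i, A i) = ⋃ i, graphOver f (A i) := image_iUnion

/-- Countable stability of the dimension lets the Hölder constant depend on the unit interval. -/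
theorem dimH_graphOver_le_of_locally {f : ℝ → ℝ} {A : Set ℝ} {γ : ℝ} (hγ : 0 < γ) (hγ1 : γ ≤ 1)
    (hf : ∀ N : ℤ, ∃ C : ℝ, 0 ≤ C ∧ ∀ x ∈ Icc (N : ℝ) (N + 1), ∀ y ∈ Icc (N : ℝ) (N + 1),
      |f x - f y| ≤ C * |x - y| ^ γ) :
    dimH (graphOver f A) ≤ dimH A / ENNReal.ofReal γ ∧
      dimH (graphOver f A) ≤ dimH A + 1 - ENNReal.ofReal γ := by
  have hA : A = ⋃ N : ℤ, A ∩ Icc (N : ℝ) (N + 1) := by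
    rw [← inter_iUnion, eq_comm, inter_eq_left]
    exact fun x _ => mem_iUnion.2 ⟨⌊x⌋, Int.floor_le x, (Int.lt_floor_add_one x).le⟩
  have hG : dimH (graphOver f A) = ⨆ N : ℤ, dimH (graphOver f (A ∩ Icc (N : ℝ) (N + 1))) := by
    conv_lhs => rw [hA, graphOver_iUnion, dimH_iUnion]
  have hmono : ∀ N : ℤ, dimH (A ∩ Icc (N : ℝ) (N + 1)) ≤ dimH A :=
    fun N => dimH_mono inter_subset_left
  rw [hG]
  refine ⟨iSup_le fun N => ?_, iSup_le fun N => ?_⟩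
  · obtain ⟨C, hC, h⟩ := hf N
    refine (dimH_graphOver_le_div hC hγ hγ1 inter_subset_right
      fun x hx y hy => h x hx.2 y hy.2).trans ?_
    exact ENNReal.div_le_div_right (hmono N) _
  · obtain ⟨C, hC, h⟩ := hf N
    refine (dimH_graphOver_le_add hC hγ.le hγ1 fun x hx y hy => h x hx.2 y hy.2).trans ?_
    exact tsub_le_tsub_right (add_le_add (hmono N) le_rfl) _

theorem theorem5p7 {Ω : Type*} [MeasurableSpace Ω] (P : Measure Ω) [IsProbabilityMeasure P]
    (θ : ℕ → Ω → ℝ) (hθmeas : ∀ n, Measurable (θ n)) (hθindep : iIndepFun θ P)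
    (hθunif : ∀ n, pdf.IsUniform (θ n) (Icc (0 : ℝ) 1) P volume)
    (a : ℕ → ℝ) (ha : Summable fun n => |a n|)
    (lam : ℕ → ℝ) (hlam : Monotone lam) (hlam0 : lam 0 = 1)
    (q : ℝ) (hq : IsLUB (range fun n => lam (n + 1) / lam n) q) (hq1 : 1 < q)
    (σ τ : ℝ) (hσ : lowerExponent a lam q = (σ : EReal))
    (hτ : upperExponent a lam q = (τ : EReal))
    (A : Set ℝ) (hA : MeasurableSet A) :
    (0 < σ → σ ≤ τ → τ ≤ 1 →
      ∀ᵐ ω ∂P,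
        min (dimH A / ENNReal.ofReal τ) (dimH A + 1 - ENNReal.ofReal τ)
            ≤ dimH (graphOver (sineSeries a lam θ ω) A) ∧
        dimH (graphOver (sineSeries a lam θ ω) A)
            ≤ min (dimH A / ENNReal.ofReal σ) (dimH A + 1 - ENNReal.ofReal σ)) ∧
    (τ = 0 → 0 < dimH A →
      ∀ᵐ ω ∂P, dimH (graphOver (sineSeries a lam θ ω) A) = 1 + dimH A) := by
  have hlam1 : ∀ n, 1 ≤ lam n := fun n => hlam0 ▸ hlam (Nat.zero_le n)
  have hfin : dimH A ≠ ∞ := Real.dimH_ne_top A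
  obtain ⟨δ, hδ⟩ : ∃ δ, δ = (dimH A).toReal := ⟨_, rfl⟩
  have hδ0 : 0 ≤ δ := hδ ▸ ENNReal.toReal_nonneg
  have hdim : dimH A = ENNReal.ofReal δ := by rw [hδ, ENNReal.ofReal_toReal hfin]
  have hadd : ∀ γ, 0 ≤ γ → dimH A + 1 - ENNReal.ofReal γ = ENNReal.ofReal (δ + 1 - γ) := by
    intro γ hγ
    rw [hdim, ENNReal.ofReal_sub _ hγ, ENNReal.ofReal_add hδ0 zero_le_one, ENNReal.ofReal_one]
  have hdiv : ∀ γ, 0 < γ → dimH A / ENNReal.ofReal γ = ENNReal.ofReal (δ / γ) := by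
    intro γ hγ
    rw [hdim, ENNReal.ofReal_div_of_pos hγ]
  refine ⟨fun hσ0 hστ hτ1 => ?_, fun hτ0 hpos => ?_⟩
  · have hτ0 : 0 < τ := hσ0.trans_le hστ
    have hσ1 : σ ≤ 1 := hστ.trans hτ1
    have hlower : ∀ᵐ ω ∂P, min (dimH A / ENNReal.ofReal τ) (dimH A + 1 - ENNReal.ofReal τ)
        ≤ dimH (graphOver (sineSeries a lam θ ω) A) := by
      refine ae_le_of_forall_ofReal_lt fun t ht htb => ?_
      rw [hdiv τ hτ0, hadd τ hτ0.le, lt_min_iff] at htb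
      have h1 := (ENNReal.ofReal_lt_ofReal_iff_of_nonneg ht.le).1 htb.1
      have h2 := (ENNReal.ofReal_lt_ofReal_iff_of_nonneg ht.le).1 htb.2
      rw [lt_div_iff₀ hτ0] at h1
      exact ae_le_dimH_graphOver hθmeas hθindep hθunif ha hq1 hτ hτ0.le hτ1 hA ht
        (hδ ▸ h1) (hδ ▸ h2)
    -- Hölder regularity holds only for exponents below σ; a sequence increasing to σ keeps the
    -- exceptional null set common to all of them.
    obtain ⟨γ, -, hγσ, hγlim⟩ := exists_seq_strictMono_tendsto σ
    have hholder : ∀ᵐ ω ∂P, ∀ (n : ℕ) (N : ℤ), 0 < γ n → ∃ C : ℝ, 0 ≤ C ∧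
        ∀ x ∈ Icc (N : ℝ) (N + 1), ∀ y ∈ Icc (N : ℝ) (N + 1),
          |sineSeries a lam θ ω x - sineSeries a lam θ ω y| ≤ C * |x - y| ^ γ n := by
      rw [ae_all_iff]
      intro n
      rw [ae_all_iff]
      intro N
      by_cases h0 : 0 < γ n
      · filter_upwards [ae_exists_holder_sineSeries hθmeas hθindep hθunif ha hlam1 hq1 hσ hσ1 h0
          (hγσ n) N] with ω hω _ using hω
      · exact Eventually.of_forall fun ω h' => absurd h' h0
    filter_upwards [hlower, hholder] with ω hω1 hω2
    refine ⟨hω1, ?_⟩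
    have hev : ∀ᶠ n in atTop, 0 < γ n := hγlim.eventually (lt_mem_nhds hσ0)
    have hn : ∀ n, 0 < γ n → dimH (graphOver (sineSeries a lam θ ω) A) ≤
        ENNReal.ofReal (δ / γ n) ∧ dimH (graphOver (sineSeries a lam θ ω) A) ≤
          ENNReal.ofReal (δ + 1 - γ n) := by
      intro n h0
      rw [← hdiv _ h0, ← hadd _ h0.le]
      exact dimH_graphOver_le_of_locally h0 ((hγσ n).le.trans hσ1) fun N => hω2 n N h0
    rw [hdiv σ hσ0, hadd σ hσ0.le]
    refine le_min ?_ ?_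
    · refine ge_of_tendsto (ENNReal.tendsto_ofReal (tendsto_const_nhds.div hγlim hσ0.ne')) ?_
      filter_upwards [hev] with n h0 using (hn n h0).1
    · refine ge_of_tendsto (ENNReal.tendsto_ofReal (tendsto_const_nhds.sub hγlim)) ?_
      filter_upwards [hev] with n h0 using (hn n h0).2
  · have hδpos : 0 < δ := by
      rw [hdim, ENNReal.ofReal_pos] at hpos
      exact hpos
    have hlower : ∀ᵐ ω ∂P, 1 + dimH A ≤ dimH (graphOver (sineSeries a lam θ ω) A) := by
      refine ae_le_of_forall_ofReal_lt fun t ht htb => ?_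
      rw [hdim, ← ENNReal.ofReal_one, ← ENNReal.ofReal_add zero_le_one hδ0] at htb
      have h1 := (ENNReal.ofReal_lt_ofReal_iff_of_nonneg ht.le).1 htb
      refine ae_le_dimH_graphOver hθmeas hθindep hθunif ha hq1 hτ hτ0.ge
        (hτ0.le.trans zero_le_one) hA ht ?_ ?_
      · rw [hτ0, mul_zero, ← hδ]; exact hδpos
      · rw [hτ0, ← hδ]; linarith
    filter_upwards [hlower] with ω hω
    refine le_antisymm ?_ hω
    have hb := abs_sineSeries_le ha lam θ ω
    have hsum : 0 ≤ ∑' n, |a n| := tsum_nonneg fun n => abs_nonneg (a n)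
    -- The series is bounded by Σ |a_n|, which is the Hölder condition with exponent 0 and gives the
    -- bound dim A + 1.
    have h1 := dimH_graphOver_le_add (f := sineSeries a lam θ ω) (A := A)
      (C := 2 * ∑' n, |a n|) (γ := 0) (by positivity) le_rfl zero_le_one fun x _ y _ => by
        rw [Real.rpow_zero, mul_one]
        have := (abs_sub (sineSeries a lam θ ω x) (sineSeries a lam θ ω y)).trans
          (add_le_add (hb x) (hb y))
        linarith
    rw [ENNReal.ofReal_zero, tsub_zero, add_comm] at h1
    exact h1
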